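/- Let $\tau=e^{2i\pi/3}$ and let $\gamma>0$ be given by $\gamma^2=2\pi/\sqrt3$. Write $dL$ for Lebesgue measure on $\mathbb C$, $R_\alpha u(z)=e^{\frac12(\alpha\bar z-\bar\alpha z)}u(z+\alpha)$ for the magnetic translations, $S_\gamma=\{z\in\mathbb C:\ -\gamma/2<\operatorname{Re}z<\gamma/2\}$, and $$[\Pi u](z)=\frac1\pi e^{-\frac{|z|^2}2}\int_{\mathbb C}e^{\bar w z-\frac{|w|^2}2}u(w)\,dL(w).$$ Let $\mathcal F_\gamma$ be the space of functions $u(z)=e^{-|z|^2/2}F(z)$ with $F$ entire, $u$ of at most polynomial growth, and $R_\gamma u=u$. The space $\mathcal F_\gamma\cap L^2(S_\gamma)$ has the Hilbert basis $\psi_k=R_{k\tau\gamma}\psi_0$, $k\in\mathbb Z$, where $\psi_0(z)=\big(\frac{2}{\pi\gamma^2}\big)^{1/4}e^{\frac12z^2-\frac12|z|^2}$. Let $\Theta_\tau(z)=-i\sum_{n\in\mathbb Z}(-1)^ne^{i\pi\tau(n+1/2)^2}e^{i(2n+1)\pi z}$, $\Phi_0(z)=e^{\frac12z^2-\frac{i\pi}\gamma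 z-\frac12|z|^2}\,\Theta_\tau\big(\tfrac1\gamma(z-z_0)\big)$ with $z_0=\frac\gamma2(\tau-1)$, $c=e^{i\pi\tau/4}\big(\frac2{\pi\gamma^2}\big)^{1/4}$, and let $\Psi_0=c\,\Phi_0$ be the Abrikosov lattice. Put $\lambda=|c|^2\,\dfrac{\int_K|\Phi_0|^4\,dL}{\int_K|\Phi_0|^2\,dL}$ with $K=\{\gamma(r_1+r_2\tau):\ r_1,r_2\in[0,1]\}$. Put $$\ell(\xi)=1+2\sum_{k\ge1}e^{-\pi^2k^2/\gamma^2}\cos(2\pi k\xi),\qquad h(\xi)=2\sum_{k\ge0}e^{-\pi^2(2k+1)^2/\gamma^2}\cos\big(2(2k+1)\pi\xi\big),$$ $$a(\xi)=\tfrac{2}{\gamma\sqrt\pi}\big[\ell(\xi)\ell(0)-2h(\xi)h(0)\big]-\tfrac1{\gamma\sqrt\pi}\big[\ell(0)^2-2h(0)^2\big],\qquad b(\xi)=\tfrac1{\gamma\sqrt\pi}\big[\ell(\xi)^2-2h(\xi)^2\big].$$ **Theorem.** For every $\xi\in(0,1)$ one has $a(\xi)^2>b(\xi)^2$, and the function $\mu=(a^2-b^2)^{1/2}$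 satisfies $\mu(\xi)\sim\kappa\,\xi^2$ as $\xi\to0$, for some $\kappa>0$. Moreover, there is a constant $C<\infty$ such that the following holds. Let $v:[0,\infty)\to\mathcal F_\gamma\cap L^2(S_\gamma)$ be differentiable for the norm of $L^2(S_\gamma)$ and solve $$i\partial_tv+\lambda v=\Pi\big[2|\Psi_0|^2v+\Psi_0^2\,\bar v\big],$$ let $v(t)=\sum_{n\in\mathbb Z}c_n(t)\psi_n$, so that $c_n(t)=\int_{S_\gamma}v(t)\overline{\psi_n}\,dL$, let $f(t,\cdot)$ be the 1-periodic function $f(t,\xi)=\sum_{n\in\mathbb Z}c_n(t)e^{-2\pi in\xi}$ (convergence in $L^2([0,1])$), and let $g(t,\xi)=\overline{f(t,-\xi)}$. Write $f_0=f(0,\cdot)$ and $g_0=g(0,\cdot)$. Then for all $t\ge0$ $$\Big\|\frac{f+g}\mu\Big\|_{L^2([0,1])}+\|f\|_{L^2([0,1])}\le C\Big(\Big\|\frac{f_0+g_0}\mu\Big\|_{L^2([0,1])}+\|f_0\|_{L^2([0,1])}\Big),$$ and, more generally, for all $t\ge0$ and all $j\in\mathbb R$ $$\Big\|\frac{f+g}{\mu^{j+1}}\Big\|_{L^2([0,1])}+\Big\|\frac{f-g}{\mu^j}\Big\|_{L^2([0,1])}\le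 C\Big(\Big\|\frac{f_0+g_0}{\mu^{j+1}}\Big\|_{L^2([0,1])}+\Big\|\frac{f_0-g_0}{\mu^j}\Big\|_{L^2([0,1])}\Big),$$ where the norms take values in $[0,\infty]$. -/

import Mathlib

open MeasureTheory Filter Topology
open scoped ENNReal NNReal

noncomputable section

namespace Abrikosov

/-! ### The hexagonal lattice, theta function and the Abrikosov lattice solution -/

/-- `τ = e^{2iπ/3}`. -/
def tau : ℂ := Complex.exp (2 * Complex.I * Real.pi / 3)

/-- The positive number `γ` with `γ² = 2π/√3`. -/
def gam : ℝ := Real.sqrt (2 * Real.pi / Real.sqrt 3)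

/-- The Jacobi theta function
`Θ_τ(z) = -i ∑_{n ∈ ℤ} (-1)^n e^{iπτ(n+1/2)²} e^{i(2n+1)πz}`. -/
def theta (z : ℂ) : ℂ :=
  -Complex.I * ∑' n : ℤ, (-1 : ℂ) ^ n *
    Complex.exp (Complex.I * Real.pi * tau * ((n : ℂ) + 1 / 2) ^ 2) *
    Complex.exp (Complex.I * (2 * (n : ℂ) + 1) * Real.pi * z)

/-- `Φ₀(z) = e^{z²/2 - iπz/γ - |z|²/2} Θ_τ((z - z₀)/γ)` with `z₀ = γ(τ-1)/2`. -/
def Phi0 (z : ℂ) : ℂ :=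
  Complex.exp (z ^ 2 / 2 - Complex.I * Real.pi / gam * z - (‖z‖ : ℂ) ^ 2 / 2) *
    theta ((z - gam / 2 * (tau - 1)) / gam)

/-- `c = e^{iπτ/4} (2/(πγ²))^{1/4}`. -/
def cnorm : ℂ :=
  Complex.exp (Complex.I * Real.pi / 4 * tau) *
    (((2 / (Real.pi * gam ^ 2)) ^ (1 / 4 : ℝ) : ℝ) : ℂ)

/-- The Abrikosov lattice `Ψ₀ = c Φ₀`. -/
def Psi0 (z : ℂ) : ℂ := cnorm * Phi0 z

/-- The fundamental cell `{γ(r₁ + r₂τ) : r₁, r₂ ∈ [0,1]}`. -/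
def cell : Set ℂ :=
  {z | ∃ r₁ ∈ Set.Icc (0 : ℝ) 1, ∃ r₂ ∈ Set.Icc (0 : ℝ) 1, z = gam * (r₁ + r₂ * tau)}

/-- `λ₀ = ∫_K |Φ₀|⁴ / ∫_K |Φ₀|²`. -/
def lambda0 : ℝ := (∫ z in cell, ‖Phi0 z‖ ^ 4) / (∫ z in cell, ‖Phi0 z‖ ^ 2)

/-- `λ = λ₀ |c|²`, so that `e^{-iλt} Ψ₀` is the stationary solution of the
lowest Landau level equation. -/
def lam : ℝ := lambda0 * ‖cnorm‖ ^ 2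

/-! ### Function spaces and the projector -/

/-- The projector `Π` on the Fock-Bargmann space, through its kernel:
`(Πu)(z) = π⁻¹ e^{-|z|²/2} ∫_ℂ e^{w̄z - |w|²/2} u(w) dL(w)`. -/
def proj (u : ℂ → ℂ) (z : ℂ) : ℂ :=
  1 / (Real.pi : ℂ) * Complex.exp (-(‖z‖ : ℂ) ^ 2 / 2) *
    ∫ w : ℂ, Complex.exp ((starRingEnd ℂ) w * z - (‖w‖ : ℂ) ^ 2 / 2) * u w

/-- The magnetic translation `R_α u(z) = e^{(α z̄ - ᾱ z)/2} u(z + α)`. -/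
def magTrans (α : ℂ) (u : ℂ → ℂ) (z : ℂ) : ℂ :=
  Complex.exp ((α * (starRingEnd ℂ) z - (starRingEnd ℂ) α * z) / 2) * u (z + α)

/-- The space of functions `u(z) = e^{-|z|²/2} F(z)` with `F` entire and
`|u(z)| ≤ A (1+|z|²)^{M/2}` for some `A`, `M`. -/
def MemFock (u : ℂ → ℂ) : Prop :=
  (∃ F : ℂ → ℂ, Differentiable ℂ F ∧
    ∀ z, u z = Complex.exp (-(‖z‖ : ℂ) ^ 2 / 2) * F z) ∧
  ∃ A M : ℝ, ∀ z, ‖u z‖ ≤ A * (1 + ‖z‖ ^ 2) ^ (M / 2)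

/-- The space `𝓕_γ` of functions of the previous space that are invariant under `R_γ`. -/
def MemPeriodicFock (u : ℂ → ℂ) : Prop :=
  MemFock u ∧ magTrans gam u = u

/-- The strip `S_γ = {z : -γ/2 < Re z < γ/2}`. -/
def strip : Set ℂ := {z | -gam / 2 < z.re ∧ z.re < gam / 2}

/-- Lebesgue measure on the strip. -/
def stripMeasure : Measure ℂ := volume.restrict strip

/-- `ψ₀(z) = (2/(πγ²))^{1/4} e^{z²/2 - |z|²/2}`. -/
def psi0 (z : ℂ) : ℂ :=
  (((2 / (Real.pi * gam ^ 2)) ^ (1 / 4 : ℝ) : ℝ) : ℂ) *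
    Complex.exp (z ^ 2 / 2 - (‖z‖ : ℂ) ^ 2 / 2)

/-- The orthonormal basis `ψ_k = R_{kτγ} ψ₀`, `k ∈ ℤ`, of `𝓕_γ ∩ L²(S_γ)`. -/
def psi (k : ℤ) : ℂ → ℂ := magTrans (k * tau * gam) psi0

/-- The coordinate `c_k = ⟨u, ψ_k⟩` in `L²(S_γ)` of `u = ∑ c_k ψ_k`. -/
def coeff (u : ℂ → ℂ) (k : ℤ) : ℂ := ∫ z, u z * (starRingEnd ℂ) (psi k z) ∂stripMeasure

/-! ### The linearized equation -/

/-- The curve `v : [0,∞) → L²(S_γ)` is differentiable at `t` (one-sided at `t = 0`)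
with derivative `w`, for the norm of `L²(S_γ)`. -/
def HasStripDerivAt (v : ℝ → ℂ → ℂ) (w : ℂ → ℂ) (t : ℝ) : Prop :=
  Tendsto
    (fun s : ℝ => eLpNorm (fun z => (v s z - v t z) / ((s - t : ℝ) : ℂ) - w z) 2 stripMeasure)
    (𝓝[Set.Ici 0 \ {t}] t) (𝓝 0)

/-- `v : [0,∞) → 𝓕_γ ∩ L²(S_γ)` solves
`i ∂_t v + λ v = Π[2|Ψ₀|² v + Ψ₀² v̄]`, the linearization about the Abrikosov lattice. -/
structure IsSolution (v : ℝ → ℂ → ℂ) : Prop where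
  mem : ∀ t, 0 ≤ t → MemPeriodicFock (v t)
  memLp : ∀ t, 0 ≤ t → MemLp (v t) 2 stripMeasure
  eqn : ∀ t, 0 ≤ t → ∃ w : ℂ → ℂ, HasStripDerivAt v w t ∧
    ∀ z, Complex.I * w z + lam * v t z =
      proj (fun y => 2 * (‖Psi0 y‖ : ℂ) ^ 2 * v t y +
        Psi0 y ^ 2 * (starRingEnd ℂ) (v t y)) z

/-! ### The Fourier side -/

/-- The norm of `L²([0,1])`, with values in `[0,∞]`. -/
def normL2 (f : ℝ → ℂ) : ℝ≥0∞ := eLpNorm f 2 (volume.restrict (Set.Icc 0 1))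

/-- `f(ξ) = ∑_{n ∈ ℤ} c_n e^{-2πinξ}`: the function `f` is 1-periodic, square integrable on
`[0,1]`, and the sum of the series in `L²([0,1])`. -/
structure IsFourierSum (c : ℤ → ℂ) (f : ℝ → ℂ) : Prop where
  periodic : Function.Periodic f 1
  memLp : MemLp f 2 (volume.restrict (Set.Icc 0 1))
  tendsto : Tendsto
    (fun s : Finset ℤ => normL2 (fun ξ =>
      f ξ - ∑ n ∈ s, c n * Complex.exp (-2 * Real.pi * Complex.I * n * ξ)))
    atTop (𝓝 0)

/-- `g(ξ) = conj (f(-ξ))`. -/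
def reflect (f : ℝ → ℂ) (ξ : ℝ) : ℂ := (starRingEnd ℂ) (f (-ξ))

/-- `ℓ(ξ) = 1 + 2 ∑_{k ≥ 1} e^{-π²k²/γ²} cos(2πkξ)`. -/
def ell (ξ : ℝ) : ℝ :=
  1 + 2 * ∑' k : ℕ, Real.exp (-(Real.pi ^ 2 * ((k : ℝ) + 1) ^ 2) / gam ^ 2) *
    Real.cos (2 * Real.pi * ((k : ℝ) + 1) * ξ)

/-- `h(ξ) = 2 ∑_{k ≥ 0} e^{-π²(2k+1)²/γ²} cos(2(2k+1)πξ)`. -/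
def hodd (ξ : ℝ) : ℝ :=
  2 * ∑' k : ℕ, Real.exp (-(Real.pi ^ 2 * (2 * (k : ℝ) + 1) ^ 2) / gam ^ 2) *
    Real.cos (2 * (2 * (k : ℝ) + 1) * Real.pi * ξ)

/-- The diagonal coefficient `a(ξ)`. -/
def a (ξ : ℝ) : ℝ :=
  2 / (gam * Real.sqrt Real.pi) * (ell ξ * ell 0 - 2 * hodd ξ * hodd 0) -
    1 / (gam * Real.sqrt Real.pi) * (ell 0 ^ 2 - 2 * hodd 0 ^ 2)

/-- The off-diagonal coefficient `b(ξ)`. -/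
def b (ξ : ℝ) : ℝ :=
  1 / (gam * Real.sqrt Real.pi) * (ell ξ ^ 2 - 2 * hodd ξ ^ 2)

/-- `μ = (a² - b²)^{1/2}`. -/
def mu (ξ : ℝ) : ℝ := Real.sqrt (a ξ ^ 2 - b ξ ^ 2)

end Abrikosov

end

/-!
# Linear stability of the Abrikosov lattice

Put `s = π / γ`, the height of the lattice cell. In coordinates
`ψ_k(x + iy) = C e^{-(y + sk)²} e^{i(xy + 2skx - πk²/2)}` (`psi_eq`): each `ψ_k` is a Gaussian in
`y` centred at `-sk` times a single horizontal Fourier mode. Expanding the theta series term by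
term gives `Ψ₀ = ∑ ψ_k` (`hasSum_Psi0`). For `u ∈ 𝓕_γ`, Cauchy's theorem on rectangles shows that
at every height the `k`-th horizontal mode of `u` is a constant multiple of that of `ψ_k`, the
constant being the coefficient `⟨u, ψ_k⟩` (`MemPeriodicFock.hasModes`). This replaces any
convergence of `∑ c_k ψ_k`, and the polynomial bound on `u` makes all integrals over the strip
absolutely convergent. The projector does not change coefficients, `⟨Π N, ψ_n⟩ = ⟨N, ψ_n⟩`
(`coeff_proj`), because its kernel is Hermitian, commutes with magnetic translations and reproduces
`ψ_n`.

The quartic integrals are resonant: the horizontal integral vanishes unless momentum is conserved,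
and `∫ ψ_{n+p} ψ_{n+q} conj(ψ_{n+p+q} ψ_n) = (γ√π)⁻¹ (-1)^{pq} e^{-s²(p² + q²)}` does not depend on
`n` (`kern`, `integral_psi_conj_psi_mul`, `integral_psi_psi_mul_conj`). Hence the interaction acts
on coefficients by convolution. Since `(-1)^{pq} = 1 - 2` on pairs of odd integers and `1`
elsewhere, its Fourier multipliers are products of theta series, `ℓ ℓ - 2 h h` (`hasSum_kern`);
unfolding the cell to the strip evaluates `λ` in the same terms (`lam_eq`). So `fcoef_fourierRHS`
identifies the right-hand side with `a f + b g`, and Bessel on the strip with Parseval on `[0,1]`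
turns the differentiability of `v` into `i ∂_t f = a f + b g` in `L²([0,1])`
(`IsSolution.hasL2Deriv`).

As `a` and `b` are real and even, `p = f + g` and `m = f - g` satisfy `i ∂_t p = (a - b) m` and
`i ∂_t m = (a + b) p`, so `(a + b)|p|² + (a - b)|m|²` is constant in time at almost every `ξ`
(`energy_ae_eq`, `IsSolution.energy_ae_eq`). Now `μ² = (a - b)(a + b)`, where `a + b` lies between
two positive constants; the conservation law therefore bounds `|p| / μ` and `|m|` by the initial
values of the same two quantities, pointwise in `ξ` (`weighted_le_of_energy`). Dividing by `μ^j`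
before taking norms costs nothing, which is why one constant serves all real `j`
(`weighted_stability`); `unweighted_stability` is the case `j = 0` rewritten with
`f = (p + m) / 2`.

What remains is the symbol. One has `γ√π (a - b) = 2 (h(0) - h)² - (ℓ(0) - ℓ)²` (`a_sub_b`). Both
increments are series of terms `q^{m²} (1 - cos 2πmξ)`, with all `m ≥ 1` for `ℓ` and odd `m` for
`h`. The nome `q = e^{-π²/γ²}` is below `1/12`, so the even modes are small against the mode
`m = 1` and `ℓ(0) - ℓ ≤ (7/5) (h(0) - h)` (`ell_zero_sub_le`). As `(7/5)² < 2`, the difference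
`a - b` is positive on `(0, 1)`. Both increments being of exact order `ξ²`, the difference is of
exact order `ξ⁴` at `0`, that is, `μ ∼ κ ξ²` (`exists_tendsto_mu_div_sq`).
-/

namespace Abrikosov

noncomputable section

/-! ### The constants of the hexagonal lattice and the basis `ψ_k` in coordinates -/

/-- The spacing `π / γ` of the rows of the lattice, which is the height `γ √3 / 2` of the cell: the
Gaussian profiles of consecutive `ψ_k` are this far apart. -/
def stp : ℝ := Real.pi / gam

/-- The normalization constant of `ψ₀`. -/
def psiNorm : ℝ := (2 / (Real.pi * gam ^ 2)) ^ (1 / 4 : ℝ)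

lemma gam_pos : 0 < gam := by
  unfold gam; positivity

lemma gam_sq : gam ^ 2 = 2 * Real.pi / Real.sqrt 3 := by
  unfold gam
  rw [Real.sq_sqrt (by positivity)]

lemma gam_mul_sqrt_three : gam * Real.sqrt 3 = 2 * stp := by
  have h := gam_sq
  have h3 : (0 : ℝ) < Real.sqrt 3 := by positivity
  have hg := gam_pos
  unfold stp
  field_simp at h ⊢
  linarith

lemma stp_pos : 0 < stp := div_pos Real.pi_pos gam_pos

lemma gam_mul_stp : gam * stp = Real.pi := by
  unfold stp
  field_simp [gam_pos.ne']

lemma stp_eq : stp = gam * Real.sqrt 3 / 2 := by linarith [gam_mul_sqrt_three]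

lemma stp_sq : stp ^ 2 = Real.pi * Real.sqrt 3 / 2 := by
  rw [sq]; nth_rw 1 [stp_eq]
  linear_combination (Real.sqrt 3 / 2) * gam_mul_stp

lemma gam_sq_mul_sqrt_three : gam ^ 2 * Real.sqrt 3 = 2 * Real.pi := by
  rw [sq, mul_assoc, gam_mul_sqrt_three]; linarith [gam_mul_stp]

lemma tau_eq : tau = -1 / 2 + Complex.I * (Real.sqrt 3 / 2 : ℝ) := by
  have : 2 * Complex.I * (Real.pi : ℂ) / 3 = ((2 * Real.pi / 3 : ℝ) : ℂ) * Complex.I := by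
    push_cast; ring
  unfold tau
  rw [this, Complex.exp_mul_I, ← Complex.ofReal_cos, ← Complex.ofReal_sin]
  have e : 2 * Real.pi / 3 = Real.pi - Real.pi / 3 := by ring
  rw [e, Real.cos_pi_sub, Real.sin_pi_sub, Real.cos_pi_div_three, Real.sin_pi_div_three]
  push_cast; ring

lemma psiNorm_pos : 0 < psiNorm := by
  have := gam_pos
  unfold psiNorm; positivity

lemma psiNorm_pow_four : psiNorm ^ 4 = 2 / (Real.pi * gam ^ 2) := by
  have := gam_pos
  unfold psiNorm
  rw [← Real.rpow_natCast, ← Real.rpow_mul (by positivity)]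
  norm_num

lemma psiNorm_sq : psiNorm ^ 2 = Real.sqrt (2 / Real.pi) / gam := by
  have := gam_pos
  have h : (psiNorm ^ 2) ^ 2 = (Real.sqrt (2 / Real.pi) / gam) ^ 2 := by
    rw [← pow_mul, div_pow, Real.sq_sqrt (by positivity), psiNorm_pow_four]; field_simp
  exact (pow_left_inj₀ (by positivity) (by positivity) two_ne_zero).1 h

lemma psiNorm_sq_mul : psiNorm ^ 2 * gam * Real.sqrt (Real.pi / 2) = 1 := by
  have := gam_pos
  rw [psiNorm_sq, div_mul_cancel₀ _ this.ne', ← Real.sqrt_mul (by positivity)]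
  rw [show 2 / Real.pi * (Real.pi / 2) = 1 by field_simp, Real.sqrt_one]

lemma psiNorm_pow_four_mul :
    psiNorm ^ 4 * gam * (Real.sqrt Real.pi / 2) = 1 / (gam * Real.sqrt Real.pi) := by
  have := gam_pos
  have hp : Real.sqrt Real.pi ^ 2 = Real.pi := Real.sq_sqrt Real.pi_pos.le
  have : 0 < Real.sqrt Real.pi := by positivity
  rw [psiNorm_pow_four]
  field_simp
  linarith

lemma ofReal_sq_stp : (stp : ℂ) ^ 2 = Real.pi * Real.sqrt 3 / 2 := by
  rw [← Complex.ofReal_pow, stp_sq]; push_cast; ring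

/-- The modulus of `ψ_k` at height `y`, a Gaussian centred at `-k π / γ`. -/
def amp (k : ℤ) (y : ℝ) : ℝ := psiNorm * Real.exp (-(y + stp * k) ^ 2)

/-- The phase of `ψ_k` at `x + iy`. Up to the factor `e^{ixy}` common to all `k`, it is that of the
horizontal Fourier mode `e^{2πikx/γ}`. -/
def phase (k : ℤ) (x y : ℝ) : ℝ := x * y + 2 * stp * k * x - Real.pi * k ^ 2 / 2

lemma amp_pos (k : ℤ) (y : ℝ) : 0 < amp k y := mul_pos psiNorm_pos (Real.exp_pos _)

/-- The exponent arising both from the magnetic translation of `ψ₀` and from the `k`-th term of the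
theta series; its real part completes the square in `y + kπ/γ` because `Im τ = √3 / 2`. -/
lemma gaussian_mul_theta_term (k : ℤ) (x y : ℝ) :
    (psiNorm : ℂ) * Complex.exp (Complex.I * Real.pi * tau * k ^ 2 +
      2 * stp * k * Complex.I * (x + y * Complex.I) +
      ((x + y * Complex.I) ^ 2 / 2 - (x ^ 2 + y ^ 2) / 2)) =
    amp k y * Complex.exp (Complex.I * phase k x y) := by
  have hI : Complex.I ^ 2 = -1 := Complex.I_sq
  unfold amp phase
  push_cast
  rw [mul_assoc (psiNorm : ℂ), ← Complex.exp_add]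
  congr 2
  rw [tau_eq]
  push_cast
  linear_combination
    ((Real.pi * Real.sqrt 3 / 2 : ℂ) * k ^ 2 + 2 * stp * k * y + y ^ 2 / 2) * hI +
      (k : ℂ) ^ 2 * ofReal_sq_stp

lemma ofReal_norm_sq (z : ℂ) : (‖z‖ : ℂ) ^ 2 = (z.re : ℂ) ^ 2 + (z.im : ℂ) ^ 2 := by
  rw [← Complex.ofReal_pow, Complex.sq_norm, Complex.normSq_apply]; push_cast; ring

lemma psi_add_mul_I (k : ℤ) (x y : ℝ) :
    psi k (x + y * Complex.I) = amp k y * Complex.exp (Complex.I * phase k x y) := by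
  rw [← gaussian_mul_theta_term]
  unfold psi magTrans psi0
  rw [ofReal_norm_sq, tau_eq]
  rw [show (((2 / (Real.pi * gam ^ 2)) ^ (1 / 4 : ℝ) : ℝ) : ℂ) = (psiNorm : ℂ) from rfl]
  rw [mul_left_comm, ← Complex.exp_add]
  congr 2
  have hI : Complex.I ^ 2 = -1 := Complex.I_sq
  have h1 : (gam : ℂ) * (Real.sqrt 3 : ℝ) = 2 * stp := by exact_mod_cast gam_mul_sqrt_three
  have h2 : (gam : ℂ) ^ 2 * (Real.sqrt 3 : ℝ) = 2 * Real.pi := by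
    exact_mod_cast gam_sq_mul_sqrt_three
  simp [Complex.add_re, Complex.add_im, Complex.mul_re, Complex.mul_im, map_ofNat]
  linear_combination (k * Complex.I * (x + y * Complex.I)) * h1 +
    (Complex.I * (-1 / 2 + Complex.I * (Real.sqrt 3 / 2 : ℂ)) * k ^ 2 / 2) * h2 -
    (k * gam * (Real.sqrt 3 : ℝ) * y / 2 + k ^ 2 * gam ^ 2 * (Real.sqrt 3 : ℝ) ^ 2 / 8) * hI

lemma psi_eq (k : ℤ) (z : ℂ) :
    psi k z = amp k z.im * Complex.exp (Complex.I * phase k z.re z.im) := by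
  rw [← psi_add_mul_I, Complex.re_add_im]

lemma norm_psi (k : ℤ) (z : ℂ) : ‖psi k z‖ = amp k z.im := by
  rw [psi_eq, norm_mul, mul_comm Complex.I, Complex.norm_exp_ofReal_mul_I, mul_one,
    Complex.norm_real, Real.norm_of_nonneg (amp_pos _ _).le]

lemma conj_psi (k : ℤ) (z : ℂ) :
    (starRingEnd ℂ) (psi k z) = amp k z.im * Complex.exp (-Complex.I * phase k z.re z.im) := by
  rw [psi_eq, map_mul, ← Complex.exp_conj, map_mul, Complex.conj_ofReal, Complex.conj_ofReal,
    Complex.conj_I]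

lemma continuous_psi (k : ℤ) : Continuous (psi k) := by
  rw [show psi k = fun z : ℂ => (amp k z.im : ℂ) * Complex.exp (Complex.I * phase k z.re z.im)
    from funext (psi_eq k)]
  unfold amp phase
  fun_prop

/-! ### The Abrikosov lattice is `∑ ψ_k` -/

lemma summable_exp_neg_mul_sq {c : ℝ} (hc : 0 < c) :
    Summable fun k : ℤ => Real.exp (-c * (k : ℝ) ^ 2) := by
  have h : Summable fun n : ℕ => Real.exp (-c * (n : ℝ) ^ 2) := by
    refine Summable.of_nonneg_of_le (fun _ => (Real.exp_pos _).le) (fun n => ?_)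
      (Real.summable_exp_nat_mul_iff.2 (neg_lt_zero.2 hc))
    have hn : (n : ℝ) ≤ (n : ℝ) ^ 2 := by exact_mod_cast Nat.le_self_pow two_ne_zero n
    exact Real.exp_le_exp.2 (by nlinarith)
  exact Summable.of_nat_of_neg (by simpa using h) (by simpa using h)

/-- A Gaussian weight in `y`, however weak, makes the moduli of the `ψ_k` decay in `k`. -/
lemma amp_le {ε : ℝ} (hε : 0 < ε) (k : ℤ) (y : ℝ) :
    amp k y ≤ psiNorm * Real.exp (-(ε / (1 + ε) * stp ^ 2) * (k : ℝ) ^ 2) *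
      Real.exp (ε * y ^ 2) := by
  unfold amp
  rw [mul_assoc, ← Real.exp_add]
  refine mul_le_mul_of_nonneg_left (Real.exp_le_exp.2 ?_) psiNorm_pos.le
  have h : 0 ≤ ((1 + ε) * y + stp * k) ^ 2 / (1 + ε) := by positivity
  have e : (y + stp * k) ^ 2 + ε * y ^ 2 - ε / (1 + ε) * stp ^ 2 * (k : ℝ) ^ 2 =
      ((1 + ε) * y + stp * k) ^ 2 / (1 + ε) := by field_simp; ring
  linarith

lemma summable_amp (y : ℝ) : Summable fun k : ℤ => amp k y := by
  refine Summable.of_nonneg_of_le (fun k => (amp_pos k y).le) (fun k => amp_le one_pos k y) ?_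
  exact ((summable_exp_neg_mul_sq (by have := stp_pos; positivity)).mul_left _).mul_right _

/-- By `amp_le`, the theta series grows more slowly than any Gaussian in the vertical direction.
(It is in fact bounded; this form suffices for every domination argument below.) -/
lemma tsum_amp_le {ε : ℝ} (hε : 0 < ε) :
    ∃ B : ℝ, ∀ y, ∑' k : ℤ, amp k y ≤ B * Real.exp (ε * y ^ 2) := by
  have hs : Summable fun k : ℤ =>
      psiNorm * Real.exp (-(ε / (1 + ε) * stp ^ 2) * (k : ℝ) ^ 2) :=
    (summable_exp_neg_mul_sq (by have := stp_pos; positivity)).mul_left _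
  refine ⟨∑' k : ℤ, psiNorm * Real.exp (-(ε / (1 + ε) * stp ^ 2) * (k : ℝ) ^ 2), fun y => ?_⟩
  rw [← tsum_mul_right]
  exact (summable_amp y).tsum_le_tsum (fun k => amp_le hε k y) (hs.mul_right _)

lemma summable_psi (z : ℂ) : Summable fun k : ℤ => psi k z :=
  Summable.of_norm (by simpa only [norm_psi] using summable_amp z.im)

/-- The shift `z₀` and the constant `c` are chosen so that the terms of the theta series of `Ψ₀` are
exactly the `ψ_n`. -/
lemma theta_term_eq (n : ℤ) (z : ℂ) :
    cnorm * (Complex.exp (z ^ 2 / 2 - Complex.I * Real.pi / gam * z - (‖z‖ : ℂ) ^ 2 / 2) *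
      (-Complex.I * ((-1 : ℂ) ^ n *
        Complex.exp (Complex.I * Real.pi * tau * ((n : ℂ) + 1 / 2) ^ 2) *
        Complex.exp (Complex.I * (2 * (n : ℂ) + 1) * Real.pi *
          ((z - gam / 2 * (tau - 1)) / gam))))) = psi n z := by
  rw [psi_eq, ← gaussian_mul_theta_term, Complex.re_add_im, ← ofReal_norm_sq]
  have hg : (gam : ℂ) ≠ 0 := by exact_mod_cast gam_pos.ne'
  have hm : (-1 : ℂ) ^ n = Complex.exp (-(n * (Real.pi * Complex.I))) := by
    rw [← mul_neg, Complex.exp_int_mul, Complex.exp_neg, Complex.exp_pi_mul_I]; norm_num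
  have hI : -Complex.I = Complex.exp (-(Real.pi / 2 * Complex.I)) := by
    rw [Complex.exp_neg, Complex.exp_pi_div_two_mul_I, Complex.inv_I]
  unfold cnorm
  rw [show (((2 / (Real.pi * gam ^ 2)) ^ (1 / 4 : ℝ) : ℝ) : ℂ) = (psiNorm : ℂ) from rfl, hm, hI,
    mul_comm (Complex.exp _) (psiNorm : ℂ), mul_assoc]
  simp only [← Complex.exp_add]
  congr 2
  have hs : (stp : ℂ) = Real.pi / gam := by unfold stp; push_cast; rfl
  rw [hs]
  field_simp
  ring

lemma hasSum_Psi0 (z : ℂ) : HasSum (fun k : ℤ => psi k z) (Psi0 z) := by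
  have h : Psi0 z = ∑' k : ℤ, psi k z := by
    unfold Psi0 Phi0 theta
    rw [← tsum_mul_left, ← tsum_mul_left, ← tsum_mul_left]
    exact tsum_congr fun n => theta_term_eq n z
  rw [h]
  exact (summable_psi z).hasSum

lemma norm_Psi0_le (z : ℂ) : ‖Psi0 z‖ ≤ ∑' k : ℤ, amp k z.im := by
  rw [← (hasSum_Psi0 z).tsum_eq]
  simpa only [norm_psi] using norm_tsum_le_tsum_norm (f := fun k : ℤ => psi k z)
    (by simpa only [norm_psi] using summable_amp z.im)

lemma measurable_Psi0 : Measurable Psi0 :=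
  measurable_of_tendsto_metrizable' atTop
    (fun s : Finset ℤ => Finset.measurable_sum s fun k _ => (continuous_psi k).measurable)
    (tendsto_pi_nhds.2 fun z => by simpa [HasSum] using hasSum_Psi0 z)

/-! ### Invariance under the magnetic translation `R_γ` -/

lemma magTrans_gam_apply (u : ℂ → ℂ) (z : ℂ) :
    magTrans gam u z = Complex.exp (-Complex.I * (gam * z.im : ℝ)) * u (z + gam) := by
  unfold magTrans
  congr 2
  rw [Complex.conj_ofReal]
  apply Complex.ext
  · simp
  · simp; ring

/-- The factor of automorphy has modulus one and depends on the height only, so products with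
as many conjugated as unconjugated factors are periodic. -/
lemma add_gam_of_magTrans_eq {u : ℂ → ℂ} (h : magTrans gam u = u) (z : ℂ) :
    u (z + gam) = Complex.exp (Complex.I * (gam * z.im : ℝ)) * u z := by
  have := congrFun h z
  rw [magTrans_gam_apply] at this
  rw [← this, ← mul_assoc, ← Complex.exp_add]
  simp

lemma magTrans_psi (k : ℤ) : magTrans gam (psi k) = psi k := by
  funext z
  rw [magTrans_gam_apply, psi_eq, psi_eq]
  simp only [Complex.add_im, Complex.add_re, Complex.ofReal_im, Complex.ofReal_re, add_zero]
  rw [mul_left_comm, ← Complex.exp_add]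
  congr 1
  have e : (phase k (z.re + gam) z.im : ℝ) = phase k z.re z.im + gam * z.im +
      k * (2 * Real.pi) := by
    unfold phase; linear_combination 2 * (k : ℝ) * gam_mul_stp
  rw [e]
  rw [show -Complex.I * (gam * z.im : ℝ) + Complex.I * ((phase k z.re z.im + gam * z.im +
      k * (2 * Real.pi) : ℝ) : ℂ) = Complex.I * (phase k z.re z.im : ℝ) +
      k * (2 * Real.pi * Complex.I) by push_cast; ring]
  exact Complex.exp_periodic.int_mul k _

lemma magTrans_Psi0 : magTrans gam Psi0 = Psi0 := by
  funext z
  rw [magTrans_gam_apply]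
  refine ((hasSum_Psi0 (z + gam)).mul_left _).unique ?_
  have : (fun k : ℤ => Complex.exp (-Complex.I * (gam * z.im : ℝ)) * psi k (z + gam)) =
      fun k => psi k z := by
    funext k; rw [← magTrans_gam_apply, magTrans_psi]
  rw [this]
  exact hasSum_Psi0 z

/-! ### Positivity and asymptotics of the symbol -/

/-- The nome `e^{-π²/γ²}` of the theta series `ℓ` and `h`. -/
def nome : ℝ := Real.exp (-stp ^ 2)

lemma nome_pos : 0 < nome := Real.exp_pos _

lemma nome_lt : nome < 1 / 12 := by
  have h3 : (1.7 : ℝ) < Real.sqrt 3 := Real.lt_sqrt_of_sq_lt (by norm_num)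
  have hp : (3.14 : ℝ) < Real.pi := Real.pi_gt_d2
  have h : (2.6 : ℝ) < stp ^ 2 := by rw [stp_sq]; nlinarith
  -- `e² > 7.38` and `1 + 0.6 + 0.18 = 1.78` leave a margin: their product exceeds `13`
  have he : (12 : ℝ) < Real.exp 2.6 := by
    have h1 : Real.exp 2.6 = Real.exp 1 ^ 2 * Real.exp 0.6 := by
      rw [← Real.exp_nat_mul, ← Real.exp_add]; norm_num
    have h2 := Real.exp_one_gt_d9
    have h3 := Real.quadratic_le_exp_of_nonneg (x := 0.6) (by norm_num)
    rw [h1]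
    nlinarith
  calc nome < Real.exp (-2.6) := Real.exp_lt_exp.2 (by linarith)
    _ = (Real.exp 2.6)⁻¹ := Real.exp_neg _
    _ < 1 / 12 := by rw [one_div]; exact inv_strictAnti₀ (by norm_num) he

lemma exp_eq_nome_pow (m : ℕ) :
    Real.exp (-(Real.pi ^ 2 * (m : ℝ) ^ 2) / gam ^ 2) = nome ^ (m ^ 2) := by
  unfold nome stp
  rw [← Real.exp_nat_mul]
  congr 1
  push_cast
  ring

lemma ell_eq (ξ : ℝ) : ell ξ =
    1 + 2 * ∑' k : ℕ, nome ^ ((k + 1) ^ 2) * Real.cos (2 * Real.pi * (k + 1 : ℕ) * ξ) := by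
  unfold ell
  congr 2
  refine tsum_congr fun k => ?_
  rw [← exp_eq_nome_pow]
  push_cast; rfl

lemma hodd_eq (ξ : ℝ) : hodd ξ =
    2 * ∑' k : ℕ, nome ^ ((2 * k + 1) ^ 2) * Real.cos (2 * Real.pi * (2 * k + 1 : ℕ) * ξ) := by
  unfold hodd
  congr 1
  refine tsum_congr fun k => ?_
  rw [← exp_eq_nome_pow]
  push_cast
  congr 2
  ring

/-- Crude geometric bound for the quadratically weighted powers of the nome. -/
lemma sq_mul_nome_pow_le {k m : ℕ} (h : k + 1 ≤ m ^ 2) :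
    (m : ℝ) ^ 2 * nome ^ (m ^ 2) ≤ 2 * nome * (1 / 6) ^ k := by
  have hn := nome_pos
  have hn' := nome_lt
  have h1 : (m : ℝ) ^ 2 ≤ 2 ^ (m ^ 2) := by exact_mod_cast Nat.lt_two_pow_self.le
  calc (m : ℝ) ^ 2 * nome ^ (m ^ 2) ≤ 2 ^ (m ^ 2) * nome ^ (m ^ 2) := by gcongr
    _ = (2 * nome) ^ (m ^ 2) := (mul_pow _ _ _).symm
    _ ≤ (2 * nome) ^ (k + 1) := pow_le_pow_of_le_one (by positivity) (by linarith) h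
    _ = 2 * nome * (2 * nome) ^ k := pow_succ' _ _
    _ ≤ _ := by gcongr; linarith

lemma summable_sq_mul_nome_pow {m : ℕ → ℕ} (hm : ∀ k, k + 1 ≤ m k) :
    Summable fun k => (m k : ℝ) ^ 2 * nome ^ (m k ^ 2) := by
  refine Summable.of_nonneg_of_le (fun k => by have := nome_pos; positivity)
    (fun k => sq_mul_nome_pow_le ((hm k).trans (Nat.le_self_pow two_ne_zero _))) ?_
  exact (summable_geometric_of_lt_one (by norm_num) (by norm_num)).mul_left _

lemma summable_nome_pow {m : ℕ → ℕ} (hm : ∀ k, k + 1 ≤ m k) :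
    Summable fun k => nome ^ (m k ^ 2) := by
  refine Summable.of_nonneg_of_le (fun k => by have := nome_pos; positivity) (fun k => ?_)
    (summable_sq_mul_nome_pow hm)
  have : (1 : ℝ) ≤ m k := by exact_mod_cast (by have := hm k; omega : 1 ≤ m k)
  exact le_mul_of_one_le_left (pow_pos nome_pos _).le (one_le_pow₀ this)

lemma abs_nome_pow_mul_cos_le (m : ℕ) (x : ℝ) :
    |nome ^ (m ^ 2) * Real.cos x| ≤ nome ^ (m ^ 2) := by
  rw [abs_mul, abs_of_pos (pow_pos nome_pos _)]
  exact mul_le_of_le_one_right (pow_pos nome_pos _).le (Real.abs_cos_le_one _)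

lemma summable_nome_pow_mul_cos {m : ℕ → ℕ} (hm : ∀ k, k + 1 ≤ m k) (x : ℕ → ℝ) :
    Summable fun k => nome ^ (m k ^ 2) * Real.cos (x k) :=
  (summable_nome_pow hm).of_norm_bounded fun _ => abs_nome_pow_mul_cos_le _ _

lemma tsum_nome_pow_le {m : ℕ → ℕ} (hm : ∀ k, k + 1 ≤ m k) :
    ∑' k, nome ^ (m k ^ 2) ≤ 1 / 11 := by
  have hn := nome_pos
  have hn' := nome_lt
  have hg : Summable fun k : ℕ => (1 / 12 : ℝ) * (1 / 12) ^ k :=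
    (summable_geometric_of_lt_one (by norm_num) (by norm_num)).mul_left _
  calc ∑' k, nome ^ (m k ^ 2) ≤ ∑' k : ℕ, (1 / 12 : ℝ) * (1 / 12) ^ k := by
        refine (summable_nome_pow hm).tsum_le_tsum (fun k => ?_) hg
        rw [← pow_succ']
        exact (pow_le_pow_of_le_one hn.le (by linarith)
          ((hm k).trans (Nat.le_self_pow two_ne_zero _))).trans (by gcongr)
    _ = 1 / 11 := by
        rw [tsum_mul_left, tsum_geometric_of_lt_one (by norm_num) (by norm_num)]; norm_num

lemma abs_tsum_nome_cos_le {m : ℕ → ℕ} (hm : ∀ k, k + 1 ≤ m k) (x : ℕ → ℝ) :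
    |∑' k, nome ^ (m k ^ 2) * Real.cos (x k)| ≤ 1 / 11 := by
  refine (norm_tsum_le_tsum_norm (summable_nome_pow_mul_cos hm x).norm).trans ?_
  exact ((summable_nome_pow_mul_cos hm x).norm.tsum_le_tsum
    (fun _ => abs_nome_pow_mul_cos_le _ _) (summable_nome_pow hm)).trans (tsum_nome_pow_le hm)

lemma abs_ell_sub_one_le (ξ : ℝ) : |ell ξ - 1| ≤ 2 / 11 := by
  rw [ell_eq, add_sub_cancel_left, abs_mul, abs_two]
  linarith [abs_tsum_nome_cos_le (m := fun k => k + 1) (fun _ => le_rfl)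
    (fun k => 2 * Real.pi * (k + 1 : ℕ) * ξ)]

lemma abs_hodd_le (ξ : ℝ) : |hodd ξ| ≤ 2 / 11 := by
  rw [hodd_eq, abs_mul, abs_two]
  linarith [abs_tsum_nome_cos_le (m := fun k => 2 * k + 1) (fun _ => by omega)
    (fun k => 2 * Real.pi * (2 * k + 1 : ℕ) * ξ)]

lemma continuous_ell : Continuous ell := by
  rw [funext ell_eq]
  exact continuous_const.add (continuous_const.mul (continuous_tsum (fun k => by fun_prop)
    (summable_nome_pow (m := fun k => k + 1) fun _ => le_rfl)
    fun _ _ => abs_nome_pow_mul_cos_le _ _))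

lemma continuous_hodd : Continuous hodd := by
  rw [funext hodd_eq]
  exact continuous_const.mul (continuous_tsum (fun k => by fun_prop)
    (summable_nome_pow (m := fun k => 2 * k + 1) fun _ => by omega)
    fun _ _ => abs_nome_pow_mul_cos_le _ _)

lemma continuous_a : Continuous a := by
  have := continuous_ell
  have := continuous_hodd
  unfold a; fun_prop

lemma continuous_b : Continuous b := by
  have := continuous_ell
  have := continuous_hodd
  unfold b; fun_prop

lemma continuous_mu : Continuous mu := by
  have := continuous_a
  have := continuous_b
  unfold mu; fun_prop

lemma gam_mul_sqrt_pi_pos : 0 < gam * Real.sqrt Real.pi := by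
  have := gam_pos
  positivity

/-- Both symbols come from one bilinear form, which is why their difference is a form in the
increments and vanishes to fourth order at `0`. -/
lemma a_sub_b (ξ : ℝ) : a ξ - b ξ = 1 / (gam * Real.sqrt Real.pi) *
    (2 * (hodd 0 - hodd ξ) ^ 2 - (ell 0 - ell ξ) ^ 2) := by
  unfold a b; ring

lemma a_add_b (ξ : ℝ) : a ξ + b ξ = 1 / (gam * Real.sqrt Real.pi) *
    ((ell ξ + ell 0) ^ 2 - 2 * ell 0 ^ 2 - 2 * ((hodd ξ + hodd 0) ^ 2 - 2 * hodd 0 ^ 2)) := by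
  unfold a b; ring

/-- At `h = 0` and `ℓ = 1` the bracket in `a_add_b` equals `2`; the deviations of `ℓ` and `h` are at
most `2/11`. -/
lemma a_add_b_ge (ξ : ℝ) : 1 / (2 * (gam * Real.sqrt Real.pi)) ≤ a ξ + b ξ := by
  have h1 := abs_le.1 (abs_ell_sub_one_le ξ)
  have h2 := abs_le.1 (abs_ell_sub_one_le 0)
  have h3 := abs_le.1 (abs_hodd_le ξ)
  have h4 := abs_le.1 (abs_hodd_le 0)
  have hg := gam_mul_sqrt_pi_pos
  rw [a_add_b, one_div_mul_eq_div, div_le_div_iff₀ (by positivity) hg]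
  have h : 1 / 2 ≤
      (ell ξ + ell 0) ^ 2 - 2 * ell 0 ^ 2 - 2 * ((hodd ξ + hodd 0) ^ 2 - 2 * hodd 0 ^ 2) := by
    have e1 : (18 / 11 : ℝ) ^ 2 ≤ (ell ξ + ell 0) ^ 2 := by
      apply pow_le_pow_left₀ (by norm_num); linarith
    have e2 : ell 0 ^ 2 ≤ (13 / 11) ^ 2 := by
      apply pow_le_pow_left₀ (by linarith); linarith
    have e3 : (hodd ξ + hodd 0) ^ 2 ≤ (4 / 11) ^ 2 := by
      apply sq_le_sq'
      · linarith
      · linarith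
    nlinarith [sq_nonneg (hodd 0)]
  nlinarith

lemma a_add_b_pos (ξ : ℝ) : 0 < a ξ + b ξ :=
  lt_of_lt_of_le (by have := gam_mul_sqrt_pi_pos; positivity) (a_add_b_ge ξ)

lemma a_add_b_le (ξ : ℝ) : a ξ + b ξ ≤ 7 / (gam * Real.sqrt Real.pi) := by
  have h1 := abs_le.1 (abs_ell_sub_one_le ξ)
  have h2 := abs_le.1 (abs_ell_sub_one_le 0)
  have h4 := abs_le.1 (abs_hodd_le 0)
  have hg := gam_mul_sqrt_pi_pos
  rw [a_add_b, one_div_mul_eq_div]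
  refine div_le_div_of_nonneg_right ?_ hg.le
  have e1 : (ell ξ + ell 0) ^ 2 ≤ (26 / 11 : ℝ) ^ 2 := by
    apply pow_le_pow_left₀ (by linarith); linarith
  have e3 : hodd 0 ^ 2 ≤ (2 / 11) ^ 2 := by
    apply sq_le_sq'
    · linarith
    · linarith
  nlinarith [sq_nonneg (hodd ξ + hodd 0), sq_nonneg (ell 0)]

lemma ell_neg (ξ : ℝ) : ell (-ξ) = ell ξ := by
  simp only [ell, mul_neg, Real.cos_neg]

lemma hodd_neg (ξ : ℝ) : hodd (-ξ) = hodd ξ := by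
  simp only [hodd, mul_neg, Real.cos_neg]

lemma ell_periodic : Function.Periodic ell 1 := by
  intro ξ
  rw [ell_eq, ell_eq]
  congr 2
  refine tsum_congr fun k => ?_
  rw [mul_add, mul_one, mul_comm (2 * Real.pi) ((k + 1 : ℕ) : ℝ), Real.cos_add_nat_mul_two_pi]

lemma hodd_periodic : Function.Periodic hodd 1 := by
  intro ξ
  rw [hodd_eq, hodd_eq]
  congr 1
  refine tsum_congr fun k => ?_
  rw [mul_add, mul_one, mul_comm (2 * Real.pi) ((2 * k + 1 : ℕ) : ℝ), Real.cos_add_nat_mul_two_pi]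

lemma a_periodic : Function.Periodic a 1 := fun ξ => by
  simp only [a, ell_periodic ξ, hodd_periodic ξ]

lemma b_periodic : Function.Periodic b 1 := fun ξ => by
  simp only [b, ell_periodic ξ, hodd_periodic ξ]

lemma a_neg (ξ : ℝ) : a (-ξ) = a ξ := by simp only [a, ell_neg, hodd_neg]

lemma b_neg (ξ : ℝ) : b (-ξ) = b ξ := by simp only [b, ell_neg, hodd_neg]

/-- The `m`-th mode of the increment between `0` and `ξ`. -/
def osc (m : ℕ) (ξ : ℝ) : ℝ := nome ^ (m ^ 2) * (1 - Real.cos (2 * Real.pi * m * ξ))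

lemma osc_nonneg (m : ℕ) (ξ : ℝ) : 0 ≤ osc m ξ :=
  mul_nonneg (pow_pos nome_pos _).le (by linarith [Real.cos_le_one (2 * Real.pi * m * ξ)])

lemma summable_osc {m : ℕ → ℕ} (hm : ∀ k, k + 1 ≤ m k) (ξ : ℝ) :
    Summable fun k => osc (m k) ξ := by
  have h := (summable_nome_pow hm).sub
    (summable_nome_pow_mul_cos hm fun k => 2 * Real.pi * m k * ξ)
  refine h.congr fun k => ?_
  unfold osc; ring

lemma tsum_osc {m : ℕ → ℕ} (hm : ∀ k, k + 1 ≤ m k) (ξ : ℝ) :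
    ∑' k, osc (m k) ξ = ∑' k, nome ^ (m k ^ 2) * Real.cos (2 * Real.pi * m k * 0) -
      ∑' k, nome ^ (m k ^ 2) * Real.cos (2 * Real.pi * m k * ξ) := by
  rw [← (summable_nome_pow_mul_cos hm _).tsum_sub (summable_nome_pow_mul_cos hm _)]
  refine tsum_congr fun k => ?_
  rw [mul_zero, Real.cos_zero]
  unfold osc; ring

lemma ell_zero_sub (ξ : ℝ) : ell 0 - ell ξ = 2 * ∑' k : ℕ, osc (k + 1) ξ := by
  rw [ell_eq, ell_eq, tsum_osc (m := fun k => k + 1) (fun _ => le_rfl)]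
  ring

lemma hodd_zero_sub (ξ : ℝ) : hodd 0 - hodd ξ = 2 * ∑' k : ℕ, osc (2 * k + 1) ξ := by
  rw [hodd_eq, hodd_eq, tsum_osc (m := fun k => 2 * k + 1) (fun _ => by omega)]
  ring

/-- Equivalent to `|sin (m y)| ≤ m |sin y|` with `y = x / 2`. -/
lemma one_sub_cos_nat_mul_le (m : ℕ) (x : ℝ) :
    1 - Real.cos (m * x) ≤ (m : ℝ) ^ 2 * (1 - Real.cos x) := by
  have hs : ∀ (m : ℕ) (y : ℝ), |Real.sin (m * y)| ≤ m * |Real.sin y| := by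
    intro m y
    induction m with
    | zero => simp
    | succ m ih =>
      rw [Nat.cast_succ, add_one_mul, Real.sin_add]
      refine (abs_add_le _ _).trans ?_
      rw [abs_mul, abs_mul]
      have h1 : |Real.sin (m * y)| * |Real.cos y| ≤ |Real.sin (m * y)| :=
        mul_le_of_le_one_right (abs_nonneg _) (Real.abs_cos_le_one _)
      have h2 : |Real.cos (m * y)| * |Real.sin y| ≤ |Real.sin y| :=
        mul_le_of_le_one_left (abs_nonneg _) (Real.abs_cos_le_one _)
      linarith
  have hc : ∀ y : ℝ, 1 - Real.cos y = 2 * |Real.sin (y / 2)| ^ 2 := by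
    intro y
    rw [sq_abs, Real.sin_sq_eq_half_sub, mul_div_cancel₀ _ two_ne_zero]; ring
  rw [hc, hc, mul_div_assoc]
  nlinarith [pow_le_pow_left₀ (abs_nonneg _) (hs m (x / 2)) 2]

/-- The even modes are negligible against the first odd one. The constant only has to be less than
`√2 - 1`, so that `a_sub_b_ge` holds. -/
lemma tsum_osc_even_le (ξ : ℝ) :
    ∑' k : ℕ, osc (2 * k + 2) ξ ≤ 2 / 5 * osc 1 ξ := by
  have hn := nome_pos
  have hc : 0 ≤ 1 - Real.cos (2 * Real.pi * ξ) := by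
    linarith [Real.cos_le_one (2 * Real.pi * ξ)]
  have hg : Summable fun k : ℕ =>
      2 * nome * (1 / 6) ^ 3 * (1 - Real.cos (2 * Real.pi * ξ)) * (1 / 6 : ℝ) ^ k :=
    (summable_geometric_of_lt_one (by norm_num) (by norm_num)).mul_left _
  have h : ∑' k : ℕ, osc (2 * k + 2) ξ ≤ ∑' k : ℕ,
      2 * nome * (1 / 6) ^ 3 * (1 - Real.cos (2 * Real.pi * ξ)) * (1 / 6 : ℝ) ^ k := by
    refine (summable_osc (m := fun k => 2 * k + 2) (fun k => by omega) ξ).tsum_le_tsum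
      (fun k => ?_) hg
    have h1 := one_sub_cos_nat_mul_le (2 * k + 2) (2 * Real.pi * ξ)
    have h2 := sq_mul_nome_pow_le (k := k + 3) (m := 2 * k + 2) (by nlinarith)
    calc osc (2 * k + 2) ξ = nome ^ ((2 * k + 2) ^ 2) *
          (1 - Real.cos ((2 * k + 2 : ℕ) * (2 * Real.pi * ξ))) := by
          unfold osc; congr 3; ring
      _ ≤ nome ^ ((2 * k + 2) ^ 2) *
          (((2 * k + 2 : ℕ) : ℝ) ^ 2 * (1 - Real.cos (2 * Real.pi * ξ))) := by gcongr
      _ = (((2 * k + 2 : ℕ) : ℝ) ^ 2 * nome ^ ((2 * k + 2) ^ 2)) *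
          (1 - Real.cos (2 * Real.pi * ξ)) := by ring
      _ ≤ (2 * nome * (1 / 6) ^ (k + 3)) * (1 - Real.cos (2 * Real.pi * ξ)) := by gcongr
      _ = _ := by ring
  -- the sum is `2 · 6⁻³ · (6/5) = 1/90` times the first mode, well below the `2/5` claimed
  refine h.trans ?_
  rw [tsum_mul_left, tsum_geometric_of_lt_one (by norm_num) (by norm_num)]
  have : osc 1 ξ = nome * (1 - Real.cos (2 * Real.pi * ξ)) := by
    unfold osc; simp
  rw [this]
  nlinarith [mul_nonneg hn.le hc]

lemma osc_one_le (ξ : ℝ) : 2 * osc 1 ξ ≤ hodd 0 - hodd ξ := by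
  rw [hodd_zero_sub]
  have := (summable_osc (m := fun k => 2 * k + 1) (fun k => by omega) ξ).le_tsum 0
    fun k _ => osc_nonneg _ _
  linarith

lemma ell_zero_sub_nonneg (ξ : ℝ) : 0 ≤ ell 0 - ell ξ := by
  rw [ell_zero_sub]
  exact mul_nonneg zero_le_two (tsum_nonneg fun k => osc_nonneg _ _)

/-- Since `(7/5)² < 2`, this makes the quadratic form in `a_sub_b` positive. -/
lemma ell_zero_sub_le (ξ : ℝ) : ell 0 - ell ξ ≤ 7 / 5 * (hodd 0 - hodd ξ) := by
  have h1 := osc_one_le ξ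
  have h2 := tsum_osc_even_le ξ
  have h3 : ∑' k : ℕ, osc (2 * k + 1) ξ + ∑' k : ℕ, osc (2 * k + 2) ξ =
      ∑' k : ℕ, osc (k + 1) ξ :=
    tsum_even_add_odd (f := fun k => osc (k + 1) ξ)
      (summable_osc (m := fun k => 2 * k + 1) (fun k => by omega) ξ)
      (summable_osc (m := fun k => 2 * k + 2) (fun k => by omega) ξ)
  rw [ell_zero_sub, ← h3, mul_add, ← hodd_zero_sub]
  linarith

lemma a_sub_b_ge (ξ : ℝ) :
    1 / (gam * Real.sqrt Real.pi) * (1 / 25 * (hodd 0 - hodd ξ) ^ 2) ≤ a ξ - b ξ := by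
  have hg := gam_mul_sqrt_pi_pos
  rw [a_sub_b]
  refine mul_le_mul_of_nonneg_left ?_ (by positivity)
  nlinarith [pow_le_pow_left₀ (ell_zero_sub_nonneg ξ) (ell_zero_sub_le ξ) 2]

lemma a_sub_b_nonneg (ξ : ℝ) : 0 ≤ a ξ - b ξ :=
  le_trans (by have := gam_mul_sqrt_pi_pos; positivity) (a_sub_b_ge ξ)

lemma a_sub_b_pos {ξ : ℝ} (hξ : ξ ∈ Set.Ioo (0 : ℝ) 1) : 0 < a ξ - b ξ := by
  have hg := gam_mul_sqrt_pi_pos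
  refine lt_of_lt_of_le ?_ (a_sub_b_ge ξ)
  have hc : Real.cos (2 * Real.pi * ξ) < 1 := by
    refine lt_of_le_of_ne (Real.cos_le_one _) fun h => ?_
    obtain ⟨n, hn⟩ := (Real.cos_eq_one_iff _).1 h
    have : (n : ℝ) = ξ := by
      have := Real.pi_pos
      apply mul_right_cancel₀ (b := 2 * Real.pi) (by positivity)
      linarith
    rw [← this] at hξ
    have h0 : (0 : ℤ) < n := by exact_mod_cast hξ.1
    have h1 : n < (1 : ℤ) := by exact_mod_cast hξ.2
    omega
  have h1 : 0 < osc 1 ξ := by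
    unfold osc
    have := nome_pos
    have : (0 : ℝ) < 1 - Real.cos (2 * Real.pi * (1 : ℕ) * ξ) := by
      rw [Nat.cast_one, mul_one]; linarith
    positivity
  have h2 : 0 < hodd 0 - hodd ξ := by linarith [osc_one_le ξ]
  positivity

lemma sq_b_lt_sq_a {ξ : ℝ} (hξ : ξ ∈ Set.Ioo (0 : ℝ) 1) : b ξ ^ 2 < a ξ ^ 2 := by
  nlinarith [mul_pos (a_sub_b_pos hξ) (a_add_b_pos ξ)]

lemma a_sub_b_le (ξ : ℝ) : a ξ - b ξ ≤ 7 / (gam * Real.sqrt Real.pi) := by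
  have h3 := abs_le.1 (abs_hodd_le ξ)
  have h4 := abs_le.1 (abs_hodd_le 0)
  rw [a_sub_b, one_div_mul_eq_div]
  refine div_le_div_of_nonneg_right ?_ gam_mul_sqrt_pi_pos.le
  have e : (hodd 0 - hodd ξ) ^ 2 ≤ 1 ^ 2 := by
    apply sq_le_sq'
    · linarith
    · linarith
  nlinarith [sq_nonneg (ell 0 - ell ξ)]

lemma mu_sq (ξ : ℝ) : mu ξ ^ 2 = (a ξ - b ξ) * (a ξ + b ξ) := by
  have : a ξ ^ 2 - b ξ ^ 2 = (a ξ - b ξ) * (a ξ + b ξ) := by ring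
  unfold mu
  rw [this, Real.sq_sqrt (mul_nonneg (a_sub_b_nonneg ξ) (a_add_b_pos ξ).le)]

lemma mu_pos {ξ : ℝ} (hξ : ξ ∈ Set.Ioo (0 : ℝ) 1) : 0 < mu ξ :=
  Real.sqrt_pos.2 (by linarith [sq_b_lt_sq_a hξ])

lemma mu_nonneg (ξ : ℝ) : 0 ≤ mu ξ := Real.sqrt_nonneg _

lemma mu_le (ξ : ℝ) : mu ξ ≤ 7 / (gam * Real.sqrt Real.pi) := by
  have hg : 0 ≤ 7 / (gam * Real.sqrt Real.pi) := by have := gam_mul_sqrt_pi_pos; positivity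
  refine (sq_le_sq₀ (mu_nonneg ξ) hg).1 ?_
  rw [mu_sq, sq]
  exact mul_le_mul (a_sub_b_le ξ) (a_add_b_le ξ) (a_add_b_pos ξ).le hg

/-- Termwise second-order expansion at `0`; the limit of each term also dominates it. -/
lemma tendsto_tsum_osc_div_sq {m : ℕ → ℕ} (hm : ∀ k, k + 1 ≤ m k) :
    Tendsto (fun ξ : ℝ => (∑' k, osc (m k) ξ) / ξ ^ 2) (𝓝[≠] 0)
      (𝓝 (∑' k, 2 * Real.pi ^ 2 * ((m k : ℝ) ^ 2 * nome ^ (m k ^ 2)))) := by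
  have hn := nome_pos
  simp_rw [← tsum_div_const]
  have hsq : ∀ (k : ℕ) (ξ : ℝ), osc k ξ = 2 * nome ^ (k ^ 2) * Real.sin (Real.pi * k * ξ) ^ 2 := by
    intro k ξ
    unfold osc
    rw [Real.sin_sq_eq_half_sub, show 2 * (Real.pi * k * ξ) = 2 * Real.pi * k * ξ by ring]
    ring
  refine tendsto_tsum_of_dominated_convergence
    (bound := fun k => 2 * Real.pi ^ 2 * ((m k : ℝ) ^ 2 * nome ^ (m k ^ 2)))
    ((summable_sq_mul_nome_pow hm).mul_left _) (fun k => ?_) ?_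
  · have hd : HasDerivAt (fun ξ : ℝ => Real.sin (Real.pi * m k * ξ)) (Real.pi * m k) 0 := by
      have h := ((hasDerivAt_id (0 : ℝ)).const_mul (Real.pi * m k)).sin
      simpa using h
    have h1 := (hasDerivAt_iff_tendsto_slope.1 hd).pow 2
    refine ((h1.const_mul (2 * nome ^ (m k ^ 2))).congr' ?_).trans_eq ?_
    · filter_upwards with ξ
      rw [hsq, slope_def_field]
      simp [div_pow, mul_div_assoc]
    · congr 1; ring
  · filter_upwards [self_mem_nhdsWithin] with ξ hξ k
    have hξ : 0 < ξ ^ 2 := by have : ξ ≠ 0 := hξ; positivity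
    rw [Real.norm_of_nonneg (div_nonneg (osc_nonneg _ _) hξ.le), div_le_iff₀ hξ, hsq]
    have h := Real.abs_sin_le_abs (x := Real.pi * m k * ξ)
    have h2 : Real.sin (Real.pi * m k * ξ) ^ 2 ≤ (Real.pi * m k * ξ) ^ 2 := sq_le_sq.2 h
    calc 2 * nome ^ (m k ^ 2) * Real.sin (Real.pi * m k * ξ) ^ 2
        ≤ 2 * nome ^ (m k ^ 2) * (Real.pi * m k * ξ) ^ 2 := by gcongr
      _ = _ := by ring

/-- The increments of `h` and `ℓ` are asymptotic to `H ξ²` and `L ξ²`, and `L ≤ (7/5) H` passes to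
the limit, so that `μ² / ξ⁴` tends to a positive multiple of `2 H² - L²`. -/
lemma exists_tendsto_mu_div_sq :
    ∃ κ : ℝ, 0 < κ ∧ Tendsto (fun ξ : ℝ => mu ξ / ξ ^ 2) (𝓝[≠] 0) (𝓝 κ) := by
  have hn := nome_pos
  have hg := gam_mul_sqrt_pi_pos
  have hH := (tendsto_tsum_osc_div_sq (m := fun k => 2 * k + 1) (fun k => by omega)).const_mul 2
  have hL := (tendsto_tsum_osc_div_sq (m := fun k => k + 1) (fun k => le_rfl)).const_mul 2
  simp_rw [← mul_div_assoc, ← hodd_zero_sub] at hH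
  simp_rw [← mul_div_assoc, ← ell_zero_sub] at hL
  have hpos := (((summable_sq_mul_nome_pow (m := fun k => 2 * k + 1)
    (fun k => by omega)).mul_left (2 * Real.pi ^ 2)).tsum_pos
    (fun _ => by positivity) 0 (by have := Real.pi_pos; positivity))
  set H := 2 * ∑' k : ℕ, 2 * Real.pi ^ 2 *
    (((2 * k + 1 : ℕ) : ℝ) ^ 2 * nome ^ ((2 * k + 1) ^ 2)) with hHdef
  set L := 2 * ∑' k : ℕ, 2 * Real.pi ^ 2 * (((k + 1 : ℕ) : ℝ) ^ 2 * nome ^ ((k + 1) ^ 2)) with hLdef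
  have hHpos : 0 < H := by rw [hHdef]; linarith
  have hL0 : 0 ≤ L := by rw [hLdef]; positivity
  have hLH : L ≤ 7 / 5 * H := by
    refine le_of_tendsto_of_tendsto' hL (hH.const_mul (7 / 5)) fun ξ => ?_
    rw [← mul_div_assoc]
    exact div_le_div_of_nonneg_right (ell_zero_sub_le ξ) (sq_nonneg _)
  have hS : Tendsto (fun ξ => a ξ + b ξ) (𝓝[≠] 0) (𝓝 (a 0 + b 0)) :=
    ((continuous_a.add continuous_b).tendsto 0).mono_left nhdsWithin_le_nhds
  have hD := (((hH.pow 2).const_mul 2).sub (hL.pow 2)).const_mul (1 / (gam * Real.sqrt Real.pi))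
  refine ⟨_, ?_, ((hD.mul hS).sqrt).congr' ?_⟩
  · refine Real.sqrt_pos.2 (mul_pos (mul_pos (by positivity) ?_) (a_add_b_pos 0))
    nlinarith [pow_le_pow_left₀ hL0 hLH 2, mul_pos hHpos hHpos]
  · filter_upwards [self_mem_nhdsWithin] with ξ hξ
    have hξ : 0 < ξ ^ 2 := by have : ξ ≠ 0 := hξ; positivity
    rw [← Real.sqrt_sq (show 0 ≤ mu ξ / ξ ^ 2 from div_nonneg (Real.sqrt_nonneg _) hξ.le),
      div_pow (mu ξ), mu_sq, a_sub_b]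
    congr 1
    field_simp

/-! ### Fourier coefficients on `[0,1]` -/

/-- The coefficient of `e^{-2πinξ}` in the Fourier series of `F` on `[0,1]`. -/
def fcoef (F : ℝ → ℂ) (n : ℤ) : ℂ :=
  ∫ ξ in Set.Icc (0 : ℝ) 1, Complex.exp (2 * Real.pi * Complex.I * n * ξ) * F ξ

instance isProbabilityMeasure_Icc : IsProbabilityMeasure (volume.restrict (Set.Icc (0 : ℝ) 1)) :=
  ⟨by simp⟩

lemma norm_character (n : ℤ) (ξ : ℝ) :
    ‖Complex.exp (2 * Real.pi * Complex.I * n * ξ)‖ = 1 := by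
  rw [show 2 * Real.pi * Complex.I * n * ξ = ((2 * Real.pi * n * ξ : ℝ) : ℂ) * Complex.I by
    push_cast; ring, Complex.norm_exp_ofReal_mul_I]

lemma fcoef_eq_fourierCoeffOn (F : ℝ → ℂ) (n : ℤ) :
    fcoef F n = fourierCoeffOn zero_lt_one F (-n) := by
  rw [fourierCoeffOn_eq_integral, intervalIntegral.integral_of_le zero_le_one,
    ← integral_Icc_eq_integral_Ioc, fcoef]
  simp only [sub_zero, div_one, one_smul, neg_neg, smul_eq_mul]
  refine integral_congr_ae (Eventually.of_forall fun ξ => ?_)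
  simp only
  rw [fourier_coe_apply]
  push_cast
  rw [sub_zero, div_one]

/-- Parseval's identity, as a bound of the norm by partial sums of the coefficients. -/
lemma normL2_le_of_sum_sq_le {F : ℝ → ℂ} (hF : MemLp F 2 (volume.restrict (Set.Icc 0 1)))
    {B : ℝ} (hB : 0 ≤ B) (h : ∀ s : Finset ℤ, ∑ n ∈ s, ‖fcoef F n‖ ^ 2 ≤ B ^ 2) :
    normL2 F ≤ ENNReal.ofReal B := by
  have hF' : MemLp F 2 (volume.restrict (Set.Ioc 0 1)) := by
    rwa [Measure.restrict_congr_set Ioc_ae_eq_Icc]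
  have hP := hasSum_sq_fourierCoeffOn zero_lt_one hF'
  have hint : ∫ ξ in Set.Icc (0 : ℝ) 1, ‖F ξ‖ ^ 2 ≤ B ^ 2 := by
    rw [intervalIntegral.integral_of_le zero_le_one, ← integral_Icc_eq_integral_Ioc] at hP
    simp only [sub_zero, inv_one, one_smul] at hP
    refine le_of_tendsto' hP fun s => ?_
    refine le_trans (le_of_eq ?_) (h (s.map (Equiv.neg ℤ).toEmbedding))
    simp [Finset.sum_map, fcoef_eq_fourierCoeffOn]
  unfold normL2
  rw [hF.eLpNorm_eq_integral_rpow_norm two_ne_zero ENNReal.ofNat_ne_top]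
  refine ENNReal.ofReal_le_ofReal ?_
  simp only [ENNReal.toReal_ofNat, Real.rpow_ofNat]
  rw [← Real.sqrt_sq hB, Real.sqrt_eq_rpow, one_div]
  exact Real.rpow_le_rpow (integral_nonneg fun _ => by positivity) hint (by norm_num)

lemma integrable_character_mul {F : ℝ → ℂ}
    (hF : Integrable F (volume.restrict (Set.Icc 0 1))) (n : ℤ) :
    Integrable (fun ξ : ℝ => Complex.exp (2 * Real.pi * Complex.I * n * ξ) * F ξ)
      (volume.restrict (Set.Icc 0 1)) :=
  hF.bdd_mul (c := 1) (by fun_prop) (Eventually.of_forall fun ξ => (norm_character n ξ).le)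

lemma fcoef_sub {F G : ℝ → ℂ} (hF : Integrable F (volume.restrict (Set.Icc 0 1)))
    (hG : Integrable G (volume.restrict (Set.Icc 0 1))) (n : ℤ) :
    fcoef (fun ξ => F ξ - G ξ) n = fcoef F n - fcoef G n := by
  unfold fcoef
  rw [← integral_sub (integrable_character_mul hF n) (integrable_character_mul hG n)]
  simp only [mul_sub]

lemma fcoef_add {F G : ℝ → ℂ} (hF : Integrable F (volume.restrict (Set.Icc 0 1)))
    (hG : Integrable G (volume.restrict (Set.Icc 0 1))) (n : ℤ) :
    fcoef (fun ξ => F ξ + G ξ) n = fcoef F n + fcoef G n := by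
  unfold fcoef
  rw [← integral_add (integrable_character_mul hF n) (integrable_character_mul hG n)]
  simp only [mul_add]

lemma fcoef_const_mul (c : ℂ) (F : ℝ → ℂ) (n : ℤ) :
    fcoef (fun ξ => c * F ξ) n = c * fcoef F n := by
  unfold fcoef
  rw [← integral_const_mul]
  simp only [mul_left_comm]

/-- On a space of total mass one the `L¹` norm is at most the `L²` norm. -/
lemma enorm_fcoef_le {F : ℝ → ℂ} (hF : AEStronglyMeasurable F (volume.restrict (Set.Icc 0 1)))
    (n : ℤ) : ‖fcoef F n‖ₑ ≤ normL2 F := by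
  unfold fcoef normL2
  refine (enorm_integral_le_lintegral_enorm _).trans ?_
  refine le_trans (le_of_eq ?_) (eLpNorm_le_eLpNorm_of_exponent_le one_le_two hF)
  rw [eLpNorm_one_eq_lintegral_enorm]
  refine lintegral_congr fun ξ => ?_
  rw [enorm_mul, ← ofReal_norm, norm_character, ENNReal.ofReal_one, one_mul]

lemma fcoef_character (m n : ℤ) :
    fcoef (fun ξ => Complex.exp (-2 * Real.pi * Complex.I * m * ξ)) n = if m = n then 1 else 0 := by
  unfold fcoef
  simp only [← Complex.exp_add]
  split_ifs with h
  · subst h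
    rw [integral_congr_ae (g := fun _ => (1 : ℂ)) (Eventually.of_forall fun ξ => by
      simp only
      rw [show 2 * Real.pi * Complex.I * m * (ξ : ℂ) + -2 * Real.pi * Complex.I * m * ξ = 0 by ring,
        Complex.exp_zero])]
    simp
  · have hc : 2 * Real.pi * Complex.I * (n - m : ℂ) ≠ 0 := by
      have : (n - m : ℂ) ≠ 0 := by
        rw [sub_ne_zero]; exact_mod_cast Ne.symm h
      exact mul_ne_zero Complex.two_pi_I_ne_zero this
    rw [integral_Icc_eq_integral_Ioc, ← intervalIntegral.integral_of_le zero_le_one]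
    have e : ∀ ξ : ℝ, Complex.exp (2 * Real.pi * Complex.I * n * ξ +
        -2 * Real.pi * Complex.I * m * ξ) =
        Complex.exp (2 * Real.pi * Complex.I * (n - m : ℂ) * ξ) := fun ξ => by ring_nf
    simp only [e]
    rw [integral_exp_mul_complex hc]
    have : Complex.exp (2 * Real.pi * Complex.I * (n - m : ℂ)) = 1 :=
      Complex.exp_eq_one_iff.2 ⟨n - m, by push_cast; ring⟩
    simp [this]

/-- The coefficients of the series are the Fourier coefficients of its sum. -/
lemma IsFourierSum.fcoef_eq {c : ℤ → ℂ} {f : ℝ → ℂ} (h : IsFourierSum c f) (n : ℤ) :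
    fcoef f n = c n := by
  have hf : Integrable f (volume.restrict (Set.Icc 0 1)) := h.memLp.integrable one_le_two
  have hch : ∀ m : ℤ, Integrable (fun ξ : ℝ => Complex.exp (-2 * Real.pi * Complex.I * m * ξ))
      (volume.restrict (Set.Icc 0 1)) := fun m => by
    refine Continuous.integrableOn_Icc ?_
    fun_prop
  have hsum : ∀ s : Finset ℤ, Integrable (fun ξ : ℝ =>
      ∑ m ∈ s, c m * Complex.exp (-2 * Real.pi * Complex.I * m * ξ))
      (volume.restrict (Set.Icc 0 1)) := fun s =>
    integrable_finsetSum s fun m _ => (hch m).const_mul _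
  have hpart : ∀ s : Finset ℤ, n ∈ s → fcoef (fun ξ : ℝ =>
      ∑ m ∈ s, c m * Complex.exp (-2 * Real.pi * Complex.I * m * ξ)) n = c n := by
    intro s hn
    have : fcoef (fun ξ : ℝ => ∑ m ∈ s, c m * Complex.exp (-2 * Real.pi * Complex.I * m * ξ)) n =
        ∑ m ∈ s, c m * fcoef (fun ξ => Complex.exp (-2 * Real.pi * Complex.I * m * ξ)) n := by
      unfold fcoef
      simp only [Finset.mul_sum]
      rw [integral_finsetSum]
      · refine Finset.sum_congr rfl fun m _ => ?_
        rw [← integral_const_mul]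
        simp only [mul_left_comm]
      · exact fun m _ => integrable_character_mul ((hch m).const_mul _) n
    rw [this]
    simp only [fcoef_character]
    simp [hn]
  have hle : ‖fcoef f n - c n‖ₑ ≤ 0 := by
    refine ge_of_tendsto h.tendsto ?_
    filter_upwards [eventually_ge_atTop {n}] with s hs
    have := enorm_fcoef_le (hf.sub (hsum s)).aestronglyMeasurable n
    rwa [show (f - fun ξ : ℝ => ∑ m ∈ s, c m * Complex.exp (-2 * Real.pi * Complex.I * m * ξ)) =
      fun ξ => f ξ - ∑ m ∈ s, c m * Complex.exp (-2 * Real.pi * Complex.I * m * ξ) from rfl,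
      fcoef_sub hf (hsum s), hpart s (by simpa using hs)] at this
  rw [nonpos_iff_eq_zero, enorm_eq_zero, sub_eq_zero] at hle
  exact hle

/-- Multiplication by an absolutely convergent trigonometric series acts on the coefficients by
convolution. -/
lemma hasSum_fcoef_mul {ι : Type*} [Countable ι] {α : ι → ℂ} {k : ι → ℤ} {A F : ℝ → ℂ}
    (hα : Summable fun i => ‖α i‖)
    (hA : ∀ ξ : ℝ, HasSum (fun i => α i * Complex.exp (2 * Real.pi * Complex.I * k i * ξ)) (A ξ))
    (hF : Integrable F (volume.restrict (Set.Icc 0 1))) (n : ℤ) :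
    HasSum (fun i => α i * fcoef F (n + k i)) (fcoef (fun ξ => A ξ * F ξ) n) := by
  have e : ∀ i, α i * fcoef F (n + k i) = ∫ ξ in Set.Icc (0 : ℝ) 1,
      α i * (Complex.exp (2 * Real.pi * Complex.I * (n + k i : ℤ) * ξ) * F ξ) := fun i => by
    rw [integral_const_mul]; rfl
  simp only [e]
  refine hasSum_integral_of_dominated_convergence (fun i ξ => ‖α i‖ * ‖F ξ‖) (fun i => ?_)
    (fun i => ?_) ?_ ?_ ?_
  · exact ((integrable_character_mul hF _).const_mul _).aestronglyMeasurable
  · refine Eventually.of_forall fun ξ => ?_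
    rw [norm_mul, norm_mul, norm_character, one_mul]
  · exact Eventually.of_forall fun ξ => hα.mul_right _
  · simp only [tsum_mul_right]
    exact hF.norm.const_mul _
  · refine Eventually.of_forall fun ξ => ?_
    have := ((hA ξ).mul_right (F ξ)).mul_left (Complex.exp (2 * Real.pi * Complex.I * n * ξ))
    refine Eq.mp (congrArg (fun φ => HasSum φ _) (funext fun i => ?_)) this
    rw [show 2 * Real.pi * Complex.I * (n + k i : ℤ) * ξ =
      2 * Real.pi * Complex.I * n * ξ + 2 * Real.pi * Complex.I * k i * ξ by push_cast; ring,
      Complex.exp_add]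
    ring

/-! ### The reflection `f ↦ conj f(-·)` -/

lemma measurePreserving_one_sub :
    MeasurePreserving (fun ξ : ℝ => 1 - ξ) (volume.restrict (Set.Icc 0 1))
      (volume.restrict (Set.Icc 0 1)) := by
  have h := (Measure.measurePreserving_sub_left (volume : Measure ℝ) 1).restrict_preimage
    (measurableSet_Icc (a := (0 : ℝ)) (b := 1))
  have e : (fun ξ : ℝ => 1 - ξ) ⁻¹' Set.Icc 0 1 = Set.Icc 0 1 := by
    ext ξ; simp
  rwa [e] at h

lemma reflect_eq {f : ℝ → ℂ} (h : Function.Periodic f 1) (ξ : ℝ) :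
    reflect f ξ = (starRingEnd ℂ) (f (1 - ξ)) := by
  unfold reflect
  rw [← h (-ξ), neg_add_eq_sub]

lemma memLp_reflect {f : ℝ → ℂ} (h : Function.Periodic f 1)
    (hf : MemLp f 2 (volume.restrict (Set.Icc 0 1))) :
    MemLp (reflect f) 2 (volume.restrict (Set.Icc 0 1)) := by
  rw [funext (reflect_eq h)]
  exact (hf.comp_measurePreserving measurePreserving_one_sub).star

lemma normL2_reflect {f : ℝ → ℂ} (h : Function.Periodic f 1)
    (hf : AEStronglyMeasurable f (volume.restrict (Set.Icc 0 1))) :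
    normL2 (reflect f) = normL2 f := by
  unfold normL2
  rw [← eLpNorm_comp_measurePreserving hf measurePreserving_one_sub]
  refine eLpNorm_congr_norm_ae (Eventually.of_forall fun ξ => ?_)
  rw [reflect_eq h]
  simp

/-- The reflection conjugates the coefficients without moving them. -/
lemma fcoef_reflect {f : ℝ → ℂ} (h : Function.Periodic f 1) (n : ℤ) :
    fcoef (reflect f) n = (starRingEnd ℂ) (fcoef f n) := by
  unfold fcoef
  rw [← integral_conj, ← measurePreserving_one_sub.integral_comp
    (Homeomorph.subLeft (1 : ℝ)).measurableEmbedding]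
  refine integral_congr_ae (Eventually.of_forall fun ξ => ?_)
  simp only
  rw [reflect_eq h, map_mul, ← Complex.exp_conj]
  rw [sub_sub_cancel]
  congr 1
  rw [Complex.exp_eq_exp_iff_exists_int]
  refine ⟨n, ?_⟩
  simp [map_ofNat]
  ring

/-! ### Integration over the strip -/

/-- One horizontal period `(-γ/2, γ/2)`. -/
def period : Set ℝ := Set.Ioo (-gam / 2) (gam / 2)

lemma volume_period : volume period = ENNReal.ofReal gam := by
  rw [period, Real.volume_Ioo]; congr 1; ring

instance isFiniteMeasure_period : IsFiniteMeasure (volume.restrict period) :=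
  ⟨by simp [volume_period]⟩

lemma measurePreserving_strip :
    MeasurePreserving (fun p : ℝ × ℝ => (p.1 + p.2 * Complex.I : ℂ))
      ((volume.restrict period).prod volume) stripMeasure := by
  have hms : MeasurableSet strip := by
    have : strip = Complex.re ⁻¹' period := rfl
    rw [this]
    exact Complex.measurable_re measurableSet_Ioo
  have h := Complex.volume_preserving_equiv_real_prod.symm.restrict_preimage hms
  have e : Complex.measurableEquivRealProd.symm ⁻¹' strip = period ×ˢ (Set.univ : Set ℝ) := by
    ext p
    simp [strip, period, Complex.measurableEquivRealProd]
  rw [e, Measure.volume_eq_prod, ← Measure.prod_restrict, Measure.restrict_univ] at h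
  unfold stripMeasure
  convert h using 1
  funext p
  apply Complex.ext <;> simp [Complex.measurableEquivRealProd]

lemma measurableEmbedding_add_mul_I :
    MeasurableEmbedding (fun p : ℝ × ℝ => (p.1 + p.2 * Complex.I : ℂ)) := by
  have h := Complex.measurableEquivRealProd.symm.measurableEmbedding
  convert h using 1
  funext p
  apply Complex.ext <;> simp [Complex.measurableEquivRealProd]

lemma integrable_strip_iff {G : ℂ → ℂ} : Integrable G stripMeasure ↔
    Integrable (fun p : ℝ × ℝ => G (p.1 + p.2 * Complex.I))
      ((volume.restrict period).prod volume) :=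
  (measurePreserving_strip.integrable_comp_emb measurableEmbedding_add_mul_I).symm

lemma integral_strip {G : ℂ → ℂ} (hG : Integrable G stripMeasure) :
    ∫ z, G z ∂stripMeasure = ∫ y : ℝ, ∫ x in period, G (x + y * Complex.I) := by
  rw [← measurePreserving_strip.integral_comp measurableEmbedding_add_mul_I]
  exact integral_prod_symm _ (integrable_strip_iff.1 hG)

lemma integrable_strip_of_le {G : ℂ → ℂ} (hG : Measurable G) {g : ℝ → ℝ} (hg : Integrable g)
    (hle : ∀ z, ‖G z‖ ≤ g z.im) : Integrable G stripMeasure := by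
  rw [integrable_strip_iff]
  have h : Integrable (fun p : ℝ × ℝ => (1 : ℝ) * g p.2) ((volume.restrict period).prod volume) :=
    (integrable_const (1 : ℝ)).mul_prod hg
  refine h.mono' (hG.comp (by fun_prop)).aestronglyMeasurable (Eventually.of_forall fun p => ?_)
  rw [one_mul]
  simpa using hle (p.1 + p.2 * Complex.I)

/-- Measurable functions growing more slowly than every Gaussian in the vertical direction,
uniformly in the horizontal one. -/
def Subgaussian (u : ℂ → ℂ) : Prop :=
  Measurable u ∧ ∀ ε : ℝ, 0 < ε → ∃ B : ℝ, ∀ z, ‖u z‖ ≤ B * Real.exp (ε * z.im ^ 2)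

lemma Subgaussian.mul {u v : ℂ → ℂ} (hu : Subgaussian u) (hv : Subgaussian v) :
    Subgaussian fun z => u z * v z := by
  refine ⟨hu.1.mul hv.1, fun ε hε => ?_⟩
  obtain ⟨B, hB⟩ := hu.2 (ε / 2) (half_pos hε)
  obtain ⟨B', hB'⟩ := hv.2 (ε / 2) (half_pos hε)
  refine ⟨B * B', fun z => ?_⟩
  rw [norm_mul]
  refine (mul_le_mul (hB z) (hB' z) (norm_nonneg _) ((norm_nonneg _).trans (hB z))).trans_eq ?_
  rw [mul_mul_mul_comm, ← Real.exp_add]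
  congr 2; ring

lemma Subgaussian.add {u v : ℂ → ℂ} (hu : Subgaussian u) (hv : Subgaussian v) :
    Subgaussian fun z => u z + v z := by
  refine ⟨hu.1.add hv.1, fun ε hε => ?_⟩
  obtain ⟨B, hB⟩ := hu.2 ε hε
  obtain ⟨B', hB'⟩ := hv.2 ε hε
  refine ⟨B + B', fun z => (norm_add_le _ _).trans ?_⟩
  rw [add_mul]
  exact add_le_add (hB z) (hB' z)

lemma Subgaussian.conj {u : ℂ → ℂ} (hu : Subgaussian u) :
    Subgaussian fun z => (starRingEnd ℂ) (u z) :=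
  ⟨Complex.continuous_conj.measurable.comp hu.1, fun ε hε => by simpa using hu.2 ε hε⟩

lemma Subgaussian.const_mul {u : ℂ → ℂ} (hu : Subgaussian u) (c : ℂ) :
    Subgaussian fun z => c * u z := by
  refine ⟨hu.1.const_mul c, fun ε hε => ?_⟩
  obtain ⟨B, hB⟩ := hu.2 ε hε
  refine ⟨‖c‖ * B, fun z => ?_⟩
  rw [norm_mul, mul_assoc]
  exact mul_le_mul_of_nonneg_left (hB z) (norm_nonneg _)

lemma subgaussian_psi (k : ℤ) : Subgaussian (psi k) := by
  refine ⟨(continuous_psi k).measurable, fun ε hε => ⟨psiNorm, fun z => ?_⟩⟩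
  rw [norm_psi]
  refine mul_le_mul_of_nonneg_left (Real.exp_le_exp.2 ?_) psiNorm_pos.le
  nlinarith [sq_nonneg (z.im + stp * k), sq_nonneg z.im]

lemma subgaussian_Psi0 : Subgaussian Psi0 := by
  refine ⟨measurable_Psi0, fun ε hε => ?_⟩
  obtain ⟨B, hB⟩ := tsum_amp_le hε
  exact ⟨B, fun z => (norm_Psi0_le z).trans (hB _)⟩

/-- Decay in `y` for fixed `k`, with some of the rate sacrificed to recentre the Gaussian at `0`. -/
lemma amp_le_gaussian (k : ℤ) (y : ℝ) :
    amp k y ≤ psiNorm * Real.exp ((stp * k) ^ 2) * Real.exp (-(1 / 2) * y ^ 2) := by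
  unfold amp
  rw [mul_assoc, ← Real.exp_add]
  refine mul_le_mul_of_nonneg_left (Real.exp_le_exp.2 ?_) psiNorm_pos.le
  nlinarith [sq_nonneg (y + 2 * (stp * k))]

lemma Subgaussian.integrable_mul_conj_psi {u : ℂ → ℂ} (hu : Subgaussian u) (k : ℤ) :
    Integrable (fun z => u z * (starRingEnd ℂ) (psi k z)) stripMeasure := by
  obtain ⟨B, hB⟩ := hu.2 (1 / 4) (by norm_num)
  refine integrable_strip_of_le (g := fun y => B * (psiNorm * Real.exp ((stp * k) ^ 2)) *
    Real.exp (-(1 / 4) * y ^ 2)) (hu.1.mul (subgaussian_psi k).conj.1)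
    ((integrable_exp_neg_mul_sq (by norm_num)).const_mul _) fun z => ?_
  rw [norm_mul, RCLike.norm_conj, norm_psi]
  refine (mul_le_mul (hB z) (amp_le_gaussian k z.im) (amp_pos _ _).le
    ((norm_nonneg _).trans (hB z))).trans_eq ?_
  rw [show -(1 / 4) * z.im ^ 2 = 1 / 4 * z.im ^ 2 + -(1 / 2) * z.im ^ 2 by ring, Real.exp_add]
  ring

/-! ### Horizontal Fourier modes -/

/-- `u = ∑ c_k ψ_k` in the sense of horizontal Fourier modes: at each height the `k`-th mode of `u`
is `c_k` times that of `ψ_k`. -/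
def HasModes (u : ℂ → ℂ) (c : ℤ → ℂ) : Prop :=
  ∀ (k : ℤ) (y : ℝ), ∫ x in period, u (x + y * Complex.I) *
    Complex.exp (-Complex.I * phase k x y) = gam * c k * amp k y

lemma integral_amp_sq (k : ℤ) : ∫ y, amp k y ^ 2 = gam⁻¹ := by
  have e : ∀ y, amp k y ^ 2 = psiNorm ^ 2 * Real.exp (-2 * (y + stp * k) ^ 2) := fun y => by
    unfold amp
    rw [mul_pow, ← Real.exp_nat_mul]; congr 2; push_cast; ring
  simp only [e]
  rw [integral_const_mul, integral_add_right_eq_self (fun y => Real.exp (-2 * y ^ 2)),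
    integral_gaussian]
  have := psiNorm_sq_mul
  have hg := gam_pos
  field_simp
  linarith

/-- The modes of `u` determine its coefficients: integrate over each horizontal period first, then
use that the vertical integral of `|ψ_k|²` is `γ⁻¹` (`integral_amp_sq`). -/
lemma HasModes.coeff_eq {u : ℂ → ℂ} {c : ℤ → ℂ} (h : HasModes u c) (hu : Subgaussian u) (k : ℤ) :
    coeff u k = c k := by
  unfold coeff
  rw [integral_strip (hu.integrable_mul_conj_psi k)]
  have e : ∀ y : ℝ, ∫ x in period, u (x + y * Complex.I) *
      (starRingEnd ℂ) (psi k (x + y * Complex.I)) = gam * c k * ((amp k y ^ 2 : ℝ) : ℂ) := by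
    intro y
    have : ∀ x : ℝ, u (x + y * Complex.I) * (starRingEnd ℂ) (psi k (x + y * Complex.I)) =
        amp k y * (u (x + y * Complex.I) * Complex.exp (-Complex.I * phase k x y)) := by
      intro x
      rw [conj_psi]
      simp only [Complex.add_re, Complex.add_im, Complex.ofReal_re, Complex.ofReal_im,
        Complex.mul_re, Complex.mul_im, Complex.I_re, Complex.I_im, mul_zero, mul_one,
        sub_zero, add_zero, zero_add]
      ring
    simp only [this]
    rw [integral_const_mul, h k y]
    push_cast; ring
  simp only [e]
  rw [integral_const_mul, integral_complex_ofReal, integral_amp_sq]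
  have : (gam : ℂ) ≠ 0 := by exact_mod_cast gam_pos.ne'
  push_cast
  field_simp

lemma integral_period_character (m : ℤ) :
    ∫ x in period, Complex.exp (Complex.I * (2 * stp * m * x : ℝ)) =
      if m = 0 then (gam : ℂ) else 0 := by
  have hg := gam_pos
  split_ifs with h
  · subst h
    simp [measureReal_def, volume_period, hg.le]
  · rw [period, ← integral_Ioc_eq_integral_Ioo, ← intervalIntegral.integral_of_le (by linarith)]
    have hc : Complex.I * (2 * stp * m : ℝ) ≠ 0 := by
      refine mul_ne_zero Complex.I_ne_zero ?_
      have := stp_pos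
      have : (m : ℝ) ≠ 0 := by exact_mod_cast h
      exact_mod_cast (by positivity : 2 * stp * m ≠ 0)
    have e : ∀ x : ℝ, Complex.exp (Complex.I * (2 * stp * m * x : ℝ)) =
        Complex.exp (Complex.I * (2 * stp * m : ℝ) * x) := fun x => by push_cast; ring_nf
    simp only [e]
    rw [integral_exp_mul_complex hc, div_eq_zero_iff]
    left
    rw [sub_eq_zero, Complex.exp_eq_exp_iff_exists_int]
    refine ⟨m, ?_⟩
    have hs : (gam : ℂ) * stp = Real.pi := by exact_mod_cast gam_mul_stp
    push_cast
    linear_combination (2 * Complex.I * m) * hs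

lemma hasModes_psi (m : ℤ) : HasModes (psi m) (fun k => if m = k then 1 else 0) := by
  intro k y
  have e : ∀ x : ℝ, psi m (x + y * Complex.I) * Complex.exp (-Complex.I * phase k x y) =
      amp m y * Complex.exp (-Complex.I * (Real.pi * (m ^ 2 - k ^ 2) / 2 : ℝ)) *
        Complex.exp (Complex.I * (2 * stp * (m - k : ℤ) * x : ℝ)) := by
    intro x
    rw [psi_add_mul_I, mul_assoc, mul_assoc, ← Complex.exp_add, ← Complex.exp_add]
    congr 2
    unfold phase
    push_cast
    ring
  simp only [e]
  rw [integral_const_mul, integral_period_character]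
  simp only [sub_eq_zero]
  split_ifs with h
  · subst h
    simp; ring
  · simp

lemma coeff_psi (m k : ℤ) : coeff (psi m) k = if m = k then 1 else 0 :=
  (hasModes_psi m).coeff_eq (subgaussian_psi m) k

lemma hasModes_Psi0 : HasModes Psi0 (fun _ => 1) := by
  intro k y
  have h : HasSum (fun m : ℤ => ∫ x in period, psi m (x + y * Complex.I) *
      Complex.exp (-Complex.I * phase k x y)) (∫ x in period, Psi0 (x + y * Complex.I) *
      Complex.exp (-Complex.I * phase k x y)) := by
    have hph : ∀ x : ℝ, ‖Complex.exp (-Complex.I * phase k x y)‖ = 1 := fun x => by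
      rw [neg_mul, mul_comm, ← neg_mul, ← Complex.ofReal_neg, Complex.norm_exp_ofReal_mul_I]
    refine hasSum_integral_of_dominated_convergence (fun m _ => amp m y) (fun m => ?_)
      (fun m => Eventually.of_forall fun x => ?_) (Eventually.of_forall fun x => summable_amp y)
      (integrable_const _) (Eventually.of_forall fun x => (hasSum_Psi0 _).mul_right _)
    · refine Continuous.aestronglyMeasurable ?_
      have := continuous_psi m
      unfold phase
      fun_prop
    · rw [norm_mul, hph, mul_one, norm_psi]
      simp
  simp only [hasModes_psi _ k y] at h
  refine h.unique ?_
  convert hasSum_ite_eq k ((gam : ℂ) * 1 * amp k y) using 2 with m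
  split_ifs with h1
  · rfl
  · simp

lemma coeff_Psi0 (k : ℤ) : coeff Psi0 k = 1 := hasModes_Psi0.coeff_eq subgaussian_Psi0 k

/-! ### The modes of a function in `𝓕_γ` -/

lemma norm_add_gam {u : ℂ → ℂ} (h : magTrans gam u = u) (z : ℂ) : ‖u (z + gam)‖ = ‖u z‖ := by
  rw [add_gam_of_magTrans_eq h, norm_mul, mul_comm Complex.I, Complex.norm_exp_ofReal_mul_I,
    one_mul]

lemma norm_add_int_mul_gam {u : ℂ → ℂ} (h : magTrans gam u = u) (n : ℤ) (z : ℂ) :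
    ‖u (z + n * gam)‖ = ‖u z‖ := by
  have hp : Function.Periodic (fun z => ‖u z‖) (gam : ℂ) := norm_add_gam h
  exact hp.int_mul n z

lemma MemFock.continuous {u : ℂ → ℂ} (h : MemFock u) : Continuous u := by
  obtain ⟨⟨F, hF, hu⟩, -⟩ := h
  have := hF.continuous
  rw [funext hu]
  fun_prop

/-- Translating the point into the strip turns polynomial growth in `|z|` into polynomial growth in
the height. -/
lemma MemPeriodicFock.subgaussian {u : ℂ → ℂ} (h : MemPeriodicFock u) : Subgaussian u := by
  refine ⟨h.1.continuous.measurable, fun ε hε => ?_⟩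
  obtain ⟨⟨-, A, M, hA⟩, hper⟩ := h
  have hg := gam_pos
  obtain ⟨N, hN⟩ := exists_nat_ge (M / 2)
  refine ⟨|A| * (N.factorial * Real.exp (ε * (1 + gam ^ 2)) / ε ^ N), fun z => ?_⟩
  obtain ⟨n, hn, -⟩ := existsUnique_add_zsmul_mem_Ico hg z.re 0
  rw [zero_add, zsmul_eq_mul] at hn
  rw [← norm_add_int_mul_gam hper n z]
  have hre : (z + n * gam).re = z.re + n * gam := by simp
  have him : (z + n * gam).im = z.im := by simp
  have hsq : ‖z + n * gam‖ ^ 2 ≤ gam ^ 2 + z.im ^ 2 := by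
    rw [Complex.sq_norm, Complex.normSq_apply, hre, him]
    nlinarith [hn.1, hn.2]
  have h1 : (1 : ℝ) ≤ 1 + ‖z + n * gam‖ ^ 2 := by linarith [sq_nonneg ‖z + n * gam‖]
  have hexp := Real.pow_div_factorial_le_exp (x := ε * (1 + gam ^ 2 + z.im ^ 2))
    (by positivity) N
  rw [div_le_iff₀ (by positivity), mul_pow] at hexp
  calc ‖u (z + n * gam)‖ ≤ A * (1 + ‖z + n * gam‖ ^ 2) ^ (M / 2) := hA _
    _ ≤ |A| * (1 + ‖z + n * gam‖ ^ 2) ^ (N : ℝ) :=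
        mul_le_mul (le_abs_self A) (Real.rpow_le_rpow_of_exponent_le h1 hN)
          (Real.rpow_nonneg (by linarith) _) (abs_nonneg _)
    _ = |A| * (1 + ‖z + n * gam‖ ^ 2) ^ N := by rw [Real.rpow_natCast]
    _ ≤ |A| * (1 + gam ^ 2 + z.im ^ 2) ^ N := by gcongr ?_ * ?_ ^ N; linarith
    _ ≤ |A| * (N.factorial * Real.exp (ε * (1 + gam ^ 2)) / ε ^ N * Real.exp (ε * z.im ^ 2)) := by
        refine mul_le_mul_of_nonneg_left ?_ (abs_nonneg _)
        rw [div_mul_eq_mul_div, le_div_iff₀ (by positivity), mul_assoc, ← Real.exp_add]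
        rw [← mul_add]
        linarith
    _ = _ := by ring

/-- The horizontal means of a `γ`-periodic entire function do not depend on the height. -/
lemma integral_period_eq_of_periodic {H : ℂ → ℂ} (hH : Differentiable ℂ H)
    (hp : Function.Periodic H gam) (y : ℝ) :
    ∫ x in period, H (x + y * Complex.I) = ∫ x in period, H x := by
  have hg := gam_pos
  have h := Complex.integral_boundary_rect_eq_zero_of_differentiableOn H
    ((-gam / 2 : ℝ) : ℂ) ((gam / 2 : ℝ) + y * Complex.I) hH.differentiableOn
  have hv : ∀ t : ℝ, H (((gam / 2 : ℝ) : ℂ) + t * Complex.I) =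
      H (((-gam / 2 : ℝ) : ℂ) + t * Complex.I) := fun t =>
    (congrArg H (by push_cast; ring)).trans (hp _)
  simp only [Complex.add_re, Complex.add_im, Complex.ofReal_re, Complex.ofReal_im, Complex.mul_re,
    Complex.mul_im, Complex.I_re, Complex.I_im, mul_zero, mul_one, zero_mul, sub_zero, add_zero,
    zero_add, hv, Complex.ofReal_zero] at h
  rw [add_sub_cancel_right, sub_eq_zero] at h
  rw [period, ← integral_Ioc_eq_integral_Ioo, ← integral_Ioc_eq_integral_Ioo,
    ← intervalIntegral.integral_of_le (by linarith),
    ← intervalIntegral.integral_of_le (by linarith)]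
  exact h.symm

/-- Multiplied by `e^{-2πikz/γ}`, the entire function `e^{-z²/2} F` is still `γ`-periodic, so its
horizontal means are independent of the height; these means are the `k`-th modes of `u` up to the
explicit factor by which `ψ_k` depends on `y`. -/
lemma MemPeriodicFock.exists_hasModes {u : ℂ → ℂ} (h : MemPeriodicFock u) :
    ∃ c, HasModes u c := by
  obtain ⟨⟨⟨F, hF, hu⟩, -⟩, hper⟩ := h
  have hs : (gam : ℂ) * stp = Real.pi := by exact_mod_cast gam_mul_stp
  -- `G = e^{-z²/2} F` is entire and `γ`-periodic
  have hG : ∀ z, F z * Complex.exp (-z ^ 2 / 2) =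
      u z * Complex.exp (((z.re : ℂ) ^ 2 + (z.im : ℂ) ^ 2 - z ^ 2) / 2) := fun z => by
    rw [hu, mul_comm (Complex.exp _), mul_assoc, ← Complex.exp_add, ofReal_norm_sq]
    congr 2; ring
  have hGp : ∀ k : ℤ, Function.Periodic
      (fun z => F z * Complex.exp (-z ^ 2 / 2) * Complex.exp (-2 * Complex.I * stp * k * z))
      (gam : ℂ) := by
    intro k z
    simp only
    rw [hG, hG, add_gam_of_magTrans_eq hper, mul_assoc, mul_assoc, mul_left_comm _ (u z),
      mul_assoc (u z)]
    congr 1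
    simp only [← Complex.exp_add]
    rw [Complex.exp_eq_exp_iff_exists_int]
    refine ⟨-k, ?_⟩
    have hz := Complex.re_add_im z
    simp only [Complex.add_re, Complex.add_im, Complex.ofReal_re, Complex.ofReal_im, add_zero]
    push_cast
    rw [← hz]
    simp only [Complex.add_re, Complex.add_im, Complex.ofReal_re, Complex.ofReal_im, add_zero,
      Complex.mul_re, Complex.mul_im, Complex.I_re, Complex.I_im, mul_zero, mul_one, sub_zero,
      zero_add]
    linear_combination (-2 * Complex.I * k) * hs
  have hcont : ∀ k : ℤ, Differentiable ℂ
      (fun z => F z * Complex.exp (-z ^ 2 / 2) * Complex.exp (-2 * Complex.I * stp * k * z)) := by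
    intro k; fun_prop
  refine ⟨fun k => (∫ x in period, F (x : ℂ) * Complex.exp (-(x : ℂ) ^ 2 / 2) *
    Complex.exp (-2 * Complex.I * stp * k * x)) *
    Complex.exp (stp ^ 2 * k ^ 2 + Complex.I * Real.pi * k ^ 2 / 2) / (gam * psiNorm),
    fun k y => ?_⟩
  have e : ∀ x : ℝ, u (x + y * Complex.I) * Complex.exp (-Complex.I * phase k x y) =
      Complex.exp (stp ^ 2 * k ^ 2 + Complex.I * Real.pi * k ^ 2 / 2) *
      Real.exp (-(y + stp * k) ^ 2) * (F (x + y * Complex.I) *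
        Complex.exp (-(x + y * Complex.I : ℂ) ^ 2 / 2) *
        Complex.exp (-2 * Complex.I * stp * k * (x + y * Complex.I))) := by
    intro x
    rw [hG]
    rw [mul_comm _ (_ * _ * _), mul_assoc, mul_assoc]
    congr 1
    push_cast
    simp only [← Complex.exp_add]
    congr 1
    simp only [Complex.add_re, Complex.add_im, Complex.ofReal_re, Complex.ofReal_im, add_zero,
      Complex.mul_re, Complex.mul_im, Complex.I_re, Complex.I_im, mul_zero, mul_one, sub_zero,
      zero_add]
    unfold phase
    push_cast
    linear_combination (2 * stp * k * y + y ^ 2 / 2) * Complex.I_sq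
  simp only [e]
  rw [integral_const_mul, integral_period_eq_of_periodic (hcont k) (hGp k) y]
  have hg : (gam : ℂ) ≠ 0 := by exact_mod_cast gam_pos.ne'
  have hn : (psiNorm : ℂ) ≠ 0 := by exact_mod_cast psiNorm_pos.ne'
  unfold amp
  push_cast
  field_simp

lemma MemPeriodicFock.hasModes {u : ℂ → ℂ} (h : MemPeriodicFock u) : HasModes u (coeff u) := by
  obtain ⟨c, hc⟩ := h.exists_hasModes
  rwa [show coeff u = c from funext (hc.coeff_eq h.subgaussian)]

/-! ### Bessel's inequality on the strip -/

lemma memLp_psi (k : ℤ) : MemLp (psi k) 2 stripMeasure := by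
  rw [memLp_two_iff_integrable_sq_norm (continuous_psi k).aestronglyMeasurable]
  refine ((subgaussian_psi k).integrable_mul_conj_psi k).norm.congr
    (Eventually.of_forall fun z => ?_)
  simp only [norm_mul, RCLike.norm_conj, sq]

lemma inner_toLp_psi {u : ℂ → ℂ} (hu : MemLp u 2 stripMeasure) (k : ℤ) :
    inner ℂ ((memLp_psi k).toLp (psi k)) (hu.toLp u) = coeff u k := by
  rw [L2.inner_def]
  refine integral_congr_ae ?_
  filter_upwards [(memLp_psi k).coeFn_toLp, hu.coeFn_toLp] with z h1 h2
  rw [h1, h2]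
  simp

lemma orthonormal_psi : Orthonormal ℂ fun k : ℤ => (memLp_psi k).toLp (psi k) := by
  rw [orthonormal_iff_ite]
  intro i j
  rw [inner_toLp_psi, coeff_psi]
  simp only [eq_comm]

/-- Bessel's inequality for the orthonormal family `ψ_k`. -/
lemma sum_sq_coeff_le {u : ℂ → ℂ} (hu : MemLp u 2 stripMeasure) (s : Finset ℤ) :
    ∑ k ∈ s, ‖coeff u k‖ ^ 2 ≤ (eLpNorm u 2 stripMeasure).toReal ^ 2 := by
  have h := orthonormal_psi.sum_inner_products_le (hu.toLp u) (s := s)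
  simp only [inner_toLp_psi] at h
  rwa [Lp.norm_toLp] at h

/-! ### The projector and the basis -/

/-- The integrand of the projector after centring the variable of integration at `z`. -/
def projKernel (z ζ : ℂ) : ℂ :=
  Complex.exp ((-‖ζ‖ ^ 2 / 2 : ℝ) + Complex.I * (ζ.re * z.im - ζ.im * z.re : ℝ))

lemma continuous_projKernel : Continuous fun p : ℂ × ℂ => projKernel p.1 p.2 := by
  unfold projKernel; fun_prop

lemma norm_projKernel (z ζ : ℂ) : ‖projKernel z ζ‖ = Real.exp (-‖ζ‖ ^ 2 / 2) := by
  unfold projKernel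
  rw [Complex.exp_add, norm_mul, mul_comm Complex.I, Complex.norm_exp_ofReal_mul_I, mul_one,
    ← Complex.ofReal_exp, Complex.norm_real, Real.norm_of_nonneg (Real.exp_pos _).le]

/-- After centring, the kernel has a modulus depending on `ζ` only and the factor `e^{-|z|²/2}`
disappears. -/
lemma proj_eq (u : ℂ → ℂ) (z : ℂ) :
    proj u z = 1 / (Real.pi : ℂ) * ∫ ζ, projKernel z ζ * u (z + ζ) := by
  unfold proj
  rw [mul_assoc, ← integral_const_mul, ← integral_add_left_eq_self _ z]
  congr 2
  funext ζ
  rw [← mul_assoc, ← Complex.exp_add]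
  congr 2
  rw [Complex.ofReal_div, Complex.ofReal_neg, Complex.ofReal_pow, ofReal_norm_sq, ofReal_norm_sq,
    ofReal_norm_sq]
  nth_rw 4 [← Complex.re_add_im z]
  have hz : (starRingEnd ℂ) z = z.re - z.im * Complex.I := by apply Complex.ext <;> simp
  have hζ : (starRingEnd ℂ) ζ = ζ.re - ζ.im * Complex.I := by apply Complex.ext <;> simp
  rw [map_add, hz, hζ]
  simp only [Complex.add_re, Complex.add_im]
  push_cast
  linear_combination (-(z.im : ℂ) ^ 2 - z.im * ζ.im) * Complex.I_sq

lemma measurable_proj {u : ℂ → ℂ} (hu : Measurable u) : Measurable (proj u) := by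
  have h : StronglyMeasurable (Function.uncurry fun z ζ : ℂ => projKernel z ζ * u (z + ζ)) :=
    (continuous_projKernel.measurable.mul
      (hu.comp (measurable_fst.add measurable_snd))).stronglyMeasurable
  rw [funext (proj_eq u)]
  exact (h.integral_prod_right (ν := volume)).measurable.const_mul _

lemma integrable_exp_neg_norm_sq {c : ℝ} (hc : 0 < c) :
    Integrable fun ζ : ℂ => Real.exp (-c * ‖ζ‖ ^ 2) := by
  have h := (integrable_exp_neg_mul_sq hc).mul_prod (integrable_exp_neg_mul_sq hc)
  have h2 := (Complex.volume_preserving_equiv_real_prod.integrable_comp_emb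
    Complex.measurableEquivRealProd.measurableEmbedding).2 h
  refine h2.congr (Eventually.of_forall fun ζ => ?_)
  simp only [Function.comp, Complex.measurableEquivRealProd_apply]
  rw [← Real.exp_add, Complex.sq_norm, Complex.normSq_apply]
  ring_nf

lemma integrable_strip_prod {G : ℂ × ℂ → ℂ} (hG : Measurable G) {C c : ℝ} (hc : 0 < c)
    (hle : ∀ p, ‖G p‖ ≤ C * Real.exp (-c * p.1.im ^ 2) * Real.exp (-c * ‖p.2‖ ^ 2)) :
    Integrable G (stripMeasure.prod volume) := by
  have h1 : Integrable (fun z : ℂ => ((C * Real.exp (-c * z.im ^ 2) : ℝ) : ℂ)) stripMeasure := by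
    refine integrable_strip_of_le (g := fun y => |C| * Real.exp (-c * y ^ 2)) (by fun_prop)
      ((integrable_exp_neg_mul_sq hc).const_mul _) fun z => ?_
    rw [Complex.norm_real, Real.norm_eq_abs, abs_mul, Real.abs_exp]
  have h2 := h1.re.mul_prod (integrable_exp_neg_norm_sq hc)
  exact h2.mono' hG.aestronglyMeasurable (Eventually.of_forall hle)

instance sfinite_stripMeasure : SFinite stripMeasure := by unfold stripMeasure; infer_instance

lemma Subgaussian.measurable_add {u : ℂ → ℂ} (hu : Subgaussian u) :
    Measurable fun p : ℂ × ℂ => u (p.1 + p.2) :=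
  hu.1.comp (measurable_fst.add measurable_snd)

/-- Fubini's hypothesis for `⟨Π u, ψ_n⟩`: the Gaussians in `ζ` and in the height of `z` absorb the
growth of `u`, for which the exponent `1/8` is small enough. -/
lemma Subgaussian.integrable_projKernel {u : ℂ → ℂ} (hu : Subgaussian u) (n : ℤ) :
    Integrable (fun p : ℂ × ℂ => projKernel p.1 p.2 * u (p.1 + p.2) *
      (starRingEnd ℂ) (psi n p.1)) (stripMeasure.prod volume) := by
  obtain ⟨B, hB⟩ := hu.2 (1 / 8) (by norm_num)
  have hB0 : 0 ≤ B := by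
    by_contra h
    exact absurd (hB 0) (not_le.2 ((mul_neg_of_neg_of_pos (not_le.1 h) (Real.exp_pos _)).trans_le
      (norm_nonneg _)))
  refine integrable_strip_prod (c := 1 / 4) (C := B * (psiNorm * Real.exp ((stp * n) ^ 2)))
    ((continuous_projKernel.measurable.mul hu.measurable_add).mul
      ((subgaussian_psi n).conj.1.comp measurable_fst)) (by norm_num) fun p => ?_
  rw [norm_mul, norm_mul, RCLike.norm_conj, norm_psi, norm_projKernel]
  have him : p.2.im ^ 2 ≤ ‖p.2‖ ^ 2 := by
    rw [Complex.sq_norm, Complex.normSq_apply]; nlinarith [sq_nonneg p.2.re]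
  have hpn := psiNorm_pos
  calc Real.exp (-‖p.2‖ ^ 2 / 2) * ‖u (p.1 + p.2)‖ * amp n p.1.im
      ≤ Real.exp (-‖p.2‖ ^ 2 / 2) * (B * Real.exp (1 / 8 * (p.1 + p.2).im ^ 2)) *
        (psiNorm * Real.exp ((stp * n) ^ 2) * Real.exp (-(1 / 2) * p.1.im ^ 2)) := by
        gcongr
        · exact (amp_pos _ _).le
        · exact hB _
        · exact amp_le_gaussian n p.1.im
    _ = B * (psiNorm * Real.exp ((stp * n) ^ 2)) * Real.exp (-‖p.2‖ ^ 2 / 2 +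
        1 / 8 * (p.1 + p.2).im ^ 2 + -(1 / 2) * p.1.im ^ 2) := by
        rw [Real.exp_add, Real.exp_add]; ring
    _ ≤ B * (psiNorm * Real.exp ((stp * n) ^ 2)) *
        Real.exp (-(1 / 4) * p.1.im ^ 2 + -(1 / 4) * ‖p.2‖ ^ 2) := by
        refine mul_le_mul_of_nonneg_left (Real.exp_le_exp.2 ?_) (by positivity)
        rw [Complex.add_im]
        nlinarith [sq_nonneg (p.1.im - p.2.im)]
    _ = _ := by rw [Real.exp_add]; ring

/-- The counterpart of `Subgaussian.integrable_projKernel` after the translation `z ↦ z - ζ`.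
Recentring the Gaussian of `ψ_n` at `0` leaves less room, whence the exponent `1/12`. -/
lemma Subgaussian.integrable_projKernel_shift {u : ℂ → ℂ} (hu : Subgaussian u) (n : ℤ) :
    Integrable (fun p : ℂ × ℂ => projKernel p.1 p.2 * u p.1 *
      (starRingEnd ℂ) (psi n (p.1 - p.2))) (stripMeasure.prod volume) := by
  obtain ⟨B, hB⟩ := hu.2 (1 / 12) (by norm_num)
  have hB0 : 0 ≤ B := by
    by_contra h
    exact absurd (hB 0) (not_le.2 ((mul_neg_of_neg_of_pos (not_le.1 h) (Real.exp_pos _)).trans_le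
      (norm_nonneg _)))
  refine integrable_strip_prod (c := 1 / 12) (C := B * (psiNorm * Real.exp ((stp * n) ^ 2)))
    ((continuous_projKernel.measurable.mul (hu.1.comp measurable_fst)).mul
      ((subgaussian_psi n).conj.1.comp (measurable_fst.sub measurable_snd))) (by norm_num)
    fun p => ?_
  rw [norm_mul, norm_mul, RCLike.norm_conj, norm_psi, norm_projKernel]
  have him : p.2.im ^ 2 ≤ ‖p.2‖ ^ 2 := by
    rw [Complex.sq_norm, Complex.normSq_apply]; nlinarith [sq_nonneg p.2.re]
  have hpn := psiNorm_pos
  calc Real.exp (-‖p.2‖ ^ 2 / 2) * ‖u p.1‖ * amp n (p.1 - p.2).im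
      ≤ Real.exp (-‖p.2‖ ^ 2 / 2) * (B * Real.exp (1 / 12 * p.1.im ^ 2)) *
        (psiNorm * Real.exp ((stp * n) ^ 2) * Real.exp (-(1 / 2) * (p.1 - p.2).im ^ 2)) := by
        gcongr
        · exact (amp_pos _ _).le
        · exact hB _
        · exact amp_le_gaussian n (p.1 - p.2).im
    _ = B * (psiNorm * Real.exp ((stp * n) ^ 2)) * Real.exp (-‖p.2‖ ^ 2 / 2 +
        1 / 12 * p.1.im ^ 2 + -(1 / 2) * (p.1 - p.2).im ^ 2) := by
        rw [Real.exp_add, Real.exp_add]; ring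
    _ ≤ B * (psiNorm * Real.exp ((stp * n) ^ 2)) *
        Real.exp (-(1 / 12) * p.1.im ^ 2 + -(1 / 12) * ‖p.2‖ ^ 2) := by
        refine mul_le_mul_of_nonneg_left (Real.exp_le_exp.2 ?_) (by positivity)
        rw [Complex.sub_im]
        nlinarith [sq_nonneg (3 * p.2.im - 2 * p.1.im)]
    _ = _ := by rw [Real.exp_add]; ring

/-- Integrals of `γ`-periodic functions over the strip are invariant under all translations. -/
lemma integral_strip_sub {Φ : ℂ → ℂ} (hp : Function.Periodic Φ gam) (ζ : ℂ)
    (h1 : Integrable Φ stripMeasure) (h2 : Integrable (fun z => Φ (z - ζ)) stripMeasure) :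
    ∫ z, Φ (z - ζ) ∂stripMeasure = ∫ z, Φ z ∂stripMeasure := by
  have hg := gam_pos
  rw [integral_strip h1, integral_strip h2,
    ← integral_sub_right_eq_self (fun y : ℝ => ∫ x in period, Φ (x + y * Complex.I)) ζ.im]
  refine integral_congr_ae (Eventually.of_forall fun y => ?_)
  simp only
  have hper : Function.Periodic (fun x : ℝ => Φ (x + (y - ζ.im : ℝ) * Complex.I)) gam := by
    intro x
    exact (congrArg Φ (by push_cast; ring)).trans (hp _)
  have e : ∀ x : ℝ, Φ (x + y * Complex.I - ζ) =
      (fun x : ℝ => Φ (x + (y - ζ.im : ℝ) * Complex.I)) (x - ζ.re) := by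
    intro x
    simp only
    congr 1
    apply Complex.ext <;> simp
  simp only [e]
  rw [period, ← integral_Ioc_eq_integral_Ioo, ← integral_Ioc_eq_integral_Ioo,
    ← intervalIntegral.integral_of_le (by linarith),
    ← intervalIntegral.integral_of_le (by linarith),
    intervalIntegral.integral_comp_sub_right (fun x : ℝ => Φ (x + (y - ζ.im : ℝ) * Complex.I))]
  have := hper.intervalIntegral_add_eq (-gam / 2 - ζ.re) (-gam / 2)
  convert this using 2 <;> ring

/-- The reproducing property of the projector on `ψ_n`, in the form needed after unfolding. -/
lemma integral_projKernel_mul_conj_psi (n : ℤ) (z : ℂ) :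
    ∫ ζ, projKernel z ζ * (starRingEnd ℂ) (psi n (z - ζ)) =
      Real.pi * (starRingEnd ℂ) (psi n z) := by
  have hint : Integrable (fun ζ => projKernel z ζ * (starRingEnd ℂ) (psi n (z - ζ))) := by
    have hK : Continuous fun ζ => projKernel z ζ :=
      continuous_projKernel.comp (continuous_const.prodMk continuous_id)
    have hψ : Continuous fun ζ => (starRingEnd ℂ) (psi n (z - ζ)) :=
      Complex.continuous_conj.comp ((continuous_psi n).comp (continuous_const.sub continuous_id))
    refine ((integrable_exp_neg_norm_sq one_half_pos).mul_const psiNorm).mono'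
      (hK.mul hψ).aestronglyMeasurable (Eventually.of_forall fun ζ => ?_)
    rw [norm_mul, RCLike.norm_conj, norm_psi, norm_projKernel]
    have h1 : amp n (z - ζ).im ≤ psiNorm :=
      mul_le_of_le_one_right psiNorm_pos.le
        (Real.exp_le_one_iff.2 (neg_nonpos.2 (sq_nonneg _)))
    rw [show -‖ζ‖ ^ 2 / 2 = -(1 / 2) * ‖ζ‖ ^ 2 by ring]
    gcongr
  have hmp := Complex.volume_preserving_equiv_real_prod.symm
  have hme := Complex.measurableEquivRealProd.symm.measurableEmbedding
  rw [← hmp.integral_comp hme]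
  refine (integral_prod_symm (fun p : ℝ × ℝ =>
    projKernel z (Complex.measurableEquivRealProd.symm p) *
      (starRingEnd ℂ) (psi n (z - Complex.measurableEquivRealProd.symm p)))
    ((hmp.integrable_comp_emb hme).2 hint)).trans ?_
  -- with `ζ = s + it`, the exponent is quadratic in `s` and then in `t`; the answer depends on `z`
  -- through the distance `Y` to the centre of `ψ_n`
  set Y : ℝ := z.im + stp * n with hY
  have hY' : (Y : ℂ) = z.im + stp * n := by rw [hY]; push_cast; rfl
  have e : ∀ t s : ℝ, projKernel z (Complex.measurableEquivRealProd.symm (s, t)) *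
      (starRingEnd ℂ) (psi n (z - Complex.measurableEquivRealProd.symm (s, t))) =
      psiNorm * Complex.exp ((-1 / 2 : ℂ) * s ^ 2 + Complex.I * (2 * Y - t) * s +
        (-2 * t ^ 2 + 4 * Y * t + (-3 * Y ^ 2 - Complex.I * phase n z.re z.im) +
          (2 * Y - t) ^ 2 / 2)) := by
    intro t s
    have hre : (Complex.measurableEquivRealProd.symm (s, t)).re = s := rfl
    have him : (Complex.measurableEquivRealProd.symm (s, t)).im = t := rfl
    rw [conj_psi, projKernel, Complex.sub_re, Complex.sub_im, hre, him, Complex.sq_norm,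
      Complex.normSq_apply, hre, him]
    unfold amp phase
    push_cast
    rw [mul_assoc (psiNorm : ℂ), mul_left_comm, ← Complex.exp_add, ← Complex.exp_add, hY']
    congr 2
    ring
  have hs : ∀ t : ℝ, ∫ s : ℝ, projKernel z (Complex.measurableEquivRealProd.symm (s, t)) *
      (starRingEnd ℂ) (psi n (z - Complex.measurableEquivRealProd.symm (s, t))) =
      psiNorm * (Real.pi / -(-1 / 2 : ℂ)) ^ (1 / 2 : ℂ) *
      Complex.exp ((-2 : ℂ) * t ^ 2 + 4 * Y * t +
        (-3 * Y ^ 2 - Complex.I * phase n z.re z.im)) := by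
    intro t
    simp only [e]
    rw [integral_const_mul, integral_cexp_quadratic (by norm_num), ← mul_assoc]
    congr 2
    rw [mul_pow, Complex.I_sq]
    ring
  simp only [hs]
  rw [integral_const_mul, integral_cexp_quadratic (by norm_num), conj_psi]
  have hpi : ((Real.pi / -(-1 / 2 : ℂ)) ^ (1 / 2 : ℂ)) * (Real.pi / -(-2 : ℂ)) ^ (1 / 2 : ℂ) =
      Real.pi := by
    rw [show (Real.pi / -(-1 / 2 : ℂ)) = ((Real.pi * 2 : ℝ) : ℂ) by push_cast; ring,
      show (Real.pi / -(-2 : ℂ)) = ((Real.pi / 2 : ℝ) : ℂ) by push_cast; ring,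
      show (1 / 2 : ℂ) = ((1 / 2 : ℝ) : ℂ) by push_cast; rfl,
      ← Complex.ofReal_cpow (by positivity), ← Complex.ofReal_cpow (by positivity),
      ← Complex.ofReal_mul, ← Real.mul_rpow (by positivity) (by positivity),
      ← Real.sqrt_eq_rpow, show Real.pi * 2 * (Real.pi / 2) = Real.pi ^ 2 by ring,
      Real.sqrt_sq Real.pi_pos.le]
  unfold amp
  have hexp : Complex.exp (-3 * (Y : ℂ) ^ 2 - Complex.I * phase n z.re z.im -
      (4 * Y) ^ 2 / (4 * (-2))) = Complex.exp (-(Y : ℂ) ^ 2) *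
        Complex.exp (-Complex.I * phase n z.re z.im) := by
    rw [← Complex.exp_add]; congr 1; ring
  rw [← hY, hexp]
  push_cast
  linear_combination (psiNorm * Complex.exp (-(Y : ℂ) ^ 2) *
    Complex.exp (-Complex.I * phase n z.re z.im)) * hpi

/-- The projector does not change the coefficients of an `R_γ`-invariant function: exchange the two
integrations, translate by `ζ` in the strip, where the integrand is `γ`-periodic, and apply the
reproducing property of `ψ_n`. -/
lemma coeff_proj {u : ℂ → ℂ} (hu : Subgaussian u) (hper : magTrans gam u = u) (n : ℤ) :
    Integrable (fun z => proj u z * (starRingEnd ℂ) (psi n z)) stripMeasure ∧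
      coeff (proj u) n = coeff u n := by
  have hK := hu.integrable_projKernel n
  have hK' := hu.integrable_projKernel_shift n
  have e1 : ∀ z, proj u z * (starRingEnd ℂ) (psi n z) = 1 / (Real.pi : ℂ) *
      ∫ ζ, projKernel z ζ * u (z + ζ) * (starRingEnd ℂ) (psi n z) := fun z => by
    rw [proj_eq, integral_mul_const, mul_assoc]
  refine ⟨?_, ?_⟩
  · simp only [e1]
    exact hK.integral_prod_left.const_mul _
  have hshift : ∀ᵐ ζ : ℂ, ∫ z, projKernel z ζ * u (z + ζ) * (starRingEnd ℂ) (psi n z)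
      ∂stripMeasure = ∫ z, projKernel z ζ * u z * (starRingEnd ℂ) (psi n (z - ζ))
      ∂stripMeasure := by
    filter_upwards [hK.prod_left_ae, hK'.prod_left_ae] with ζ h1 h2
    have e : ∀ z, projKernel z ζ * u z * (starRingEnd ℂ) (psi n (z - ζ)) =
        (fun z => projKernel z ζ * u (z + ζ) * (starRingEnd ℂ) (psi n z)) (z - ζ) := fun z => by
      simp only [sub_add_cancel]
      congr 2
      unfold projKernel
      simp only [Complex.sub_re, Complex.sub_im]
      ring_nf
    replace h2 := h2.congr (Eventually.of_forall e)
    rw [integral_congr_ae (Eventually.of_forall e)]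
    refine (integral_strip_sub (fun z => ?_) ζ h1 h2).symm
    rw [add_right_comm z, add_gam_of_magTrans_eq hper,
      add_gam_of_magTrans_eq (magTrans_psi n), map_mul, ← Complex.exp_conj]
    rw [show projKernel (z + gam) ζ = projKernel z ζ *
      Complex.exp (-Complex.I * (gam * ζ.im : ℝ)) by
        unfold projKernel
        rw [← Complex.exp_add]
        congr 1
        simp only [Complex.add_re, Complex.add_im, Complex.ofReal_re, Complex.ofReal_im]
        push_cast; ring]
    have : Complex.exp (-Complex.I * (gam * ζ.im : ℝ)) *
        Complex.exp (Complex.I * (gam * (z + ζ).im : ℝ)) *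
        Complex.exp ((starRingEnd ℂ) (Complex.I * (gam * z.im : ℝ))) = 1 := by
      rw [← Complex.exp_add, ← Complex.exp_add, Complex.exp_eq_one_iff]
      refine ⟨0, ?_⟩
      rw [map_mul, Complex.conj_I, Complex.conj_ofReal, Complex.add_im]
      push_cast; ring
    linear_combination (projKernel z ζ * u (z + ζ) * (starRingEnd ℂ) (psi n z)) * this
  unfold coeff
  simp only [e1]
  rw [integral_const_mul, integral_integral_swap hK, integral_congr_ae hshift,
    ← integral_integral_swap hK']
  have e2 : ∀ z, ∫ ζ, projKernel z ζ * u z * (starRingEnd ℂ) (psi n (z - ζ)) =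
      Real.pi * (u z * (starRingEnd ℂ) (psi n z)) := fun z => by
    rw [mul_left_comm, ← integral_projKernel_mul_conj_psi, ← integral_const_mul]
    refine integral_congr_ae (Eventually.of_forall fun ζ => ?_)
    simp only
    ring
  simp only [e2]
  rw [integral_const_mul]
  have : (Real.pi : ℂ) ≠ 0 := by exact_mod_cast Real.pi_ne_zero
  field_simp

/-! ### The quartic interaction on the basis -/

/-- The interaction coefficient `∫ ψ_{n+p} ψ_{n+q} conj ψ_{n+p+q} conj ψ_n` over the strip, which
does not depend on `n`. -/
def kern (p : ℤ × ℤ) : ℝ :=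
  1 / (gam * Real.sqrt Real.pi) * (Real.cos (Real.pi * p.1 * p.2) *
    (Real.exp (-stp ^ 2 * p.1 ^ 2) * Real.exp (-stp ^ 2 * p.2 ^ 2)))

lemma exp_I_pi_int (m : ℤ) :
    Complex.exp (Complex.I * (Real.pi * m : ℝ)) = Real.cos (Real.pi * m) := by
  have hs : Real.sin (Real.pi * m) = 0 := by rw [mul_comm]; exact Real.sin_int_mul_pi m
  rw [mul_comm, Complex.exp_mul_I, ← Complex.ofReal_cos, ← Complex.ofReal_sin, hs]
  simp

/-- The four Gaussians are centred at `n`, `n + p`, `n + q`, `n + p + q` in units of `-π/γ`; the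
squared deviations from the common mean add up to `p² + q²`, without a cross term. -/
lemma gam_mul_integral_amp_four (n p q : ℤ) :
    gam * ∫ y, amp n y * amp (n + p) y * amp (n + q) y * amp (n + p + q) y =
      1 / (gam * Real.sqrt Real.pi) *
        (Real.exp (-stp ^ 2 * p ^ 2) * Real.exp (-stp ^ 2 * q ^ 2)) := by
  have e : ∀ y, amp n y * amp (n + p) y * amp (n + q) y * amp (n + p + q) y =
      psiNorm ^ 4 * (Real.exp (-stp ^ 2 * p ^ 2) * Real.exp (-stp ^ 2 * q ^ 2)) *
        Real.exp (-4 * (y + (stp * n + stp * (p + q) / 2)) ^ 2) := by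
    intro y
    unfold amp
    have : Real.exp (-(y + stp * n) ^ 2) * Real.exp (-(y + stp * (n + p : ℤ)) ^ 2) *
        Real.exp (-(y + stp * (n + q : ℤ)) ^ 2) * Real.exp (-(y + stp * (n + p + q : ℤ)) ^ 2) =
        Real.exp (-stp ^ 2 * p ^ 2) * Real.exp (-stp ^ 2 * q ^ 2) *
        Real.exp (-4 * (y + (stp * n + stp * (p + q) / 2)) ^ 2) := by
      simp only [← Real.exp_add]
      congr 1
      push_cast
      ring
    linear_combination psiNorm ^ 4 * this
  simp only [e]
  rw [integral_const_mul, integral_add_right_eq_self (fun y => Real.exp (-4 * y ^ 2)),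
    integral_gaussian, ← psiNorm_pow_four_mul, Real.sqrt_div Real.pi_pos.le,
    show (4 : ℝ) = 2 ^ 2 by norm_num, Real.sqrt_sq zero_le_two]
  ring

/-- For resonant indices the phases cancel up to a multiple of `π`, which gives the sign
`(-1)^{pq}`. -/
lemma phase_resonance (n p q : ℤ) (x y : ℝ) :
    phase (n + p) x y + phase (n + q) x y - phase (n + p + q) x y - phase n x y =
      Real.pi * (p * q : ℤ) := by
  unfold phase; push_cast; ring

/-- The interaction coefficient for the term `|Ψ₀|² v`. Only the mode `n + q` of `v` survives the
horizontal integration, and it has the vertical profile of `ψ_{n+q}`. -/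
lemma integral_psi_conj_psi_mul {v : ℂ → ℂ} {c : ℤ → ℂ} (hv : Subgaussian v) (hc : HasModes v c)
    (n p q : ℤ) :
    ∫ z, psi (n + p) z * (starRingEnd ℂ) (psi (n + p + q) z) * v z * (starRingEnd ℂ) (psi n z)
      ∂stripMeasure = kern (p, q) * c (n + q) := by
  rw [integral_strip ((((subgaussian_psi _).mul (subgaussian_psi _).conj).mul
    hv).integrable_mul_conj_psi n)]
  have e : ∀ x y : ℝ, psi (n + p) (x + y * Complex.I) *
      (starRingEnd ℂ) (psi (n + p + q) (x + y * Complex.I)) * v (x + y * Complex.I) *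
      (starRingEnd ℂ) (psi n (x + y * Complex.I)) =
      amp n y * amp (n + p) y * amp (n + p + q) y * Real.cos (Real.pi * (p * q : ℤ)) *
        (v (x + y * Complex.I) * Complex.exp (-Complex.I * phase (n + q) x y)) := by
    intro x y
    rw [← exp_I_pi_int, ← phase_resonance n p q x y, conj_psi, conj_psi, psi_eq]
    have hre : ((x : ℂ) + y * Complex.I).re = x := by simp
    have him : ((x : ℂ) + y * Complex.I).im = y := by simp
    rw [hre, him]
    have : Complex.exp (Complex.I * (phase (n + p) x y : ℝ)) *
        Complex.exp (-Complex.I * phase (n + p + q) x y) *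
        Complex.exp (-Complex.I * phase n x y) =
        Complex.exp (Complex.I * (phase (n + p) x y + phase (n + q) x y -
          phase (n + p + q) x y - phase n x y : ℝ)) *
        Complex.exp (-Complex.I * phase (n + q) x y) := by
      simp only [← Complex.exp_add]
      congr 1
      push_cast
      ring
    linear_combination (amp n y * amp (n + p) y * amp (n + p + q) y * v (x + y * Complex.I)) * this
  have e2 : ∀ y : ℝ, ∫ x in period, psi (n + p) (x + y * Complex.I) *
      (starRingEnd ℂ) (psi (n + p + q) (x + y * Complex.I)) * v (x + y * Complex.I) *
      (starRingEnd ℂ) (psi n (x + y * Complex.I)) =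
      (Real.cos (Real.pi * (p * q : ℤ)) * gam * c (n + q)) *
        ((amp n y * amp (n + p) y * amp (n + q) y * amp (n + p + q) y : ℝ) : ℂ) := by
    intro y
    simp only [e]
    rw [integral_const_mul, hc]
    push_cast
    ring
  simp only [e2]
  rw [integral_const_mul, integral_complex_ofReal]
  have h := congrArg (fun r : ℝ => (r : ℂ)) (gam_mul_integral_amp_four n p q)
  simp only [Complex.ofReal_mul gam] at h
  unfold kern
  simp only
  rw [mul_left_comm, Complex.ofReal_mul (Real.cos _), ← h, mul_assoc Real.pi]
  push_cast
  ring

/-- The interaction coefficient for the term `Ψ₀² conj v`, where the mode `n + p + q` of `v`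
survives. -/
lemma integral_psi_psi_mul_conj {v : ℂ → ℂ} {c : ℤ → ℂ} (hv : Subgaussian v) (hc : HasModes v c)
    (n p q : ℤ) :
    ∫ z, psi (n + p) z * psi (n + q) z * (starRingEnd ℂ) (v z) * (starRingEnd ℂ) (psi n z)
      ∂stripMeasure = kern (p, q) * (starRingEnd ℂ) (c (n + p + q)) := by
  rw [integral_strip ((((subgaussian_psi _).mul (subgaussian_psi _)).mul
    hv.conj).integrable_mul_conj_psi n)]
  have e : ∀ x y : ℝ, psi (n + p) (x + y * Complex.I) *
      psi (n + q) (x + y * Complex.I) * (starRingEnd ℂ) (v (x + y * Complex.I)) *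
      (starRingEnd ℂ) (psi n (x + y * Complex.I)) =
      amp n y * amp (n + p) y * amp (n + q) y * Real.cos (Real.pi * (p * q : ℤ)) *
        (starRingEnd ℂ) (v (x + y * Complex.I) *
          Complex.exp (-Complex.I * phase (n + p + q) x y)) := by
    intro x y
    rw [← exp_I_pi_int, ← phase_resonance n p q x y, conj_psi, psi_eq, psi_eq, map_mul,
      ← Complex.exp_conj, map_mul, map_neg, Complex.conj_I, Complex.conj_ofReal]
    have hre : ((x : ℂ) + y * Complex.I).re = x := by simp
    have him : ((x : ℂ) + y * Complex.I).im = y := by simp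
    rw [hre, him]
    have : Complex.exp (Complex.I * (phase (n + p) x y : ℝ)) *
        Complex.exp (Complex.I * phase (n + q) x y) *
        Complex.exp (-Complex.I * phase n x y) =
        Complex.exp (Complex.I * (phase (n + p) x y + phase (n + q) x y -
          phase (n + p + q) x y - phase n x y : ℝ)) *
        Complex.exp (- -Complex.I * phase (n + p + q) x y) := by
      simp only [← Complex.exp_add]
      congr 1
      push_cast
      ring
    linear_combination (amp n y * amp (n + p) y * amp (n + q) y *
      (starRingEnd ℂ) (v (x + y * Complex.I))) * this
  have e2 : ∀ y : ℝ, ∫ x in period, psi (n + p) (x + y * Complex.I) *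
      psi (n + q) (x + y * Complex.I) * (starRingEnd ℂ) (v (x + y * Complex.I)) *
      (starRingEnd ℂ) (psi n (x + y * Complex.I)) =
      (Real.cos (Real.pi * (p * q : ℤ)) * gam * (starRingEnd ℂ) (c (n + p + q))) *
        ((amp n y * amp (n + p) y * amp (n + q) y * amp (n + p + q) y : ℝ) : ℂ) := by
    intro y
    simp only [e]
    rw [integral_const_mul, integral_conj, hc, map_mul, map_mul, Complex.conj_ofReal,
      Complex.conj_ofReal]
    push_cast
    ring
  simp only [e2]
  rw [integral_const_mul, integral_complex_ofReal]
  have h := congrArg (fun r : ℝ => (r : ℂ)) (gam_mul_integral_amp_four n p q)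
  simp only [Complex.ofReal_mul gam] at h
  unfold kern
  simp only
  rw [mul_left_comm, Complex.ofReal_mul (Real.cos _), ← h, mul_assoc Real.pi]
  push_cast
  ring

/-- Two of the factors of a quartic integral may be expanded in the basis, term by term. The two
expanded factors and `u` each cost a weight `e^{y²/12}`, and the Gaussian `e^{-y²/2}` of `ψ_n` pays
for all three. -/
lemma hasSum_integral_mul_mul {e₁ e₂ : ℤ → ℂ → ℂ} {E₁ E₂ u : ℂ → ℂ} (h₁ : ∀ k, Subgaussian (e₁ k))
    (h₂ : ∀ k, Subgaussian (e₂ k)) (hn₁ : ∀ k z, ‖e₁ k z‖ = amp k z.im)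
    (hn₂ : ∀ k z, ‖e₂ k z‖ = amp k z.im) (hs₁ : ∀ z, HasSum (fun k => e₁ k z) (E₁ z))
    (hs₂ : ∀ z, HasSum (fun k => e₂ k z) (E₂ z)) (hu : Subgaussian u) (n : ℤ) :
    HasSum (fun p : ℤ × ℤ => ∫ z, e₁ p.1 z * e₂ p.2 z * u z * (starRingEnd ℂ) (psi n z)
      ∂stripMeasure) (coeff (fun z => E₁ z * E₂ z * u z) n) := by
  set β : ℤ → ℝ := fun k =>
    psiNorm * Real.exp (-(1 / 12 / (1 + 1 / 12) * stp ^ 2) * (k : ℝ) ^ 2) with hβ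
  have hβs : Summable β := (summable_exp_neg_mul_sq (by have := stp_pos; positivity)).mul_left _
  have hβ0 : ∀ k, 0 ≤ β k := fun k => by have := psiNorm_pos; positivity
  have hββ : Summable fun p : ℤ × ℤ => β p.1 * β p.2 :=
    hβs.mul_of_nonneg hβs hβ0 hβ0
  have hle : ∀ k y, amp k y ≤ β k * Real.exp (1 / 12 * y ^ 2) := fun k y =>
    amp_le (by norm_num) k y
  refine hasSum_integral_of_dominated_convergence
    (fun p z => β p.1 * β p.2 * (Real.exp (1 / 6 * z.im ^ 2) * ‖u z‖ * amp n z.im))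
    (fun p => ((((h₁ _).mul (h₂ _)).mul hu).integrable_mul_conj_psi n).aestronglyMeasurable)
    (fun p => Eventually.of_forall fun z => ?_) (Eventually.of_forall fun z => hββ.mul_right _) ?_
    (Eventually.of_forall fun z => ?_)
  · rw [norm_mul, norm_mul, norm_mul, RCLike.norm_conj, norm_psi, hn₁, hn₂]
    have h := mul_le_mul (hle p.1 z.im) (hle p.2 z.im) (amp_pos _ _).le
      (mul_nonneg (hβ0 _) (Real.exp_pos _).le)
    have h2 := mul_le_mul_of_nonneg_right (mul_le_mul_of_nonneg_right h (norm_nonneg (u z)))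
      (amp_pos n z.im).le
    refine h2.trans_eq ?_
    rw [show 1 / 6 * z.im ^ 2 = 1 / 12 * z.im ^ 2 + 1 / 12 * z.im ^ 2 by ring, Real.exp_add]
    ring
  · simp only [tsum_mul_right]
    refine Integrable.const_mul ?_ _
    obtain ⟨B, hB⟩ := hu.2 (1 / 12) (by norm_num)
    have hi : Integrable (fun z : ℂ => ((Real.exp (1 / 6 * z.im ^ 2) * ‖u z‖ * amp n z.im : ℝ) : ℂ))
        stripMeasure := by
      have hm := hu.1.norm
      have ha : Continuous (amp n) := by unfold amp; fun_prop
      refine integrable_strip_of_le (g := fun y => B * (psiNorm * Real.exp ((stp * n) ^ 2)) *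
        Real.exp (-(1 / 4) * y ^ 2)) ?_
        ((integrable_exp_neg_mul_sq (by norm_num)).const_mul _) fun z => ?_
      · exact Complex.measurable_ofReal.comp ((Measurable.mul (by fun_prop) hm).mul
          (ha.measurable.comp Complex.measurable_im))
      · rw [Complex.norm_real, Real.norm_of_nonneg
          (mul_nonneg (mul_nonneg (Real.exp_pos _).le (norm_nonneg _)) (amp_pos _ _).le)]
        have h := mul_le_mul (mul_le_mul_of_nonneg_left (hB z)
          (Real.exp_pos (1 / 6 * z.im ^ 2)).le)
          (amp_le_gaussian n z.im) (amp_pos _ _).le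
          (mul_nonneg (Real.exp_pos _).le ((norm_nonneg _).trans (hB z)))
        refine h.trans_eq ?_
        rw [show -(1 / 4) * z.im ^ 2 = 1 / 6 * z.im ^ 2 + 1 / 12 * z.im ^ 2 +
          -(1 / 2) * z.im ^ 2 by ring, Real.exp_add, Real.exp_add]
        ring
    exact hi.re
  · have hp := (hs₁ z).mul (hs₂ z) (summable_mul_of_summable_norm
      (f := fun k => e₁ k z) (g := fun k => e₂ k z)
      (by simpa only [hn₁] using summable_amp z.im) (by simpa only [hn₂] using summable_amp z.im))
    exact (hp.mul_right _).mul_right _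

/-- The change of summation indices `(p, q) ↦ (n + p, n + p + q)`. -/
def resonanceEquiv (n : ℤ) : ℤ × ℤ ≃ ℤ × ℤ where
  toFun p := (n + p.1, n + p.1 + p.2)
  invFun p := (p.1 - n, p.2 - p.1)
  left_inv p := by ext <;> simp
  right_inv p := by ext <;> simp

lemma hasSum_coeff_normSq_mul {v : ℂ → ℂ} {c : ℤ → ℂ} (hv : Subgaussian v) (hc : HasModes v c)
    (n : ℤ) :
    HasSum (fun p : ℤ × ℤ => kern p * c (n + p.2))
      (coeff (fun z => Psi0 z * (starRingEnd ℂ) (Psi0 z) * v z) n) := by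
  have h := hasSum_integral_mul_mul (e₁ := psi) (e₂ := fun k z => (starRingEnd ℂ) (psi k z))
    subgaussian_psi (fun k => (subgaussian_psi k).conj) norm_psi
    (fun k z => by rw [RCLike.norm_conj, norm_psi]) hasSum_Psi0
    (fun z => Complex.hasSum_conj'.2 (by simpa using hasSum_Psi0 z)) hv n
  rw [← (resonanceEquiv n).hasSum_iff] at h
  refine Eq.mp (congrArg (fun φ => HasSum φ _) (funext fun p => ?_)) h
  exact integral_psi_conj_psi_mul hv hc n p.1 p.2

lemma hasSum_coeff_sq_mul_conj {v : ℂ → ℂ} {c : ℤ → ℂ} (hv : Subgaussian v) (hc : HasModes v c)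
    (n : ℤ) :
    HasSum (fun p : ℤ × ℤ => kern p * (starRingEnd ℂ) (c (n + p.1 + p.2)))
      (coeff (fun z => Psi0 z * Psi0 z * (starRingEnd ℂ) (v z)) n) := by
  have h := hasSum_integral_mul_mul (e₁ := psi) (e₂ := psi) subgaussian_psi subgaussian_psi
    norm_psi norm_psi hasSum_Psi0 hasSum_Psi0 hv.conj n
  rw [← ((Equiv.addLeft n).prodCongr (Equiv.addLeft n)).hasSum_iff] at h
  refine Eq.mp (congrArg (fun φ => HasSum φ _) (funext fun p => ?_)) h
  exact integral_psi_psi_mul_conj hv hc n p.1 p.2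

/-! ### The symbol of the interaction -/

lemma exp_natCast_eq_nome_pow (k : ℕ) : Real.exp (-stp ^ 2 * (k : ℝ) ^ 2) = nome ^ (k ^ 2) := by
  unfold nome
  rw [← Real.exp_nat_mul]
  congr 1
  push_cast
  ring

lemma summable_exp_stp : Summable fun q : ℤ => Real.exp (-stp ^ 2 * (q : ℝ) ^ 2) := by
  have := summable_exp_neg_mul_sq (c := stp ^ 2) (by have := stp_pos; positivity)
  exact this

/-- Folding an even two-sided theta series into a cosine series. -/
lemma hasSum_theta_series {χ : ℤ → ℝ} (hχ : ∀ k, χ (-k) = χ k) {ξ S : ℝ}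
    (hS : HasSum (fun k : ℕ => χ (k + 1) *
      (nome ^ ((k + 1) ^ 2) * Real.cos (2 * Real.pi * (k + 1 : ℕ) * ξ))) S)
    (hb : ∀ k, |χ k| ≤ 1) :
    HasSum (fun q : ℤ => (χ q * Real.exp (-stp ^ 2 * (q : ℝ) ^ 2) : ℝ) *
      Complex.exp (2 * Real.pi * Complex.I * q * ξ)) ((χ 0 + 2 * S : ℝ) : ℂ) := by
  set f : ℤ → ℂ := fun q => (χ q * Real.exp (-stp ^ 2 * (q : ℝ) ^ 2) : ℝ) *
      Complex.exp (2 * Real.pi * Complex.I * q * ξ) with hf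
  have hsum : Summable f := by
    refine summable_exp_stp.of_norm_bounded fun q => ?_
    rw [hf, norm_mul, norm_character, mul_one, Complex.norm_real, norm_mul,
      Real.norm_of_nonneg (Real.exp_pos _).le]
    exact mul_le_of_le_one_left (Real.exp_pos _).le (hb q)
  have h1 : HasSum (fun k : ℕ => f (k + 1)) (∑' k : ℕ, f (k + 1)) :=
    (hsum.comp_injective (i := fun k : ℕ => (k + 1 : ℤ)) (fun _ _ h => by simpa using h)).hasSum
  have h2 : HasSum (fun k : ℕ => f (-(k + 1))) (∑' k : ℕ, f (-(k + 1))) :=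
    (hsum.comp_injective (i := fun k : ℕ => (-(k + 1) : ℤ)) (fun _ _ h => by simpa using h)).hasSum
  have h3 : (∑' k : ℕ, f (k + 1)) + ∑' k : ℕ, f (-(k + 1)) = ((2 * S : ℝ) : ℂ) := by
    refine (h1.add h2).unique ?_
    have h4 := Complex.hasSum_ofReal.2 (hS.mul_left 2)
    refine Eq.mp (congrArg (fun φ => HasSum φ _) (funext fun k => ?_)) h4
    have hc : Complex.exp (2 * Real.pi * Complex.I * (k + 1 : ℤ) * ξ) +
        Complex.exp (2 * Real.pi * Complex.I * (-(k + 1) : ℤ) * ξ) =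
        2 * Real.cos (2 * Real.pi * (k + 1 : ℕ) * ξ) := by
      rw [Complex.ofReal_cos, Complex.two_cos]
      congr 2 <;> (push_cast; ring)
    have e1 : f (k + 1) = (χ (k + 1) * nome ^ ((k + 1) ^ 2) : ℝ) *
        Complex.exp (2 * Real.pi * Complex.I * (k + 1 : ℤ) * ξ) := by
      rw [← exp_natCast_eq_nome_pow (k + 1)]
      simp [hf]
    have e2 : f (-(k + 1)) = (χ (k + 1) * nome ^ ((k + 1) ^ 2) : ℝ) *
        Complex.exp (2 * Real.pi * Complex.I * (-(k + 1) : ℤ) * ξ) := by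
      rw [← exp_natCast_eq_nome_pow (k + 1), ← hχ (k + 1)]
      simp only [hf]
      push_cast
      rw [neg_sq]
    rw [e1, e2, ← mul_add, hc]
    push_cast
    ring
  have h5 := h1.of_add_one_of_neg_add_one h2
  convert h5 using 1
  rw [add_right_comm, h3, hf]
  simp
  ring

lemma hasSum_ell (ξ : ℝ) :
    HasSum (fun q : ℤ => (Real.exp (-stp ^ 2 * (q : ℝ) ^ 2) : ℂ) *
      Complex.exp (2 * Real.pi * Complex.I * q * ξ)) (ell ξ) := by
  have h := hasSum_theta_series (χ := fun _ => 1) (fun _ => rfl) (ξ := ξ)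
    (by simpa only [one_mul] using (summable_nome_pow_mul_cos (m := fun k => k + 1)
      (fun _ => le_rfl) (fun k => 2 * Real.pi * (k + 1 : ℕ) * ξ)).hasSum) (by simp)
  rw [← ell_eq] at h
  simpa only [one_mul] using h

/-- The indicator of the odd integers. -/
def oddInd (q : ℤ) : ℝ := if Odd q then 1 else 0

lemma hasSum_hodd (ξ : ℝ) :
    HasSum (fun q : ℤ => (oddInd q * Real.exp (-stp ^ 2 * (q : ℝ) ^ 2) : ℝ) *
      Complex.exp (2 * Real.pi * Complex.I * q * ξ)) (hodd ξ) := by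
  have hS : HasSum (fun k : ℕ => oddInd (k + 1) *
      (nome ^ ((k + 1) ^ 2) * Real.cos (2 * Real.pi * (k + 1 : ℕ) * ξ)))
      ((∑' k : ℕ, nome ^ ((2 * k + 1) ^ 2) *
        Real.cos (2 * Real.pi * (2 * k + 1 : ℕ) * ξ)) + 0) := by
    refine HasSum.even_add_odd ?_ ?_
    · refine Eq.mp (congrArg (fun φ => HasSum φ _) (funext fun k => ?_))
        (summable_nome_pow_mul_cos (m := fun k => 2 * k + 1)
          (fun _ => by omega) (fun k => 2 * Real.pi * (2 * k + 1 : ℕ) * ξ)).hasSum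
      have : Odd ((2 * k : ℕ) + 1 : ℤ) := ⟨k, by push_cast; ring⟩
      rw [oddInd, if_pos this, one_mul]
    · refine Eq.mp (congrArg (fun φ => HasSum φ _) (funext fun k => ?_)) hasSum_zero
      have : ¬ Odd ((2 * k + 1 : ℕ) + 1 : ℤ) := by
        rw [Int.not_odd_iff_even]; exact ⟨k + 1, by push_cast; ring⟩
      rw [oddInd, if_neg this, zero_mul]
  have h := hasSum_theta_series (χ := oddInd) (fun k => by simp [oddInd]) hS
    (fun k => by unfold oddInd; split_ifs <;> simp)
  have h0 : oddInd 0 = 0 := by simp [oddInd]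
  rwa [add_zero, h0, zero_add, ← hodd_eq] at h

/-- The sign `(-1)^{pq}` as a sum of two products, which makes the double series factor. -/
lemma cos_pi_int_mul_int (p q : ℤ) :
    Real.cos (Real.pi * p * q) = 1 - 2 * (oddInd p * oddInd q) := by
  have h : Real.cos (Real.pi * p * q) = (-1) ^ (p * q) := by
    rw [← Real.cos_int_mul_pi]; congr 1; push_cast; ring
  rw [h]
  unfold oddInd
  by_cases hp : Odd p <;> by_cases hq : Odd q
  · rw [(hp.mul hq).neg_one_zpow]; simp [hp, hq]; norm_num
  · rw [((Int.not_odd_iff_even.1 hq).mul_left p).neg_one_zpow]; simp [hq]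
  · rw [((Int.not_odd_iff_even.1 hp).mul_right q).neg_one_zpow]; simp [hp]
  · rw [((Int.not_odd_iff_even.1 hp).mul_right q).neg_one_zpow]; simp [hp]

lemma summable_kern : Summable fun p => ‖(kern p : ℂ)‖ := by
  have h := (summable_exp_stp.mul_of_nonneg summable_exp_stp (fun _ => (Real.exp_pos _).le)
    (fun _ => (Real.exp_pos _).le)).mul_left (1 / (gam * Real.sqrt Real.pi))
  have hg := gam_mul_sqrt_pi_pos
  refine Summable.of_nonneg_of_le (fun _ => norm_nonneg _) (fun p => ?_) h
  unfold kern
  rw [Complex.norm_real, Real.norm_eq_abs, abs_mul, abs_mul, abs_of_pos (one_div_pos.2 hg),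
    abs_of_pos (mul_pos (Real.exp_pos _) (Real.exp_pos _))]
  exact mul_le_mul_of_nonneg_left (mul_le_of_le_one_left
    (mul_pos (Real.exp_pos _) (Real.exp_pos _)).le (Real.abs_cos_le_one _)) (one_div_pos.2 hg).le

/-- The symbol of the interaction is a product of theta series: `(γ√π)⁻¹ (ℓ ℓ - 2 h h)`. -/
lemma hasSum_kern (η ξ : ℝ) :
    HasSum (fun p : ℤ × ℤ => (kern p : ℂ) *
      (Complex.exp (2 * Real.pi * Complex.I * p.1 * η) *
        Complex.exp (2 * Real.pi * Complex.I * p.2 * ξ)))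
      ((1 / (gam * Real.sqrt Real.pi) * (ell η * ell ξ - 2 * (hodd η * hodd ξ)) : ℝ) : ℂ) := by
  set E : ℝ → ℤ → ℂ := fun ξ q => (Real.exp (-stp ^ 2 * (q : ℝ) ^ 2) : ℂ) *
    Complex.exp (2 * Real.pi * Complex.I * q * ξ) with hE
  set O : ℝ → ℤ → ℂ := fun ξ q => (oddInd q * Real.exp (-stp ^ 2 * (q : ℝ) ^ 2) : ℝ) *
    Complex.exp (2 * Real.pi * Complex.I * q * ξ) with hO
  have hEs : ∀ ξ, HasSum (E ξ) (ell ξ) := hasSum_ell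
  have hOs : ∀ ξ, HasSum (O ξ) (hodd ξ) := hasSum_hodd
  have h1 := (hEs η).mul (hEs ξ) (summable_mul_of_summable_norm (f := E η) (g := E ξ)
    (hEs η).summable.norm (hEs ξ).summable.norm)
  have h2 := (hOs η).mul (hOs ξ) (summable_mul_of_summable_norm (f := O η) (g := O ξ)
    (hOs η).summable.norm (hOs ξ).summable.norm)
  have h3 := (h1.sub (h2.mul_left 2)).mul_left ((1 / (gam * Real.sqrt Real.pi) : ℝ) : ℂ)
  have hfun : ∀ p : ℤ × ℤ, (kern p : ℂ) * (Complex.exp (2 * Real.pi * Complex.I * p.1 * η) *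
      Complex.exp (2 * Real.pi * Complex.I * p.2 * ξ)) =
      ((1 / (gam * Real.sqrt Real.pi) : ℝ) : ℂ) *
        (E η p.1 * E ξ p.2 - 2 * (O η p.1 * O ξ p.2)) := fun p => by
    simp only [hE, hO]
    unfold kern
    rw [cos_pi_int_mul_int]
    push_cast
    ring
  rw [funext hfun, show ((1 / (gam * Real.sqrt Real.pi) *
    (ell η * ell ξ - 2 * (hodd η * hodd ξ)) : ℝ) : ℂ) =
    ((1 / (gam * Real.sqrt Real.pi) : ℝ) : ℂ) *
      ((ell η : ℂ) * ell ξ - 2 * ((hodd η : ℂ) * hodd ξ)) by push_cast; ring]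
  exact h3

/-! ### The Lagrange multiplier -/

/-- The lattice vector `n τ γ`. -/
def latticeVec (n : ℤ) : ℂ := n * tau * gam

lemma latticeVec_re (n : ℤ) : (latticeVec n).re = -(n * gam / 2) := by
  unfold latticeVec; rw [tau_eq]; simp; ring

lemma latticeVec_im (n : ℤ) : (latticeVec n).im = stp * n := by
  unfold latticeVec; rw [tau_eq, stp_eq]; simp; ring

/-- Translation by `n τ γ` moves `ψ_k` to `ψ_{k+n}` up to a phase independent of `k`. -/
lemma psi_add_latticeVec (k n : ℤ) (z : ℂ) :
    psi (k + n) z = Complex.exp (Complex.I * (stp * n * z.re + n * gam / 2 * z.im : ℝ)) *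
      psi k (z + latticeVec n) := by
  rw [psi_eq, psi_eq, Complex.add_re, Complex.add_im, latticeVec_re, latticeVec_im,
    mul_left_comm, ← Complex.exp_add]
  have h1 : amp (k + n) z.im = amp k (z.im + stp * n) := by
    unfold amp; push_cast; ring_nf
  have h2 : (phase (k + n) z.re z.im : ℝ) = (stp * n * z.re + n * gam / 2 * z.im) +
      phase k (z.re + -(n * gam / 2)) (z.im + stp * n) := by
    unfold phase
    push_cast
    linear_combination (n ^ 2 / 2 + k * n : ℝ) * gam_mul_stp
  rw [h1, h2]
  push_cast
  ring_nf

lemma Psi0_add_latticeVec (n : ℤ) (z : ℂ) :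
    Psi0 z = Complex.exp (Complex.I * (stp * n * z.re + n * gam / 2 * z.im : ℝ)) *
      Psi0 (z + latticeVec n) := by
  have h := (hasSum_Psi0 (z + latticeVec n)).mul_left
    (Complex.exp (Complex.I * (stp * n * z.re + n * gam / 2 * z.im : ℝ)))
  simp only [← psi_add_latticeVec] at h
  exact ((Equiv.addRight n).hasSum_iff.2 (hasSum_Psi0 z)).unique h

lemma exp_mul_conj_exp (r : ℝ) :
    Complex.exp (Complex.I * r) * (starRingEnd ℂ) (Complex.exp (Complex.I * r)) = 1 := by
  rw [← Complex.exp_conj, ← Complex.exp_add, map_mul, Complex.conj_I, Complex.conj_ofReal,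
    neg_mul, add_neg_cancel, Complex.exp_zero]

/-- The cell is a parallelogram, sheared to the left by `γ / 2` over its height. -/
lemma mem_cell_iff (z : ℂ) : z ∈ cell ↔ z.im ∈ Set.Icc 0 stp ∧
    z.re ∈ Set.Icc (-(gam / (2 * stp) * z.im)) (gam - gam / (2 * stp) * z.im) := by
  have hg := gam_pos
  have hs := stp_pos
  have hre : ∀ r₁ r₂ : ℝ, ((gam : ℂ) * (r₁ + r₂ * tau)).re = gam * r₁ - gam * r₂ / 2 :=
      fun r₁ r₂ => by
    rw [tau_eq]; simp; ring
  have him : ∀ r₁ r₂ : ℝ, ((gam : ℂ) * (r₁ + r₂ * tau)).im = stp * r₂ := fun r₁ r₂ => by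
    rw [tau_eq, stp_eq]; simp; ring
  constructor
  · rintro ⟨r₁, h₁, r₂, h₂, rfl⟩
    rw [hre, him]
    have e : gam / (2 * stp) * (stp * r₂) = gam * r₂ / 2 := by field_simp
    rw [e]
    refine ⟨⟨by have := h₂.1; positivity, by nlinarith [h₂.2]⟩, ?_, ?_⟩
    · have := mul_nonneg hg.le h₁.1; linarith
    · nlinarith [h₁.2]
  · rintro ⟨h₂, h₁⟩
    refine ⟨(z.re + gam / (2 * stp) * z.im) / gam, ⟨div_nonneg (by linarith [h₁.1]) hg.le,
      (div_le_one hg).2 (by linarith [h₁.2])⟩, z.im / stp, ⟨div_nonneg h₂.1 hs.le,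
      (div_le_one hs).2 h₂.2⟩, ?_⟩
    apply Complex.ext
    · rw [hre]; field_simp; ring
    · rw [him]; field_simp

lemma measurableSet_cell : MeasurableSet cell := by
  rw [show cell = {z | z.im ∈ Set.Icc 0 stp ∧
    z.re ∈ Set.Icc (-(gam / (2 * stp) * z.im)) (gam - gam / (2 * stp) * z.im)} from
    Set.ext mem_cell_iff]
  simp only [Set.mem_Icc]
  have h1 := Complex.measurable_re
  have h2 := Complex.measurable_im
  measurability

lemma volume_cell_lt_top : volume cell < ⊤ := by
  have hg := gam_pos
  have hs := stp_pos
  refine (measure_mono (fun z hz => ?_)).trans_lt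
    (measure_closedBall_lt_top (x := (0 : ℂ)) (r := 2 * gam + stp))
  obtain ⟨h2, h1⟩ := (mem_cell_iff z).1 hz
  rw [mem_closedBall_zero_iff]
  have h3 : gam / (2 * stp) * z.im ≤ gam := by
    rw [div_mul_eq_mul_div, div_le_iff₀ (by positivity)]
    nlinarith [h2.2, h2.1]
  have h4 : 0 ≤ gam / (2 * stp) * z.im := mul_nonneg (by positivity) h2.1
  refine (Complex.norm_le_abs_re_add_abs_im z).trans ?_
  have h5 : |z.re| ≤ 2 * gam := abs_le.2 ⟨by linarith [h1.1], by linarith [h1.2]⟩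
  have h6 : |z.im| ≤ stp := abs_le.2 ⟨by linarith [h2.1], h2.2⟩
  linarith

/-- On `γ`-periodic functions, integration over the cell is integration over a rectangle. -/
lemma integral_cell {F : ℂ → ℂ} (hp : Function.Periodic F gam) (hF : IntegrableOn F cell) :
    ∫ z in cell, F z = ∫ y in (0 : ℝ)..stp, ∫ x in period, F (x + y * Complex.I) := by
  have hg := gam_pos
  have hs := stp_pos
  have hmp := Complex.volume_preserving_equiv_real_prod.symm
  have hme := Complex.measurableEquivRealProd.symm.measurableEmbedding
  have hind : Integrable (cell.indicator F) := hF.integrable_indicator measurableSet_cell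
  rw [← integral_indicator measurableSet_cell, ← hmp.integral_comp hme]
  refine (integral_prod_symm (fun p : ℝ × ℝ =>
    cell.indicator F (Complex.measurableEquivRealProd.symm p))
    ((hmp.integrable_comp_emb hme).2 hind)).trans ?_
  rw [intervalIntegral.integral_of_le hs.le, ← integral_Icc_eq_integral_Ioc,
    ← integral_indicator measurableSet_Icc]
  refine integral_congr_ae (Eventually.of_forall fun y => ?_)
  have hval : ∀ x : ℝ,
      Complex.measurableEquivRealProd.symm (x, y) = x + y * Complex.I := fun x => by
    apply Complex.ext <;> simp [Complex.measurableEquivRealProd]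
  have hre : ∀ x : ℝ, ((x : ℂ) + y * Complex.I).re = x := fun x => by simp
  have him : ∀ x : ℝ, ((x : ℂ) + y * Complex.I).im = y := fun x => by simp
  simp only [hval]
  by_cases hy : y ∈ Set.Icc 0 stp
  · rw [Set.indicator_of_mem hy]
    have e : ∀ x : ℝ, cell.indicator F (x + y * Complex.I) =
        (Set.Icc (-(gam / (2 * stp) * y)) (gam - gam / (2 * stp) * y)).indicator
          (fun x : ℝ => F (x + y * Complex.I)) x := fun x => by
      by_cases hx : x ∈ Set.Icc (-(gam / (2 * stp) * y)) (gam - gam / (2 * stp) * y)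
      · rw [Set.indicator_of_mem hx, Set.indicator_of_mem ((mem_cell_iff _).2 (by
          rw [hre, him]; exact ⟨hy, hx⟩))]
      · rw [Set.indicator_of_notMem hx, Set.indicator_of_notMem fun h => hx (by
          have := ((mem_cell_iff _).1 h).2
          rwa [hre, him] at this)]
    simp only [e]
    have hper : Function.Periodic (fun x : ℝ => F (x + y * Complex.I)) gam := fun x =>
      (congrArg F (by push_cast; ring)).trans (hp _)
    rw [integral_indicator measurableSet_Icc, integral_Icc_eq_integral_Ioc,
      ← intervalIntegral.integral_of_le (by linarith), period, ← integral_Ioc_eq_integral_Ioo,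
      ← intervalIntegral.integral_of_le (by linarith)]
    have := hper.intervalIntegral_add_eq (-(gam / (2 * stp) * y)) (-gam / 2)
    convert this using 2 <;> ring
  · rw [Set.indicator_of_notMem hy]
    have e : ∀ x : ℝ, cell.indicator F (x + y * Complex.I) = 0 := fun x =>
      Set.indicator_of_notMem (fun h => hy (by
        have := ((mem_cell_iff _).1 h).1
        rwa [him] at this)) _
    simp [e]

lemma Subgaussian.integrableOn_cell {u : ℂ → ℂ} (hu : Subgaussian u) : IntegrableOn u cell := by
  obtain ⟨B, hB⟩ := hu.2 1 one_pos
  have : IsFiniteMeasure (volume.restrict cell) := ⟨by simpa using volume_cell_lt_top⟩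
  refine (integrable_const (|B| * Real.exp (stp ^ 2))).mono' hu.1.aestronglyMeasurable ?_
  filter_upwards [ae_restrict_mem measurableSet_cell] with z hz
  have hy := ((mem_cell_iff z).1 hz).1
  refine (hB z).trans (mul_le_mul (le_abs_self B) (Real.exp_le_exp.2 ?_) (Real.exp_pos _).le
    (abs_nonneg _))
  nlinarith [hy.1, hy.2]

/-- Unfolding the sum `Ψ₀ = ∑ ψ_n` turns the cell into the whole strip: over the cell, the term with
`ψ_n` is the integral of `u conj ψ₀` over the `n`-th row of the strip. -/
lemma integral_cell_mul_conj_Psi0 {u : ℂ → ℂ} (hu : Subgaussian u) (hper : magTrans gam u = u)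
    (hlat : ∀ (n : ℤ) z, u z = Complex.exp (Complex.I *
      (stp * n * z.re + n * gam / 2 * z.im : ℝ)) * u (z + latticeVec n)) :
    ∫ z in cell, u z * (starRingEnd ℂ) (Psi0 z) = coeff u 0 := by
  have hs := stp_pos
  have hper' : ∀ k, Function.Periodic (fun z => u z * (starRingEnd ℂ) (psi k z)) gam := by
    intro k z
    simp only
    rw [add_gam_of_magTrans_eq hper, add_gam_of_magTrans_eq (magTrans_psi k), map_mul]
    linear_combination (u z * (starRingEnd ℂ) (psi k z)) * exp_mul_conj_exp (gam * z.im)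
  set g : ℝ → ℂ := fun y => ∫ x in period, u (x + y * Complex.I) *
    (starRingEnd ℂ) (psi 0 (x + y * Complex.I)) with hg
  have hgi : Integrable g :=
    (integrable_strip_iff.1 (hu.integrable_mul_conj_psi 0)).integral_prod_right
  have hterm : ∀ n : ℤ, ∫ z in cell, u z * (starRingEnd ℂ) (psi n z) =
      stp * ∫ t in (0 : ℝ)..1, g (stp * (t + n)) := by
    intro n
    rw [integral_cell (hper' n) (hu.mul (subgaussian_psi n).conj).integrableOn_cell]
    have e : ∀ y : ℝ, ∫ x in period, u (x + y * Complex.I) *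
        (starRingEnd ℂ) (psi n (x + y * Complex.I)) = g (y + stp * n) := by
      intro y
      have e1 : ∀ z, u z * (starRingEnd ℂ) (psi n z) =
          u (z + latticeVec n) * (starRingEnd ℂ) (psi 0 (z + latticeVec n)) := fun z => by
        have h := psi_add_latticeVec 0 n z
        rw [zero_add] at h
        rw [h, map_mul]
        nth_rw 1 [hlat n z]
        linear_combination (u (z + latticeVec n) *
          (starRingEnd ℂ) (psi 0 (z + latticeVec n))) * exp_mul_conj_exp _
      have hq : Function.Periodic (fun x : ℝ => u (x + (y + stp * n : ℝ) * Complex.I) *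
          (starRingEnd ℂ) (psi 0 (x + (y + stp * n : ℝ) * Complex.I))) gam := fun x =>
        (congrArg (fun z => u z * (starRingEnd ℂ) (psi 0 z)) (by push_cast; ring)).trans
          (hper' 0 (x + (y + stp * n : ℝ) * Complex.I))
      have e2 : ∀ x : ℝ, u (x + y * Complex.I) * (starRingEnd ℂ) (psi n (x + y * Complex.I)) =
          (fun x : ℝ => u (x + (y + stp * n : ℝ) * Complex.I) *
          (starRingEnd ℂ) (psi 0 (x + (y + stp * n : ℝ) * Complex.I)))
            (x - n * gam / 2) := fun x => by
        rw [e1]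
        have : (x : ℂ) + y * Complex.I + latticeVec n =
            (x - n * gam / 2 : ℝ) + (y + stp * n : ℝ) * Complex.I := by
          apply Complex.ext
          · simp [latticeVec_re]; ring
          · simp [latticeVec_im]
        rw [this]
      have hgam := gam_pos
      simp only [e2]
      rw [hg, period, ← integral_Ioc_eq_integral_Ioo,
        ← intervalIntegral.integral_of_le (by linarith),
        intervalIntegral.integral_comp_sub_right (fun x : ℝ =>
          u (x + (y + stp * n : ℝ) * Complex.I) *
          (starRingEnd ℂ) (psi 0 (x + (y + stp * n : ℝ) * Complex.I)))]
      simp only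
      rw [← integral_Ioc_eq_integral_Ioo, ← intervalIntegral.integral_of_le (by linarith)]
      have := hq.intervalIntegral_add_eq (-gam / 2 - n * gam / 2) (-gam / 2)
      convert this using 2 <;> ring
    simp only [e]
    have := intervalIntegral.smul_integral_comp_mul_left (a := 0) (b := 1)
      (fun y => g (y + stp * n)) stp
    rw [mul_zero, mul_one] at this
    rw [← this, Complex.real_smul]
    simp only [mul_add]
  have h1 : HasSum (fun n : ℤ => ∫ z in cell, u z * (starRingEnd ℂ) (psi n z))
      (∫ z in cell, u z * (starRingEnd ℂ) (Psi0 z)) := by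
    have hδ : Summable fun k : ℤ =>
        psiNorm * Real.exp (-(1 / (1 + 1) * stp ^ 2) * (k : ℝ) ^ 2) :=
      (summable_exp_neg_mul_sq (by positivity)).mul_left _
    refine hasSum_integral_of_dominated_convergence
      (fun n z => psiNorm * Real.exp (-(1 / (1 + 1) * stp ^ 2) * (n : ℝ) ^ 2) *
        (Real.exp (stp ^ 2) * ‖u z‖))
      (fun n => (hu.mul (subgaussian_psi n).conj).1.aestronglyMeasurable) (fun n => ?_)
      (Eventually.of_forall fun z => hδ.mul_right _) ?_ (Eventually.of_forall fun z =>
        (Complex.hasSum_conj'.2 (by simpa using hasSum_Psi0 z)).mul_left _)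
    · filter_upwards [ae_restrict_mem measurableSet_cell] with z hz
      have hy := ((mem_cell_iff z).1 hz).1
      rw [norm_mul, RCLike.norm_conj, norm_psi, mul_comm, ← mul_assoc]
      refine mul_le_mul_of_nonneg_right ((amp_le one_pos n z.im).trans ?_) (norm_nonneg _)
      refine mul_le_mul_of_nonneg_left (Real.exp_le_exp.2 ?_)
        (mul_nonneg psiNorm_pos.le (Real.exp_pos _).le)
      nlinarith [hy.1, hy.2]
    · simp only [tsum_mul_right]
      exact (hu.integrableOn_cell.norm.const_mul _).const_mul _
  simp only [hterm] at h1
  have hgs : Integrable fun t => g (stp * t) := hgi.comp_mul_left' hs.ne'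
  have h2 := (hgs.hasSum_intervalIntegral_comp_add_int).mul_left (stp : ℂ)
  rw [h1.unique h2, Measure.integral_comp_mul_left g stp, coeff,
    integral_strip (hu.integrable_mul_conj_psi 0), abs_of_pos (inv_pos.2 hs), Complex.real_smul]
  have : (stp : ℂ) ≠ 0 := by exact_mod_cast hs.ne'
  push_cast
  rw [mul_inv_cancel_left₀ this]

/-- By unfolding, `∫_K |Ψ₀|² = ⟨Ψ₀, ψ₀⟩ = 1` and `∫_K |Ψ₀|⁴ = ⟨|Ψ₀|² Ψ₀, ψ₀⟩`; the latter is the sum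
of all interaction coefficients, that is, their symbol at frequency `0`. -/
lemma lam_eq : lam = 1 / (gam * Real.sqrt Real.pi) * (ell 0 ^ 2 - 2 * hodd 0 ^ 2) := by
  have hmod : ∀ z, ((‖Psi0 z‖ ^ 2 : ℝ) : ℂ) = Psi0 z * (starRingEnd ℂ) (Psi0 z) := fun z => by
    rw [Complex.mul_conj, Complex.normSq_eq_norm_sq]
  have h2 : ∫ z in cell, ‖Psi0 z‖ ^ 2 = 1 := by
    have h := integral_cell_mul_conj_Psi0 subgaussian_Psi0 magTrans_Psi0 Psi0_add_latticeVec
    rw [coeff_Psi0] at h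
    simp only [← hmod] at h
    rw [integral_complex_ofReal] at h
    exact_mod_cast h
  have h4 : ∫ z in cell, ‖Psi0 z‖ ^ 4 =
      1 / (gam * Real.sqrt Real.pi) * (ell 0 ^ 2 - 2 * hodd 0 ^ 2) := by
    have hsub := (subgaussian_Psi0.mul subgaussian_Psi0.conj).mul subgaussian_Psi0
    have h := integral_cell_mul_conj_Psi0 hsub (by
        funext z
        rw [magTrans_gam_apply, add_gam_of_magTrans_eq magTrans_Psi0, map_mul]
        have h1 := exp_mul_conj_exp (gam * z.im)
        have h2 : Complex.exp (-Complex.I * (gam * z.im : ℝ)) *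
            Complex.exp (Complex.I * (gam * z.im : ℝ)) = 1 := by
          rw [← Complex.exp_add, neg_mul, neg_add_cancel, Complex.exp_zero]
        linear_combination (Psi0 z * (starRingEnd ℂ) (Psi0 z) * Psi0 z) *
          (Complex.exp (-Complex.I * (gam * z.im : ℝ)) *
            Complex.exp (Complex.I * (gam * z.im : ℝ)) * h1 + h2))
      (fun n z => by
        rw [Psi0_add_latticeVec n z, map_mul]
        linear_combination (Complex.exp (Complex.I * (stp * n * z.re + n * gam / 2 * z.im : ℝ)) *
          Psi0 (z + latticeVec n) * (starRingEnd ℂ) (Psi0 (z + latticeVec n)) *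
          Psi0 (z + latticeVec n)) *
          exp_mul_conj_exp (stp * n * z.re + n * gam / 2 * z.im))
    have e : ∀ z, Psi0 z * (starRingEnd ℂ) (Psi0 z) * Psi0 z * (starRingEnd ℂ) (Psi0 z) =
        ((‖Psi0 z‖ ^ 4 : ℝ) : ℂ) := fun z => by
      rw [mul_assoc, ← hmod, ← Complex.ofReal_mul]; congr 1; ring
    simp only [e] at h
    rw [integral_complex_ofReal] at h
    have hk := hasSum_kern 0 0
    simp only [Complex.ofReal_zero, mul_zero, Complex.exp_zero, mul_one] at hk
    have hc := hasSum_coeff_normSq_mul subgaussian_Psi0 hasModes_Psi0 0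
    simp only [mul_one] at hc
    rw [hc.unique hk] at h
    rw [Complex.ofReal_inj.1 h]
    ring
  have hc : ‖cnorm‖ ≠ 0 := by
    rw [norm_ne_zero_iff]
    exact mul_ne_zero (Complex.exp_ne_zero _) (Complex.ofReal_ne_zero.2 psiNorm_pos.ne')
  unfold Psi0 at h2 h4
  simp only [norm_mul, mul_pow] at h2 h4
  rw [integral_const_mul] at h2 h4
  unfold lam lambda0
  rw [← h4]
  -- the normalization shows that the denominator of `λ` does not vanish
  have hne : ∫ z in cell, ‖Phi0 z‖ ^ 2 ≠ 0 := fun h => by simp [h] at h2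
  rw [div_mul_eq_mul_div, div_eq_iff hne]
  linear_combination (-(‖cnorm‖ ^ 2 * ∫ z in cell, ‖Phi0 z‖ ^ 4)) * h2

/-! ### The linearized equation in Fourier variables -/

/-- The interaction term `2|Ψ₀|² v + Ψ₀² conj v` of the linearized equation, before projection. -/
def interaction (v : ℂ → ℂ) (y : ℂ) : ℂ :=
  2 * (‖Psi0 y‖ : ℂ) ^ 2 * v y + Psi0 y ^ 2 * (starRingEnd ℂ) (v y)

lemma interaction_eq (v : ℂ → ℂ) : interaction v = fun y =>
    2 * (Psi0 y * (starRingEnd ℂ) (Psi0 y) * v y) + Psi0 y * Psi0 y * (starRingEnd ℂ) (v y) := by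
  funext y
  rw [interaction, Complex.mul_conj, Complex.normSq_eq_norm_sq]
  push_cast
  ring

lemma Subgaussian.interaction {v : ℂ → ℂ} (hv : Subgaussian v) : Subgaussian (interaction v) := by
  rw [interaction_eq]
  exact (((subgaussian_Psi0.mul subgaussian_Psi0.conj).mul hv).const_mul 2).add
    ((subgaussian_Psi0.mul subgaussian_Psi0).mul hv.conj)

lemma magTrans_interaction {v : ℂ → ℂ} (hv : magTrans gam v = v) :
    magTrans gam (interaction v) = interaction v := by
  rw [interaction_eq]
  funext z
  rw [magTrans_gam_apply, add_gam_of_magTrans_eq magTrans_Psi0, add_gam_of_magTrans_eq hv,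
    map_mul, map_mul]
  have h1 := exp_mul_conj_exp (gam * z.im)
  have h2 : Complex.exp (-Complex.I * (gam * z.im : ℝ)) *
      Complex.exp (Complex.I * (gam * z.im : ℝ)) = 1 := by
    rw [← Complex.exp_add, neg_mul, neg_add_cancel, Complex.exp_zero]
  set e := Complex.exp (Complex.I * (gam * z.im : ℝ))
  linear_combination (2 * (Psi0 z * (starRingEnd ℂ) (Psi0 z) * v z) +
    Psi0 z * Psi0 z * (starRingEnd ℂ) (v z)) *
    (Complex.exp (-Complex.I * (gam * z.im : ℝ)) * e * h1 + h2)

lemma coeff_interaction {v : ℂ → ℂ} (hv : Subgaussian v) (n : ℤ) :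
    coeff (interaction v) n =
      2 * coeff (fun z => Psi0 z * (starRingEnd ℂ) (Psi0 z) * v z) n +
        coeff (fun z => Psi0 z * Psi0 z * (starRingEnd ℂ) (v z)) n := by
  unfold coeff
  rw [interaction_eq, ← integral_const_mul, ← integral_add]
  · refine integral_congr_ae (Eventually.of_forall fun z => ?_)
    simp only; ring
  · exact (((subgaussian_Psi0.mul subgaussian_Psi0.conj).mul hv).integrable_mul_conj_psi
      n).const_mul 2
  · exact ((subgaussian_Psi0.mul subgaussian_Psi0).mul hv.conj).integrable_mul_conj_psi n

/-- The right-hand side `-i (a f + b g)` of the equation for `f`, with `g` the reflection of `f`. -/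
def fourierRHS (f : ℝ → ℂ) (ξ : ℝ) : ℂ := -Complex.I * (a ξ * f ξ + b ξ * reflect f ξ)

lemma abs_symbol_le (ξ : ℝ) : |a ξ| ≤ 7 / (gam * Real.sqrt Real.pi) ∧
    |b ξ| ≤ 7 / (gam * Real.sqrt Real.pi) := by
  have h1 := a_sub_b_le ξ
  have h2 := a_add_b_le ξ
  have h3 := a_sub_b_nonneg ξ
  have h4 := a_add_b_pos ξ
  exact ⟨abs_le.2 ⟨by linarith, by linarith⟩, abs_le.2 ⟨by linarith, by linarith⟩⟩

lemma memLp_bdd_mul {W : ℝ → ℝ} (hW : Continuous W) {c : ℝ} (hc : ∀ ξ, |W ξ| ≤ c) {F : ℝ → ℂ}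
    {μ : Measure ℝ} (hF : MemLp F 2 μ) : MemLp (fun ξ => (W ξ : ℂ) * F ξ) 2 μ := by
  refine MemLp.of_le_mul (c := c) hF ?_ (Eventually.of_forall fun ξ => ?_)
  · exact (Complex.continuous_ofReal.comp hW).aestronglyMeasurable.mul hF.1
  · rw [norm_mul, Complex.norm_real]
    exact mul_le_mul_of_nonneg_right (hc ξ) (norm_nonneg _)

lemma memLp_fourierRHS {f : ℝ → ℂ} (hp : Function.Periodic f 1)
    (hf : MemLp f 2 (volume.restrict (Set.Icc 0 1))) :
    MemLp (fourierRHS f) 2 (volume.restrict (Set.Icc 0 1)) :=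
  ((memLp_bdd_mul continuous_a (fun ξ => (abs_symbol_le ξ).1) hf).add
    (memLp_bdd_mul continuous_b (fun ξ => (abs_symbol_le ξ).2) (memLp_reflect hp hf))).const_mul _

lemma periodic_reflect {f : ℝ → ℂ} (hp : Function.Periodic f 1) :
    Function.Periodic (reflect f) 1 := by
  intro ξ
  unfold reflect
  rw [neg_add, ← hp (-ξ + -1), neg_add_cancel_right]

lemma periodic_fourierRHS {f : ℝ → ℂ} (hp : Function.Periodic f 1) :
    Function.Periodic (fourierRHS f) 1 := by
  intro ξ
  unfold fourierRHS
  rw [a_periodic, b_periodic, hp, periodic_reflect hp]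

/-- The interaction and the multiplier `λ` act on Fourier series through the symbols `a`, `b`. -/
lemma fcoef_fourierRHS {v : ℂ → ℂ} {f : ℝ → ℂ} (hv : MemPeriodicFock v)
    (hf : IsFourierSum (coeff v) f) (n : ℤ) :
    fcoef (fourierRHS f) n = -Complex.I * (coeff (interaction v) n - lam * coeff v n) := by
  have hint : Integrable f (volume.restrict (Set.Icc 0 1)) := hf.memLp.integrable one_le_two
  have hintg : Integrable (reflect f) (volume.restrict (Set.Icc 0 1)) :=
    (memLp_reflect hf.periodic hf.memLp).integrable one_le_two
  set A : ℝ → ℂ := fun ξ => ((1 / (gam * Real.sqrt Real.pi) *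
    (ell 0 * ell ξ - 2 * (hodd 0 * hodd ξ)) : ℝ) : ℂ) with hA
  have h1 : fcoef (fun ξ => A ξ * f ξ) n =
      coeff (fun z => Psi0 z * (starRingEnd ℂ) (Psi0 z) * v z) n := by
    refine (hasSum_fcoef_mul (k := fun p : ℤ × ℤ => p.2) summable_kern (fun ξ => ?_)
      hint n).unique ?_
    · have h := hasSum_kern 0 ξ
      simp only [Complex.ofReal_zero, mul_zero, Complex.exp_zero, one_mul] at h
      exact h
    · simp only [hf.fcoef_eq]
      exact hasSum_coeff_normSq_mul hv.subgaussian hv.hasModes n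
  have h2 : fcoef (fun ξ => (b ξ : ℂ) * reflect f ξ) n =
      coeff (fun z => Psi0 z * Psi0 z * (starRingEnd ℂ) (v z)) n := by
    refine (hasSum_fcoef_mul (k := fun p : ℤ × ℤ => p.1 + p.2) summable_kern (fun ξ => ?_)
      hintg n).unique ?_
    · have h := hasSum_kern ξ ξ
      simp only [← Complex.exp_add] at h
      have hb : b ξ = 1 / (gam * Real.sqrt Real.pi) *
          (ell ξ * ell ξ - 2 * (hodd ξ * hodd ξ)) := by unfold b; ring
      rw [hb]
      refine Eq.mp (congrArg (fun φ => HasSum φ _) (funext fun p => ?_)) h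
      congr 2
      push_cast
      ring
    · simp only [fcoef_reflect hf.periodic, hf.fcoef_eq, ← add_assoc]
      exact hasSum_coeff_sq_mul_conj hv.subgaussian hv.hasModes n
  have e : fourierRHS f = fun ξ => -Complex.I * ((2 * (A ξ * f ξ) +
      (b ξ : ℂ) * reflect f ξ) - lam * f ξ) := by
    funext ξ
    have ha : a ξ = 2 * (1 / (gam * Real.sqrt Real.pi) *
        (ell 0 * ell ξ - 2 * (hodd 0 * hodd ξ))) - lam := by rw [lam_eq]; unfold a; ring
    unfold fourierRHS
    rw [ha, hA]
    push_cast
    ring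
  have hAf : Integrable (fun ξ => A ξ * f ξ) (volume.restrict (Set.Icc 0 1)) := by
    have hc : Continuous fun ξ => 1 / (gam * Real.sqrt Real.pi) *
        (ell 0 * ell ξ - 2 * (hodd 0 * hodd ξ)) := by
      have := continuous_ell
      have := continuous_hodd
      fun_prop
    have hAc : Continuous A := Complex.continuous_ofReal.comp hc
    obtain ⟨C, hC⟩ := isCompact_Icc.exists_bound_of_continuousOn
      (s := Set.Icc (0 : ℝ) 1) hAc.continuousOn
    refine hint.bdd_mul (c := C) hAc.aestronglyMeasurable ?_
    filter_upwards [ae_restrict_mem measurableSet_Icc] with ξ hξ using hC ξ hξ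
  have hbg : Integrable (fun ξ => (b ξ : ℂ) * reflect f ξ) (volume.restrict (Set.Icc 0 1)) :=
    (memLp_bdd_mul continuous_b (fun ξ => (abs_symbol_le ξ).2)
      (memLp_reflect hf.periodic hf.memLp)).integrable one_le_two
  have hsum : Integrable (fun ξ => 2 * (A ξ * f ξ) + (b ξ : ℂ) * reflect f ξ)
      (volume.restrict (Set.Icc 0 1)) := (hAf.const_mul 2).add hbg
  rw [e, fcoef_const_mul, fcoef_sub hsum (hint.const_mul _),
    fcoef_add (hAf.const_mul 2) hbg, fcoef_const_mul, fcoef_const_mul, h1, h2, hf.fcoef_eq,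
    coeff_interaction hv.subgaussian]

/-- The curve `s ↦ f s` in `L²([0,1])`, `s ≥ 0`, has derivative `F` at `t`. -/
def HasL2Deriv (f : ℝ → ℝ → ℂ) (F : ℝ → ℂ) (t : ℝ) : Prop :=
  Tendsto (fun s : ℝ => normL2 (fun ξ => (f s ξ - f t ξ) / ((s - t : ℝ) : ℂ) - F ξ))
    (𝓝[Set.Ici 0 \ {t}] t) (𝓝 0)

/-- The Fourier transform of a solution is differentiable in `L²([0,1])` and solves the diagonal
system: Parseval on `[0,1]` and Bessel on the strip carry the difference quotients over. -/
lemma IsSolution.hasL2Deriv {v : ℝ → ℂ → ℂ} {f : ℝ → ℝ → ℂ} (hv : IsSolution v)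
    (hf : ∀ t : ℝ, 0 ≤ t → IsFourierSum (coeff (v t)) (f t)) {t : ℝ} (ht : 0 ≤ t) :
    HasL2Deriv f (fourierRHS (f t)) t := by
  obtain ⟨w, hw, heq⟩ := hv.eqn t ht
  have hvt := hv.mem t ht
  have hsub := hvt.subgaussian
  have hw_eq : w = fun z => -Complex.I * (proj (interaction (v t)) z - lam * v t z) := by
    funext z
    have h := heq z
    have h2 : proj (interaction (v t)) z = Complex.I * w z + lam * v t z := h.symm
    rw [h2]
    linear_combination w z * Complex.I_sq
  have hproj := coeff_proj hsub.interaction (magTrans_interaction hvt.2)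
  have hw_int : ∀ n, Integrable (fun z => w z * (starRingEnd ℂ) (psi n z)) stripMeasure :=
      fun n => by
    have h := (((hproj n).1.sub ((hsub.integrable_mul_conj_psi n).const_mul
      (lam : ℂ))).const_mul (-Complex.I))
    refine h.congr (Eventually.of_forall fun z => ?_)
    rw [hw_eq]
    simp only [Pi.sub_apply]
    ring
  have hw_coeff : ∀ n, coeff w n = fcoef (fourierRHS (f t)) n := fun n => by
    rw [fcoef_fourierRHS hvt (hf t ht), ← (hproj n).2]
    unfold coeff
    rw [← integral_const_mul, ← integral_sub (hproj n).1
      ((hsub.integrable_mul_conj_psi n).const_mul _), ← integral_const_mul]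
    refine integral_congr_ae (Eventually.of_forall fun z => ?_)
    rw [hw_eq]
    simp only
    ring
  have hw_meas : Measurable w := by
    rw [hw_eq]
    exact ((measurable_proj hsub.interaction.1).sub (hsub.1.const_mul _)).const_mul _
  unfold HasL2Deriv
  refine tendsto_of_tendsto_of_tendsto_of_le_of_le' tendsto_const_nhds hw
    (Eventually.of_forall fun _ => zero_le) ?_
  have hfin := hw.eventually (gt_mem_nhds ENNReal.zero_lt_top)
  filter_upwards [hfin, self_mem_nhdsWithin] with s hs hmem
  have hs0 : 0 ≤ s := hmem.1
  have hvs := (hv.mem s hs0).subgaussian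
  set D : ℂ → ℂ := fun z => (v s z - v t z) / ((s - t : ℝ) : ℂ) - w z with hD
  have hDLp : MemLp D 2 stripMeasure :=
    ⟨(((hvs.1.sub hsub.1).div_const _).sub hw_meas).aestronglyMeasurable, hs⟩
  have hfs := hf s hs0
  have hft := hf t ht
  have his := hfs.memLp.integrable one_le_two
  have hit := hft.memLp.integrable one_le_two
  have hR := memLp_fourierRHS hft.periodic hft.memLp
  have hdiff : ∀ n, fcoef (fun ξ => (f s ξ - f t ξ) / ((s - t : ℝ) : ℂ) -
      fourierRHS (f t) ξ) n = coeff D n := by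
    intro n
    simp only [div_eq_inv_mul]
    have hq : Integrable (fun ξ => ((s - t : ℝ) : ℂ)⁻¹ * (f s ξ - f t ξ))
        (volume.restrict (Set.Icc 0 1)) := (his.sub hit).const_mul _
    have hqv : Integrable (fun z => ((s - t : ℝ) : ℂ)⁻¹ *
        (v s z * (starRingEnd ℂ) (psi n z) - v t z * (starRingEnd ℂ) (psi n z))) stripMeasure :=
      ((hvs.integrable_mul_conj_psi n).sub (hsub.integrable_mul_conj_psi n)).const_mul _
    rw [fcoef_sub hq (hR.integrable one_le_two), fcoef_const_mul,
      fcoef_sub his hit, hfs.fcoef_eq, hft.fcoef_eq, ← hw_coeff]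
    unfold coeff
    rw [← integral_sub (hvs.integrable_mul_conj_psi n) (hsub.integrable_mul_conj_psi n),
      ← integral_const_mul, ← integral_sub hqv (hw_int n)]
    refine integral_congr_ae (Eventually.of_forall fun z => ?_)
    simp only [hD]
    ring
  have hmem2 : MemLp (fun ξ => (f s ξ - f t ξ) / ((s - t : ℝ) : ℂ) - fourierRHS (f t) ξ) 2
      (volume.restrict (Set.Icc 0 1)) := by
    simp only [div_eq_inv_mul]
    exact ((hfs.memLp.sub hft.memLp).const_mul _).sub hR
  have := normL2_le_of_sum_sq_le hmem2 (B := (eLpNorm D 2 stripMeasure).toReal)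
    ENNReal.toReal_nonneg fun S => by
      simp only [hdiff]
      exact sum_sq_coeff_le hDLp S
  rwa [ENNReal.ofReal_toReal hs.ne] at this

/-! ### Conservation of the energy density -/

lemma HasL2Deriv.add {f g : ℝ → ℝ → ℂ} {F G : ℝ → ℂ} {t : ℝ} (ht : 0 ≤ t)
    (hf : ∀ s, 0 ≤ s → MemLp (f s) 2 (volume.restrict (Set.Icc 0 1)))
    (hg : ∀ s, 0 ≤ s → MemLp (g s) 2 (volume.restrict (Set.Icc 0 1)))
    (hF : MemLp F 2 (volume.restrict (Set.Icc 0 1)))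
    (hG : MemLp G 2 (volume.restrict (Set.Icc 0 1)))
    (h1 : HasL2Deriv f F t) (h2 : HasL2Deriv g G t) :
    HasL2Deriv (fun s ξ => f s ξ + g s ξ) (fun ξ => F ξ + G ξ) t := by
  have h := Tendsto.add h1 h2
  rw [add_zero] at h
  refine tendsto_of_tendsto_of_tendsto_of_le_of_le' tendsto_const_nhds h
    (Eventually.of_forall fun _ => zero_le) ?_
  filter_upwards [self_mem_nhdsWithin] with s hs
  have hq : ∀ {f : ℝ → ℝ → ℂ} {F : ℝ → ℂ},
      (∀ s, 0 ≤ s → MemLp (f s) 2 (volume.restrict (Set.Icc 0 1))) →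
      MemLp F 2 (volume.restrict (Set.Icc 0 1)) → AEStronglyMeasurable
        (fun ξ => (f s ξ - f t ξ) / ((s - t : ℝ) : ℂ) - F ξ) (volume.restrict (Set.Icc 0 1)) := by
    intro f F hf hF
    simp only [div_eq_inv_mul]
    exact (((hf s hs.1).1.sub (hf t ht).1).const_mul _).sub hF.1
  refine le_trans (le_of_eq ?_) (eLpNorm_add_le (hq hf hF) (hq hg hG) one_le_two)
  unfold normL2
  congr 1
  funext ξ
  simp only [Pi.add_apply]
  ring

lemma HasL2Deriv.neg {f : ℝ → ℝ → ℂ} {F : ℝ → ℂ} {t : ℝ} (h : HasL2Deriv f F t) :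
    HasL2Deriv (fun s ξ => -f s ξ) (fun ξ => -F ξ) t := by
  unfold HasL2Deriv at h ⊢
  refine h.congr fun s => ?_
  refine eLpNorm_congr_norm_ae (Eventually.of_forall fun ξ => ?_)
  simp only
  rw [← norm_neg]
  congr 1
  ring

lemma HasL2Deriv.reflect {f : ℝ → ℝ → ℂ} {F : ℝ → ℂ} {t : ℝ} (ht : 0 ≤ t)
    (hp : ∀ s, 0 ≤ s → Function.Periodic (f s) 1) (hpF : Function.Periodic F 1)
    (hf : ∀ s, 0 ≤ s → MemLp (f s) 2 (volume.restrict (Set.Icc 0 1)))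
    (hF : MemLp F 2 (volume.restrict (Set.Icc 0 1))) (h : HasL2Deriv f F t) :
    HasL2Deriv (fun s => reflect (f s)) (reflect F) t := by
  unfold HasL2Deriv at h ⊢
  refine h.congr' ?_
  filter_upwards [self_mem_nhdsWithin] with s hs
  rw [← normL2_reflect (f := fun ξ => (f s ξ - f t ξ) / ((s - t : ℝ) : ℂ) - F ξ)]
  · congr 1
    funext ξ
    simp [Abrikosov.reflect]
  · intro ξ
    simp only [hp s hs.1 ξ, hp t ht ξ, hpF ξ]
  · simp only [div_eq_inv_mul]
    exact (((hf s hs.1).1.sub (hf t ht).1).const_mul _).sub hF.1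

/-- Differentiation of a squared weighted `L²` norm along a curve that is differentiable in `L²`.
The weight is written as a square so that it can be moved onto the curve. -/
lemma HasL2Deriv.hasDerivWithinAt_integral {φ : ℝ → ℝ → ℂ} {Φ : ℝ → ℂ} {t : ℝ} (ht : 0 ≤ t)
    (hφ : ∀ s, 0 ≤ s → MemLp (φ s) 2 (volume.restrict (Set.Icc 0 1)))
    (hΦ : MemLp Φ 2 (volume.restrict (Set.Icc 0 1))) (h : HasL2Deriv φ Φ t)
    {W : ℝ → ℝ} (hW : Continuous W) {c : ℝ} (hc : ∀ ξ, |W ξ| ≤ c) (S : Set ℝ) :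
    HasDerivWithinAt
      (fun s => ∫ ξ in S, W ξ ^ 2 * ‖φ s ξ‖ ^ 2 ∂(volume.restrict (Set.Icc 0 1)))
      (2 * ∫ ξ in S, W ξ ^ 2 * ((starRingEnd ℂ) (φ t ξ) * Φ ξ).re ∂(volume.restrict (Set.Icc 0 1)))
      (Set.Ici 0) t := by
  classical
  set μ : Measure ℝ := (volume.restrict (Set.Icc 0 1)).restrict S with hμ
  have hmem : ∀ {G : ℝ → ℂ}, MemLp G 2 (volume.restrict (Set.Icc 0 1)) →
      MemLp (fun ξ => (W ξ : ℂ) * G ξ) 2 μ := fun hG => memLp_bdd_mul hW hc (hG.restrict S)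
  -- the curve in the Hilbert space `L²(μ)`, whose value at negative times is immaterial
  set γ : ℝ → Lp ℂ 2 μ := fun s =>
    if hs : 0 ≤ s then (hmem (hφ s hs)).toLp (fun ξ => (W ξ : ℂ) * φ s ξ) else 0 with hγ
  have hγs : ∀ s (hs : 0 ≤ s), γ s = (hmem (hφ s hs)).toLp (fun ξ => (W ξ : ℂ) * φ s ξ) :=
    fun s hs => by rw [hγ]; simp only [hs, dif_pos]
  have hderiv : HasDerivWithinAt γ ((hmem hΦ).toLp (fun ξ => (W ξ : ℂ) * Φ ξ)) (Set.Ici 0) t := by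
    rw [hasDerivWithinAt_iff_tendsto_slope, tendsto_iff_norm_sub_tendsto_zero]
    have hlim : Tendsto (fun s : ℝ => (ENNReal.ofReal c *
        normL2 (fun ξ => (φ s ξ - φ t ξ) / ((s - t : ℝ) : ℂ) - Φ ξ)).toReal)
        (𝓝[Set.Ici 0 \ {t}] t) (𝓝 0) := by
      have := ENNReal.Tendsto.const_mul (a := ENNReal.ofReal c) h (Or.inr ENNReal.ofReal_ne_top)
      rw [mul_zero] at this
      exact (ENNReal.tendsto_toReal ENNReal.zero_ne_top).comp this
    refine squeeze_zero' (Eventually.of_forall fun _ => norm_nonneg _) ?_ hlim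
    filter_upwards [self_mem_nhdsWithin] with s hs
    have hL : MemLp (fun ξ => (φ s ξ - φ t ξ) / ((s - t : ℝ) : ℂ) - Φ ξ) 2
        (volume.restrict (Set.Icc 0 1)) := by
      simp only [div_eq_inv_mul]
      exact (((hφ s hs.1).sub (hφ t ht)).const_mul _).sub hΦ
    have e : slope γ t s - (hmem hΦ).toLp (fun ξ => (W ξ : ℂ) * Φ ξ) =
        (hmem hL).toLp (fun ξ => (W ξ : ℂ) * ((φ s ξ - φ t ξ) / ((s - t : ℝ) : ℂ) - Φ ξ)) := by
      rw [slope_def_module, hγs s hs.1, hγs t ht, ← MemLp.toLp_sub, ← MemLp.toLp_const_smul,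
        ← MemLp.toLp_sub]
      refine MemLp.toLp_congr _ _ (Eventually.of_forall fun ξ => ?_)
      simp only [Pi.sub_apply, Pi.smul_apply, Complex.real_smul, Complex.ofReal_inv]
      ring
    rw [e, Lp.norm_toLp]
    refine ENNReal.toReal_mono (ENNReal.mul_ne_top ENNReal.ofReal_ne_top hL.2.ne) ?_
    refine (eLpNorm_mono_measure _ Measure.restrict_le_self).trans
      (eLpNorm_le_mul_eLpNorm_of_ae_le_mul (Eventually.of_forall fun ξ => ?_) 2)
    rw [norm_mul, Complex.norm_real]
    exact mul_le_mul_of_nonneg_right (hc ξ) (norm_nonneg _)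
  have hnorm : ∀ s, 0 ≤ s → ‖γ s‖ ^ 2 = ∫ ξ, W ξ ^ 2 * ‖φ s ξ‖ ^ 2 ∂μ := by
    intro s hs
    rw [hγs s hs, ← real_inner_self_eq_norm_sq, L2.inner_def]
    refine integral_congr_ae ?_
    filter_upwards [(hmem (hφ s hs)).coeFn_toLp] with ξ hξ
    rw [hξ, real_inner_self_eq_norm_sq, norm_mul, Complex.norm_real, mul_pow, Real.norm_eq_abs,
      sq_abs]
  have hinner : inner ℝ (γ t) ((hmem hΦ).toLp (fun ξ => (W ξ : ℂ) * Φ ξ)) =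
      ∫ ξ, W ξ ^ 2 * ((starRingEnd ℂ) (φ t ξ) * Φ ξ).re ∂μ := by
    rw [hγs t ht, L2.inner_def]
    refine integral_congr_ae ?_
    filter_upwards [(hmem (hφ t ht)).coeFn_toLp, (hmem hΦ).coeFn_toLp] with ξ h1 h2
    rw [h1, h2, Complex.inner, map_mul, Complex.conj_ofReal, mul_mul_mul_comm, ← Complex.ofReal_mul,
      Complex.re_ofReal_mul, sq, mul_comm (Φ ξ)]
  have := hderiv.norm_sq
  rw [hinner] at this
  exact this.congr (fun s hs => (hnorm s hs).symm) (hnorm t ht).symm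

lemma memLp_two_integrable_weight {φ : ℝ → ℂ} {μ : Measure ℝ} (hφ : MemLp φ 2 μ) {W : ℝ → ℝ}
    (hW : Continuous W) {c : ℝ} (hc : ∀ ξ, |W ξ| ≤ c) :
    Integrable (fun ξ => W ξ ^ 2 * ‖φ ξ‖ ^ 2) μ := by
  have h := (memLp_bdd_mul hW hc hφ).integrable_norm_pow two_ne_zero
  refine h.congr (Eventually.of_forall fun ξ => ?_)
  simp only [norm_mul, Complex.norm_real, mul_pow, Real.norm_eq_abs, sq_abs]

/-- For the system `i ∂_t p = (a - b) m`, `i ∂_t m = (a + b) p` the density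
`(a + b)|p|² + (a - b)|m|²` is constant in time at almost every frequency. A curve in `L²` has no
pointwise time derivative, so conservation is proved for the integral over each measurable set. -/
lemma energy_ae_eq {p m : ℝ → ℝ → ℂ}
    (hp : ∀ s, 0 ≤ s → MemLp (p s) 2 (volume.restrict (Set.Icc 0 1)))
    (hm : ∀ s, 0 ≤ s → MemLp (m s) 2 (volume.restrict (Set.Icc 0 1)))
    (hp' : ∀ s, 0 ≤ s → HasL2Deriv p (fun ξ => -Complex.I * ((a ξ - b ξ : ℝ) * m s ξ)) s)
    (hm' : ∀ s, 0 ≤ s → HasL2Deriv m (fun ξ => -Complex.I * ((a ξ + b ξ : ℝ) * p s ξ)) s)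
    {t : ℝ} (ht : 0 ≤ t) :
    ∀ᵐ ξ ∂(volume.restrict (Set.Icc (0 : ℝ) 1)),
      (a ξ + b ξ) * ‖p t ξ‖ ^ 2 + (a ξ - b ξ) * ‖m t ξ‖ ^ 2 =
        (a ξ + b ξ) * ‖p 0 ξ‖ ^ 2 + (a ξ - b ξ) * ‖m 0 ξ‖ ^ 2 := by
  set K := 7 / (gam * Real.sqrt Real.pi) with hK
  have hS : Continuous fun ξ => a ξ + b ξ := continuous_a.add continuous_b
  have hD : Continuous fun ξ => a ξ - b ξ := continuous_a.sub continuous_b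
  have hSb : ∀ ξ, |a ξ + b ξ| ≤ K := fun ξ => by
    rw [abs_of_pos (a_add_b_pos ξ)]; exact a_add_b_le ξ
  have hDb : ∀ ξ, |a ξ - b ξ| ≤ K := fun ξ => by
    rw [abs_of_nonneg (a_sub_b_nonneg ξ)]; exact a_sub_b_le ξ
  have hS1 : ∀ ξ, Real.sqrt (a ξ + b ξ) ^ 2 = a ξ + b ξ := fun ξ =>
    Real.sq_sqrt (a_add_b_pos ξ).le
  have hD1 : ∀ ξ, Real.sqrt (a ξ - b ξ) ^ 2 = a ξ - b ξ := fun ξ =>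
    Real.sq_sqrt (a_sub_b_nonneg ξ)
  have hSc : ∀ ξ, |Real.sqrt (a ξ + b ξ)| ≤ Real.sqrt K := fun ξ => by
    rw [abs_of_nonneg (Real.sqrt_nonneg _)]; exact Real.sqrt_le_sqrt (a_add_b_le ξ)
  have hDc : ∀ ξ, |Real.sqrt (a ξ - b ξ)| ≤ Real.sqrt K := fun ξ => by
    rw [abs_of_nonneg (Real.sqrt_nonneg _)]; exact Real.sqrt_le_sqrt (a_sub_b_le ξ)
  have hIp : ∀ s, 0 ≤ s → Integrable (fun ξ => (a ξ + b ξ) * ‖p s ξ‖ ^ 2)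
      (volume.restrict (Set.Icc 0 1)) := fun s hs => by
    have := memLp_two_integrable_weight (hp s hs) hS.sqrt hSc
    simpa only [hS1] using this
  have hIm : ∀ s, 0 ≤ s → Integrable (fun ξ => (a ξ - b ξ) * ‖m s ξ‖ ^ 2)
      (volume.restrict (Set.Icc 0 1)) := fun s hs => by
    have := memLp_two_integrable_weight (hm s hs) hD.sqrt hDc
    simpa only [hD1] using this
  refine Integrable.ae_eq_of_forall_setIntegral_eq _ _ ((hIp t ht).add (hIm t ht))
    ((hIp 0 le_rfl).add (hIm 0 le_rfl)) fun S _ _ => ?_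
  have hder : ∀ s, 0 ≤ s → HasDerivWithinAt (fun s =>
      (∫ ξ in S, (a ξ + b ξ) * ‖p s ξ‖ ^ 2 ∂(volume.restrict (Set.Icc 0 1))) +
        ∫ ξ in S, (a ξ - b ξ) * ‖m s ξ‖ ^ 2 ∂(volume.restrict (Set.Icc 0 1))) 0 (Set.Ici 0) s := by
    intro s hs
    have h1 := (hp' s hs).hasDerivWithinAt_integral hs hp
      ((memLp_bdd_mul hD hDb (hm s hs)).const_mul _) hS.sqrt hSc S
    have h2 := (hm' s hs).hasDerivWithinAt_integral hs hm
      ((memLp_bdd_mul hS hSb (hp s hs)).const_mul _) hD.sqrt hDc S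
    simp only [hS1, hD1] at h1 h2
    refine (h1.add h2).congr_deriv ?_
    rw [← mul_add, mul_eq_zero]
    right
    -- both terms carry the factor `(a + b)(a - b)`, and `Re (-i (conj p m + conj m p)) = 0`
    rw [add_eq_zero_iff_eq_neg, ← integral_neg]
    refine integral_congr_ae (Eventually.of_forall fun ξ => ?_)
    simp [Complex.mul_re, Complex.mul_im]
    ring
  have hconst := constant_of_has_deriv_right_zero (a := 0) (b := t)
    (f := fun s => (∫ ξ in S, (a ξ + b ξ) * ‖p s ξ‖ ^ 2 ∂(volume.restrict (Set.Icc 0 1))) +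
        ∫ ξ in S, (a ξ - b ξ) * ‖m s ξ‖ ^ 2 ∂(volume.restrict (Set.Icc 0 1)))
    (fun s hs => ((hder s hs.1).continuousWithinAt).mono Set.Icc_subset_Ici_self)
    (fun s hs => (hder s hs.1).mono (Set.Ici_subset_Ici.2 hs.1)) t (Set.right_mem_Icc.2 ht)
  rw [← integral_add (hIp t ht).integrableOn (hIm t ht).integrableOn,
    ← integral_add (hIp 0 le_rfl).integrableOn (hIm 0 le_rfl).integrableOn] at hconst
  exact hconst

/-! ### Weighted bounds -/

lemma normL2_le_add_mul {u v w : ℝ → ℂ}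
    (hu : AEStronglyMeasurable u (volume.restrict (Set.Icc 0 1)))
    (hv : AEStronglyMeasurable v (volume.restrict (Set.Icc 0 1))) {c d : ℝ} (hc : 0 ≤ c)
    (hd : 0 ≤ d) (h : ∀ᵐ ξ ∂(volume.restrict (Set.Icc (0 : ℝ) 1)),
      ‖w ξ‖ ≤ c * ‖u ξ‖ + d * ‖v ξ‖) :
    normL2 w ≤ ENNReal.ofReal c * normL2 u + ENNReal.ofReal d * normL2 v := by
  unfold normL2
  have h1 : eLpNorm w 2 (volume.restrict (Set.Icc 0 1)) ≤
      eLpNorm ((fun ξ => c * ‖u ξ‖) + fun ξ => d * ‖v ξ‖) 2 (volume.restrict (Set.Icc 0 1)) :=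
    eLpNorm_mono_ae_real h
  refine h1.trans ((eLpNorm_add_le (hu.norm.const_mul c) (hv.norm.const_mul d) one_le_two).trans
    (add_le_add ?_ ?_))
  · refine eLpNorm_le_mul_eLpNorm_of_ae_le_mul (Eventually.of_forall fun ξ => ?_) 2
    rw [Real.norm_of_nonneg (mul_nonneg hc (norm_nonneg _))]
  · refine eLpNorm_le_mul_eLpNorm_of_ae_le_mul (Eventually.of_forall fun ξ => ?_) 2
    rw [Real.norm_of_nonneg (mul_nonneg hd (norm_nonneg _))]

/-- Pointwise consequence of the conservation law, divided by powers of `μ`. The constants do not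
depend on `j`, since both sides are divided by the same power. -/
lemma weighted_le_of_energy {ξ : ℝ} (hξ : ξ ∈ Set.Ioo (0 : ℝ) 1) {p m p₀ m₀ : ℂ} (j : ℝ)
    (h : (a ξ + b ξ) * ‖p‖ ^ 2 + (a ξ - b ξ) * ‖m‖ ^ 2 =
      (a ξ + b ξ) * ‖p₀‖ ^ 2 + (a ξ - b ξ) * ‖m₀‖ ^ 2) :
    ‖p / ((mu ξ ^ (j + 1) : ℝ) : ℂ)‖ ≤ 1 * ‖p₀ / ((mu ξ ^ (j + 1) : ℝ) : ℂ)‖ +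
        2 * (gam * Real.sqrt Real.pi) * ‖m₀ / ((mu ξ ^ j : ℝ) : ℂ)‖ ∧
      ‖m / ((mu ξ ^ j : ℝ) : ℂ)‖ ≤ 7 / (gam * Real.sqrt Real.pi) *
        ‖p₀ / ((mu ξ ^ (j + 1) : ℝ) : ℂ)‖ + 1 * ‖m₀ / ((mu ξ ^ j : ℝ) : ℂ)‖ := by
  have hμ := mu_pos hξ
  have hμ2 := mu_sq ξ
  have hSpos := a_add_b_pos ξ
  have hDpos := a_sub_b_pos hξ
  have hS1 := a_add_b_ge ξ
  have hS2 := a_add_b_le ξ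
  have hg := gam_mul_sqrt_pi_pos
  set S := a ξ + b ξ
  set D := a ξ - b ξ
  have hj : 0 < mu ξ ^ j := Real.rpow_pos_of_pos hμ j
  have hj1 : mu ξ ^ (j + 1) = mu ξ ^ j * mu ξ := by rw [Real.rpow_add hμ, Real.rpow_one]
  -- `|p| ≤ |p₀| + (μ / (a + b)) |m₀|` and `|m| ≤ |m₀| + ((a + b) / μ) |p₀|`
  have hp : ‖p‖ ≤ ‖p₀‖ + mu ξ / S * ‖m₀‖ := by
    refine le_of_sq_le_sq ?_ (by positivity)
    have e : (mu ξ / S) ^ 2 = D / S := by rw [div_pow, hμ2]; field_simp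
    have h1 : ‖p‖ ^ 2 ≤ ‖p₀‖ ^ 2 + D / S * ‖m₀‖ ^ 2 := by
      rw [div_mul_eq_mul_div, ← sub_le_iff_le_add', le_div_iff₀ hSpos]
      nlinarith [mul_nonneg hDpos.le (sq_nonneg ‖m‖)]
    have h2 : 0 ≤ ‖p₀‖ * (mu ξ / S * ‖m₀‖) := by positivity
    calc ‖p‖ ^ 2 ≤ ‖p₀‖ ^ 2 + (mu ξ / S) ^ 2 * ‖m₀‖ ^ 2 := by rw [e]; exact h1
      _ ≤ _ := by nlinarith
  have hm : ‖m‖ ≤ S / mu ξ * ‖p₀‖ + ‖m₀‖ := by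
    refine le_of_sq_le_sq ?_ (by positivity)
    have e : (S / mu ξ) ^ 2 = S / D := by rw [div_pow, hμ2]; field_simp
    have h1 : ‖m‖ ^ 2 ≤ S / D * ‖p₀‖ ^ 2 + ‖m₀‖ ^ 2 := by
      rw [div_mul_eq_mul_div, ← sub_le_iff_le_add, le_div_iff₀ hDpos]
      nlinarith [mul_nonneg hSpos.le (sq_nonneg ‖p‖)]
    have h2 : 0 ≤ ‖m₀‖ * (S / mu ξ * ‖p₀‖) := by positivity
    calc ‖m‖ ^ 2 ≤ (S / mu ξ) ^ 2 * ‖p₀‖ ^ 2 + ‖m₀‖ ^ 2 := by rw [e]; exact h1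
      _ ≤ _ := by nlinarith
  have hSinv : 1 / S ≤ 2 * (gam * Real.sqrt Real.pi) := by
    rw [div_le_iff₀ hSpos]
    rw [div_le_iff₀ (by positivity)] at hS1
    linarith
  simp only [norm_div, Complex.norm_real]
  rw [Real.norm_of_nonneg hj.le, Real.norm_of_nonneg (by rw [hj1]; positivity), hj1]
  constructor
  · rw [div_le_iff₀ (by positivity)]
    have e : (1 * (‖p₀‖ / (mu ξ ^ j * mu ξ)) + 2 * (gam * Real.sqrt Real.pi) *
        (‖m₀‖ / mu ξ ^ j)) * (mu ξ ^ j * mu ξ) =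
        ‖p₀‖ + 2 * (gam * Real.sqrt Real.pi) * (mu ξ * ‖m₀‖) := by field_simp
    rw [e]
    have := mul_le_mul_of_nonneg_right hSinv (by positivity : 0 ≤ mu ξ * ‖m₀‖)
    have e2 : mu ξ / S * ‖m₀‖ = 1 / S * (mu ξ * ‖m₀‖) := by ring
    linarith
  · rw [div_le_iff₀ hj]
    have e : (7 / (gam * Real.sqrt Real.pi) * (‖p₀‖ / (mu ξ ^ j * mu ξ)) +
        1 * (‖m₀‖ / mu ξ ^ j)) * mu ξ ^ j =
        7 / (gam * Real.sqrt Real.pi) * (‖p₀‖ / mu ξ) + ‖m₀‖ := by field_simp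
    rw [e]
    have := mul_le_mul_of_nonneg_right hS2 (by positivity : 0 ≤ ‖p₀‖ / mu ξ)
    have e2 : S / mu ξ * ‖p₀‖ = S * (‖p₀‖ / mu ξ) := by ring
    linarith

lemma reflect_fourierRHS (f : ℝ → ℂ) (ξ : ℝ) :
    reflect (fourierRHS f) ξ = Complex.I * (a ξ * reflect f ξ + b ξ * f ξ) := by
  unfold fourierRHS reflect
  simp [a_neg, b_neg]

/-- The conserved density, for the Fourier transform of a solution. -/
lemma IsSolution.energy_ae_eq {v : ℝ → ℂ → ℂ} {f : ℝ → ℝ → ℂ} (hv : IsSolution v)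
    (hf : ∀ t : ℝ, 0 ≤ t → IsFourierSum (coeff (v t)) (f t)) {t : ℝ} (ht : 0 ≤ t) :
    ∀ᵐ ξ ∂(volume.restrict (Set.Icc (0 : ℝ) 1)),
      (a ξ + b ξ) * ‖f t ξ + reflect (f t) ξ‖ ^ 2 + (a ξ - b ξ) * ‖f t ξ - reflect (f t) ξ‖ ^ 2 =
        (a ξ + b ξ) * ‖f 0 ξ + reflect (f 0) ξ‖ ^ 2 +
          (a ξ - b ξ) * ‖f 0 ξ - reflect (f 0) ξ‖ ^ 2 := by
  have hper : ∀ s, 0 ≤ s → Function.Periodic (f s) 1 := fun s hs => (hf s hs).periodic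
  have hfL : ∀ s, 0 ≤ s → MemLp (f s) 2 (volume.restrict (Set.Icc 0 1)) :=
    fun s hs => (hf s hs).memLp
  have hgL : ∀ s, 0 ≤ s → MemLp (reflect (f s)) 2 (volume.restrict (Set.Icc 0 1)) :=
    fun s hs => memLp_reflect (hper s hs) (hfL s hs)
  have hRL : ∀ s, 0 ≤ s → MemLp (fourierRHS (f s)) 2 (volume.restrict (Set.Icc 0 1)) :=
    fun s hs => memLp_fourierRHS (hper s hs) (hfL s hs)
  have hRp : ∀ s, 0 ≤ s → Function.Periodic (fourierRHS (f s)) 1 :=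
    fun s hs => periodic_fourierRHS (hper s hs)
  have hf' : ∀ s, 0 ≤ s → HasL2Deriv f (fourierRHS (f s)) s := fun s hs => hv.hasL2Deriv hf hs
  have hg' : ∀ s, 0 ≤ s → HasL2Deriv (fun s => reflect (f s)) (reflect (fourierRHS (f s))) s :=
    fun s hs => (hf' s hs).reflect hs hper (hRp s hs) hfL (hRL s hs)
  have hmain := Abrikosov.energy_ae_eq (p := fun s ξ => f s ξ + reflect (f s) ξ)
    (m := fun s ξ => f s ξ + -reflect (f s) ξ) (fun s hs => (hfL s hs).add (hgL s hs))
    (fun s hs => (hfL s hs).add (hgL s hs).neg) (fun s hs => ?_) (fun s hs => ?_) ht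
  · simpa only [← sub_eq_add_neg] using hmain
  · have h := (hf' s hs).add hs hfL hgL (hRL s hs) (memLp_reflect (hRp s hs) (hRL s hs)) (hg' s hs)
    refine Eq.mp (congrArg (fun F => HasL2Deriv _ F s) (funext fun ξ => ?_)) h
    rw [reflect_fourierRHS, fourierRHS]
    push_cast
    ring
  · have h := (hf' s hs).add hs hfL (fun s hs => (hgL s hs).neg) (hRL s hs)
      (memLp_reflect (hRp s hs) (hRL s hs)).neg (hg' s hs).neg
    refine Eq.mp (congrArg (fun F => HasL2Deriv _ F s) (funext fun ξ => ?_)) h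
    simp only [Pi.neg_apply]
    rw [reflect_fourierRHS, fourierRHS]
    push_cast
    ring

lemma aestronglyMeasurable_div_mu_rpow {F : ℝ → ℂ} {ν : Measure ℝ} (hF : AEStronglyMeasurable F ν)
    (r : ℝ) : AEStronglyMeasurable (fun ξ => F ξ / ((mu ξ ^ r : ℝ) : ℂ)) ν := by
  have h : Measurable fun ξ => ((mu ξ ^ r : ℝ) : ℂ) :=
    Complex.measurable_ofReal.comp (continuous_mu.measurable.pow_const r)
  exact (hF.aemeasurable.div h.aemeasurable).aestronglyMeasurable

/-- The stability constant. Its second term bounds `1 / (a + b)`, and its third bounds both `a + b`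
and `μ`. -/
def stabConst : ℝ := 1 + 2 * (gam * Real.sqrt Real.pi) + 7 / (gam * Real.sqrt Real.pi)

lemma one_le_stabConst : 1 ≤ stabConst := by
  have := gam_mul_sqrt_pi_pos
  unfold stabConst
  have : 0 ≤ 2 * (gam * Real.sqrt Real.pi) + 7 / (gam * Real.sqrt Real.pi) := by positivity
  linarith

lemma mu_le_stabConst (ξ : ℝ) : mu ξ ≤ stabConst := by
  have := gam_mul_sqrt_pi_pos
  have := mu_le ξ
  unfold stabConst
  have : 0 ≤ 2 * (gam * Real.sqrt Real.pi) := by positivity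
  linarith

lemma ae_mem_Ioo : ∀ᵐ ξ ∂(volume.restrict (Set.Icc (0 : ℝ) 1)), ξ ∈ Set.Ioo (0 : ℝ) 1 := by
  rw [← Measure.restrict_congr_set Ioo_ae_eq_Icc]
  exact ae_restrict_mem measurableSet_Ioo

/-- The estimate with the weights `μ^{-j-1}` and `μ^{-j}`. -/
lemma weighted_stability {p m p₀ m₀ : ℝ → ℂ}
    (hp₀ : AEStronglyMeasurable p₀ (volume.restrict (Set.Icc 0 1)))
    (hm₀ : AEStronglyMeasurable m₀ (volume.restrict (Set.Icc 0 1)))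
    (h : ∀ᵐ ξ ∂(volume.restrict (Set.Icc (0 : ℝ) 1)),
      (a ξ + b ξ) * ‖p ξ‖ ^ 2 + (a ξ - b ξ) * ‖m ξ‖ ^ 2 =
        (a ξ + b ξ) * ‖p₀ ξ‖ ^ 2 + (a ξ - b ξ) * ‖m₀ ξ‖ ^ 2) (j : ℝ) :
    normL2 (fun ξ => p ξ / ((mu ξ ^ (j + 1) : ℝ) : ℂ)) +
        normL2 (fun ξ => m ξ / ((mu ξ ^ j : ℝ) : ℂ)) ≤
      ENNReal.ofReal stabConst * (normL2 (fun ξ => p₀ ξ / ((mu ξ ^ (j + 1) : ℝ) : ℂ)) +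
        normL2 (fun ξ => m₀ ξ / ((mu ξ ^ j : ℝ) : ℂ))) := by
  have hg := gam_mul_sqrt_pi_pos
  set X := normL2 (fun ξ => p₀ ξ / ((mu ξ ^ (j + 1) : ℝ) : ℂ))
  set Y := normL2 (fun ξ => m₀ ξ / ((mu ξ ^ j : ℝ) : ℂ))
  have h1 := normL2_le_add_mul (aestronglyMeasurable_div_mu_rpow hp₀ (j + 1))
    (aestronglyMeasurable_div_mu_rpow hm₀ j) zero_le_one
    (by positivity : 0 ≤ 2 * (gam * Real.sqrt Real.pi))
    (w := fun ξ => p ξ / ((mu ξ ^ (j + 1) : ℝ) : ℂ)) (by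
      filter_upwards [h, ae_mem_Ioo] with ξ h1 h2 using (weighted_le_of_energy h2 j h1).1)
  have h2 := normL2_le_add_mul (aestronglyMeasurable_div_mu_rpow hp₀ (j + 1))
    (aestronglyMeasurable_div_mu_rpow hm₀ j)
    (by positivity : 0 ≤ 7 / (gam * Real.sqrt Real.pi)) zero_le_one
    (w := fun ξ => m ξ / ((mu ξ ^ j : ℝ) : ℂ)) (by
      filter_upwards [h, ae_mem_Ioo] with ξ h1 h2 using (weighted_le_of_energy h2 j h1).2)
  refine (add_le_add h1 h2).trans ?_
  change ENNReal.ofReal 1 * X + ENNReal.ofReal _ * Y + (ENNReal.ofReal _ * X +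
    ENNReal.ofReal 1 * Y) ≤ _
  unfold stabConst
  rw [ENNReal.ofReal_add (by positivity) (by positivity),
    ENNReal.ofReal_add (by positivity) (by positivity)]
  generalize ENNReal.ofReal (2 * (gam * Real.sqrt Real.pi)) = α
  generalize ENNReal.ofReal (7 / (gam * Real.sqrt Real.pi)) = β
  rw [ENNReal.ofReal_one]
  calc 1 * X + α * Y + (β * X + 1 * Y) ≤ 1 * X + α * Y + (β * X + 1 * Y) + (α * X + β * Y) :=
        le_self_add
    _ = (1 + α + β) * (X + Y) := by ring

/-- The case `j = 0`, in terms of `f = (p + m) / 2`. -/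
lemma unweighted_stability {f g f₀ g₀ : ℝ → ℂ}
    (hf : AEStronglyMeasurable f (volume.restrict (Set.Icc 0 1)))
    (hg : AEStronglyMeasurable g (volume.restrict (Set.Icc 0 1)))
    (hf₀ : AEStronglyMeasurable f₀ (volume.restrict (Set.Icc 0 1)))
    (hg₀ : AEStronglyMeasurable g₀ (volume.restrict (Set.Icc 0 1)))
    (h : ∀ᵐ ξ ∂(volume.restrict (Set.Icc (0 : ℝ) 1)),
      (a ξ + b ξ) * ‖f ξ + g ξ‖ ^ 2 + (a ξ - b ξ) * ‖f ξ - g ξ‖ ^ 2 =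
        (a ξ + b ξ) * ‖f₀ ξ + g₀ ξ‖ ^ 2 + (a ξ - b ξ) * ‖f₀ ξ - g₀ ξ‖ ^ 2) :
    normL2 (fun ξ => (f ξ + g ξ) / (mu ξ : ℂ)) + normL2 f ≤
      ENNReal.ofReal (6 * stabConst ^ 3) *
        (normL2 (fun ξ => (f₀ ξ + g₀ ξ) / (mu ξ : ℂ)) + normL2 f₀) := by
  have hC := one_le_stabConst
  have hw := weighted_stability (hf₀.add hg₀) (hf₀.sub hg₀) h 0
  simp only [zero_add, Real.rpow_one, Real.rpow_zero, Complex.ofReal_one, div_one,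
    Pi.add_apply, Pi.sub_apply] at hw
  have hdiv : ∀ {F : ℝ → ℂ}, AEStronglyMeasurable F (volume.restrict (Set.Icc 0 1)) →
      AEStronglyMeasurable (fun ξ => F ξ / (mu ξ : ℂ)) (volume.restrict (Set.Icc 0 1)) :=
    fun hF => by simpa only [Real.rpow_one] using aestronglyMeasurable_div_mu_rpow hF 1
  -- `‖p‖ ≤ (sup μ) ‖p / μ‖`
  have hmul : ∀ {ξ : ℝ}, ξ ∈ Set.Ioo (0 : ℝ) 1 → ∀ p : ℂ,
      ‖p‖ ≤ stabConst * ‖p / (mu ξ : ℂ)‖ := fun {ξ} hξ p => by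
    have hμ := mu_pos hξ
    rw [norm_div, Complex.norm_real, Real.norm_of_nonneg hμ.le, mul_div_assoc', le_div_iff₀ hμ,
      mul_comm]
    exact mul_le_mul_of_nonneg_right (mu_le_stabConst ξ) (norm_nonneg _)
  have h1 : normL2 f ≤ ENNReal.ofReal stabConst * normL2 (fun ξ => (f ξ + g ξ) / (mu ξ : ℂ)) +
      ENNReal.ofReal 1 * normL2 (fun ξ => f ξ - g ξ) := by
    refine normL2_le_add_mul (hdiv (hf.add hg)) (hf.sub hg) (by linarith) zero_le_one ?_
    filter_upwards [ae_mem_Ioo] with ξ hξ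
    have h2 : ‖f ξ + f ξ‖ ≤ ‖f ξ + g ξ‖ + ‖f ξ - g ξ‖ := by
      rw [show f ξ + f ξ = (f ξ + g ξ) + (f ξ - g ξ) by ring]; exact norm_add_le _ _
    have h3 : ‖f ξ + f ξ‖ = 2 * ‖f ξ‖ := by rw [← two_mul, norm_mul]; simp
    have h4 := hmul hξ (f ξ + g ξ)
    simp only [Pi.add_apply, Pi.sub_apply]
    linarith [norm_nonneg (f ξ + g ξ), norm_nonneg (f ξ - g ξ)]
  have h2 : normL2 (fun ξ => f₀ ξ - g₀ ξ) ≤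
      ENNReal.ofReal stabConst * normL2 (fun ξ => (f₀ ξ + g₀ ξ) / (mu ξ : ℂ)) +
      ENNReal.ofReal 2 * normL2 f₀ := by
    refine normL2_le_add_mul (hdiv (hf₀.add hg₀)) hf₀ (by linarith) zero_le_two ?_
    filter_upwards [ae_mem_Ioo] with ξ hξ
    have h3 : ‖f₀ ξ - g₀ ξ‖ ≤ 2 * ‖f₀ ξ‖ + ‖f₀ ξ + g₀ ξ‖ := by
      rw [show f₀ ξ - g₀ ξ = 2 * f₀ ξ - (f₀ ξ + g₀ ξ) by ring]
      refine (norm_sub_le _ _).trans ?_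
      rw [norm_mul]; simp
    have h4 := hmul hξ (f₀ ξ + g₀ ξ)
    simp only [Pi.add_apply]
    linarith
  set P := normL2 (fun ξ => (f ξ + g ξ) / (mu ξ : ℂ))
  set M := normL2 (fun ξ => f ξ - g ξ)
  set P₀ := normL2 (fun ξ => (f₀ ξ + g₀ ξ) / (mu ξ : ℂ))
  set M₀ := normL2 (fun ξ => f₀ ξ - g₀ ξ)
  change P + M ≤ ENNReal.ofReal stabConst * (P₀ + M₀) at hw
  have hpow : ENNReal.ofReal (6 * stabConst ^ 3) = 6 * ENNReal.ofReal stabConst ^ 3 := by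
    rw [ENNReal.ofReal_mul (by norm_num), ENNReal.ofReal_pow (by linarith)]; norm_num
  rw [hpow]
  have hC' : 1 ≤ ENNReal.ofReal stabConst := by rwa [ENNReal.one_le_ofReal]
  rw [ENNReal.ofReal_one] at h1
  rw [ENNReal.ofReal_ofNat] at h2
  generalize ENNReal.ofReal stabConst = C at *
  have hCC : ∀ x : ℝ≥0∞, x ≤ C * x := fun x => le_mul_of_one_le_left zero_le hC'
  calc P + normL2 f ≤ P + (C * P + 1 * M) := by gcongr
    _ ≤ C * P + (C * P + C * M) := by gcongr; exact hCC P
    _ ≤ C * P + (C * P + C * M) + C * M := le_self_add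
    _ = 2 * C * (P + M) := by ring
    _ ≤ 2 * C * (C * (P₀ + (C * P₀ + 2 * normL2 f₀))) := by gcongr; exact hw.trans (by gcongr)
    _ ≤ 2 * C * (C * (C * P₀ + (C * P₀ + 2 * (C * normL2 f₀)))) := by
        gcongr
        · exact hCC P₀
        · exact hCC _
    _ ≤ 2 * C * (C * (C * P₀ + (C * P₀ + 2 * (C * normL2 f₀)))) +
        (2 * C ^ 3 * P₀ + 2 * C ^ 3 * normL2 f₀) := le_self_add
    _ = 6 * C ^ 3 * (P₀ + normL2 f₀) := by ring

end

end Abrikosov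

theorem theorem5p9 :
    -- the weight is well defined, positive inside the period, and `μ(ξ) ∼ κ ξ²` at `0`
    (∀ ξ ∈ Set.Ioo (0 : ℝ) 1, Abrikosov.b ξ ^ 2 < Abrikosov.a ξ ^ 2) ∧
    (∃ κ : ℝ, 0 < κ ∧
      Tendsto (fun ξ : ℝ => Abrikosov.mu ξ / ξ ^ 2) (𝓝[≠] 0) (𝓝 κ)) ∧
    -- stability, with a constant that does not depend on the solution, on `t` or on `j`
    ∃ C : ℝ≥0, ∀ (v : ℝ → ℂ → ℂ) (f g : ℝ → ℝ → ℂ),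
      Abrikosov.IsSolution v →
      (∀ t : ℝ, 0 ≤ t → Abrikosov.IsFourierSum (Abrikosov.coeff (v t)) (f t)) →
      (∀ t ξ : ℝ, g t ξ = Abrikosov.reflect (f t) ξ) →
      ∀ t : ℝ, 0 ≤ t →
        (Abrikosov.normL2 (fun ξ => (f t ξ + g t ξ) / (Abrikosov.mu ξ : ℂ)) +
            Abrikosov.normL2 (f t) ≤
          C * (Abrikosov.normL2 (fun ξ => (f 0 ξ + g 0 ξ) / (Abrikosov.mu ξ : ℂ)) +
            Abrikosov.normL2 (f 0))) ∧
        ∀ j : ℝ,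
          Abrikosov.normL2 (fun ξ => (f t ξ + g t ξ) / ((Abrikosov.mu ξ ^ (j + 1) : ℝ) : ℂ)) +
              Abrikosov.normL2 (fun ξ => (f t ξ - g t ξ) / ((Abrikosov.mu ξ ^ j : ℝ) : ℂ)) ≤
            C * (Abrikosov.normL2
                (fun ξ => (f 0 ξ + g 0 ξ) / ((Abrikosov.mu ξ ^ (j + 1) : ℝ) : ℂ)) +
              Abrikosov.normL2
                (fun ξ => (f 0 ξ - g 0 ξ) / ((Abrikosov.mu ξ ^ j : ℝ) : ℂ))) := by
  refine ⟨fun ξ hξ => Abrikosov.sq_b_lt_sq_a hξ, Abrikosov.exists_tendsto_mu_div_sq,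
    (6 * Abrikosov.stabConst ^ 3).toNNReal, fun v f g hv hf hg t ht => ?_⟩
  have hper : ∀ s, 0 ≤ s → Function.Periodic (f s) 1 := fun s hs => (hf s hs).periodic
  have hfL : ∀ s, 0 ≤ s → AEStronglyMeasurable (f s) (volume.restrict (Set.Icc 0 1)) :=
    fun s hs => (hf s hs).memLp.1
  have hgL : ∀ s, 0 ≤ s → AEStronglyMeasurable (g s) (volume.restrict (Set.Icc 0 1)) :=
    fun s hs => by
      rw [funext (hg s)]
      exact (Abrikosov.memLp_reflect (hper s hs) (hf s hs).memLp).1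
  have hE := hv.energy_ae_eq hf ht
  simp only [← hg] at hE
  refine ⟨Abrikosov.unweighted_stability (hfL t ht) (hgL t ht) (hfL 0 le_rfl) (hgL 0 le_rfl) hE,
    fun j => ?_⟩
  refine (Abrikosov.weighted_stability ((hfL 0 le_rfl).add (hgL 0 le_rfl))
    ((hfL 0 le_rfl).sub (hgL 0 le_rfl)) hE j).trans ?_
  have hC := Abrikosov.one_le_stabConst
  refine mul_le_mul_left ?_ _
  refine ENNReal.ofReal_le_ofReal ?_
  nlinarith [pow_le_pow_right₀ hC (show 1 ≤ 3 by norm_num)]
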